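/- Let $n\ge 2$ and let $(\cdot,\cdot)$ be the standard symmetric bilinear form of signature $(n+1,1)$ on $\mathbb R^{n+2}$. The de Sitter space $S^{n+1}_1$ is the set of points of $P^{n+1}$ with $(x,x)>0$, and the absolute $Q^n$ is the set of points with $(x,x)=0$. Let $U^n\subset S^{n+1}_1$ be a smooth immersed hypersurface all of whose tangent hyperplanes are tangent to $Q^n$ (a lightlike hypersurface). Near each of its points consider the smooth adapted frames $\{A_0,A_1,\dots,A_{n-1},A_n,A_{n+1}\}$: $A_n=x$ is the point of $U^n$, $A_0$ is the point where the tangent hyperplane at $x$ touches $Q^n$, $(A_n,A_n)=1$, $(A_0,A_{n+1})=-1$, $(A_i,A_j)=g_{ij}$ for $i,j=1,\dots,n-1$ with $(g_{ij})$ positive definite, and all other scalar products vanish. Write $dA_\xi=\omega_\xi^\eta A_\eta$. Assume that $U^n$ has maximal rank: the tensor $\nu_{ij}$ in $\omega_i^{n+1}=\nu_{ij}\omega_n^j$ has rank $n-1$ at every point; let $V^{n-1}\subset Q^n$ be the submanifold described by $A_0$. Then $\omega_i^n=\lambda_{ij}\omega_0^j$ and $$d\lambda_{ij}-\lambda_{ik}\omega_j^k-\lambda_{kj}\omega_i^k+\lambda_{ij}\omega_0^0+g_{ij}\omega_n^0=\lambda_{ijk}\omega_0^k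 .$$ Put $\lambda=\frac1{n-1}\lambda_{ij}g^{ij}$, $\lambda_k=\frac1{n-1}g^{ij}\lambda_{ijk}$, $a_{ij}=\lambda_{ij}-\lambda g_{ij}$, $a_i^j=g^{jk}a_{ki}$, $C_i=\lambda_iA_0-a_i^jA_j$, let $C=A_n+\lambda A_0$ be the harmonic pole, and let $W$ be the submanifold described by $C$. Suppose that the tensor $a_{ij}$ is nondegenerate at every point. Then adapted frames and the quantities above exist near every point, and: (1) The points $C_1,\dots,C_{n-1}$ are linearly independent. The $(n-2)$-dimensional projective subspace $\zeta=C_1\wedge\dots\wedge C_{n-1}$ does not depend on the adapted frame, depends smoothly on the point, equals $T_{A_0}(V^{n-1})\cap T_C(W)$, lies in $T_{A_0}(V^{n-1})$ and does not contain $A_0$. So the subspaces $\zeta$ form a normalization of $U^n$. (2) This normalization is invariant: it is equivariant under all linear transformations preserving $(\cdot,\cdot)$, independent of the parametrization, and unchanged when $x$ is displaced along its isotropic generator $A_nA_0$. It is determined by the third-order differential neighborhood: lightlike hypersurfaces of maximal rank with the same 3-jet at a point have the same $\zeta$ there. (3) The screens $\Delta_x=x\wedge\zeta$ form a smooth distribution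 of $(n-1)$-dimensional elements on $U^n$ complementary to the isotropic direction, and this distribution is invariant under all linear transformations preserving $(\cdot,\cdot)$ and under reparametrizations. (4) Adapted frames with $A_i\in\zeta$ exist near every point, and there is a smooth torsion-free affine connection on $U^n$ whose connection form with respect to the coframe $(\omega_n^0,\omega_n^i)$ of every such frame is $\begin{pmatrix}\omega_0^0&\omega_i^0\\ \omega_0^i&\omega_j^i\end{pmatrix}$. It is uniquely determined by this, and it is invariant under all linear transformations preserving $(\cdot,\cdot)$ and under reparametrizations. -/

import Mathlib

open scoped Manifold ContDiff Topology
open scoped LinearAlgebra.Projectivization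

universe u

namespace DeSitter

noncomputable section

/-- The vector space whose projectivization is `P^{n+1}`. Its Euclidean norm is used only for
differential calculus. -/
abbrev V (n : ℕ) : Type := EuclideanSpace ℝ (Fin (n + 2))

/-- The quadratic form `(x, x)` of signature `(n+1, 1)` (as a symmetric bilinear form). The absolute
`Q^n` is `(x, x) = 0`; the de Sitter space `S^{n+1}_1` is the set of points of `P^{n+1}` with
`(x, x) > 0`. -/
def form (n : ℕ) : LinearMap.BilinForm ℝ (V n) :=
  LinearMap.mk₂ ℝ
    (fun x y => (∑ i : Fin (n + 1), x i.castSucc * y i.castSucc)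
      - x (Fin.last (n + 1)) * y (Fin.last (n + 1)))
    (fun x x' y => by simp [add_mul, Finset.sum_add_distrib]; ring)
    (fun c x y => by simp [mul_assoc, Finset.mul_sum, mul_sub])
    (fun x y y' => by simp [mul_add, Finset.sum_add_distrib]; ring)
    (fun c x y => by simp [mul_left_comm, Finset.mul_sum, mul_sub])

/-- Linear representatives of the motions of the de Sitter space (and of the conformal
transformations of `Q^n`): linear automorphisms preserving `(x, y)`. -/
def IsMotion {n : ℕ} (T : V n ≃ₗ[ℝ] V n) : Prop :=
  ∀ x y, form n (T x) (T y) = form n x y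

section Hypersurface

variable {n : ℕ} {M : Type u} [TopologicalSpace M] [ChartedSpace (EuclideanSpace ℝ (Fin n)) M]

/-- `x` is, on the open set `O`, a smooth representative of the map `X` to projective space,
normalized by `(x, x) = 1`. -/
structure IsLift (X : M → ℙ ℝ (V n)) (O : Set M) (x : M → V n) : Prop where
  isOpen : IsOpen O
  smooth : ContMDiffOn (𝓡 n) 𝓘(ℝ, V n) ∞ x O
  normalized : ∀ q ∈ O, form n (x q) (x q) = 1
  represents : ∀ q ∈ O, (X q).submodule = Submodule.span ℝ {x q}

/-- The projective tangent subspace `η = T_x(U^n)` at the point `p` (as a linear subspace). All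
normalized representatives give the same subspace. -/
def tangentPlane (X : M → ℙ ℝ (V n)) (p : M) : Submodule ℝ (V n) :=
  ⨆ (O : Set M) (x : M → V n) (_ : p ∈ O ∧ IsLift X O x),
    Submodule.span ℝ {x p} ⊔ LinearMap.range (mvfderiv (𝓡 n) x p).toLinearMap

/-- `X` is an immersed hypersurface `U^n` of the de Sitter space whose tangent hyperplanes are all
tangent to the absolute, that is, each is the polar hyperplane of a point `y` of the absolute. -/
structure IsLightlikeHypersurface (X : M → ℙ ℝ (V n)) : Prop where
  exists_lift : ∀ p, ∃ O x, p ∈ O ∧ IsLift X O x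
  immersion : ∀ p O x, p ∈ O → IsLift X O x → Function.Injective (mvfderiv (𝓡 n) x p)
  lightlike : ∀ p, ∃ y : V n, y ≠ 0 ∧ form n y y = 0 ∧
    ∀ z, z ∈ tangentPlane X p ↔ form n y z = 0

/-- The isotropic generator `A_n A_0` through `X p`: the line joining `X p` to the pole of the
tangent hyperplane, i.e. to its point of tangency with the absolute. -/
def generator (X : M → ℙ ℝ (V n)) (p : M) : Submodule ℝ (V n) :=
  (X p).submodule ⊔ (form n).orthogonal (tangentPlane X p)

/-- An adapted moving frame `{A_0, A_i, A_n, A_{n+1}}` of the hypersurface `X` on a neighbourhood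
`dom` of `p`: the point `A_n` is the point `x` of the hypersurface, the Gram matrix is
`(A_0, A_{n+1}) = -1`, `(A_i, A_j) = g_{ij}`, `(A_n, A_n) = 1`, all others zero, and `A_0` is the
point of tangency of the tangent hyperplane with the absolute (`ω_n^{n+1} = 0`). The index `i` runs
over `n - 1` values. -/
structure AdaptedFrame (X : M → ℙ ℝ (V n)) (p : M) where
  dom : Set M
  isOpen_dom : IsOpen dom
  mem_dom : p ∈ dom
  A0 : M → V n
  A : Fin (n - 1) → M → V n
  An : M → V n
  Ainf : M → V n
  smooth_A0 : ContMDiffOn (𝓡 n) 𝓘(ℝ, V n) ∞ A0 dom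
  smooth_A : ∀ i, ContMDiffOn (𝓡 n) 𝓘(ℝ, V n) ∞ (A i) dom
  isLift_An : IsLift X dom An
  smooth_Ainf : ContMDiffOn (𝓡 n) 𝓘(ℝ, V n) ∞ Ainf dom
  form_A0_A0 : ∀ q ∈ dom, form n (A0 q) (A0 q) = 0
  form_A0_A : ∀ q ∈ dom, ∀ i, form n (A0 q) (A i q) = 0
  form_A0_An : ∀ q ∈ dom, form n (A0 q) (An q) = 0
  form_A0_Ainf : ∀ q ∈ dom, form n (A0 q) (Ainf q) = -1
  form_A_An : ∀ q ∈ dom, ∀ i, form n (A i q) (An q) = 0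
  form_A_Ainf : ∀ q ∈ dom, ∀ i, form n (A i q) (Ainf q) = 0
  form_An_Ainf : ∀ q ∈ dom, form n (An q) (Ainf q) = 0
  form_Ainf_Ainf : ∀ q ∈ dom, form n (Ainf q) (Ainf q) = 0
  linearIndependent_A : ∀ q ∈ dom, LinearIndependent ℝ (fun i => A i q)
  tangent : ∀ q ∈ dom, ∀ v : TangentSpace (𝓡 n) q, form n (mvfderiv (𝓡 n) An q v) (A0 q) = 0

namespace AdaptedFrame

variable {X : M → ℙ ℝ (V n)} {p : M} (F : AdaptedFrame X p)

/-- The tensor `g_{ij} = (A_i, A_j)`. -/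
def g (q : M) : Matrix (Fin (n - 1)) (Fin (n - 1)) ℝ :=
  Matrix.of fun i j => form n (F.A i q) (F.A j q)

/-! The coefficients of a vector in the frame at `q`,
`z = c_0 A_0 + c_i A_i + c_n A_n + c_{n+1} A_{n+1}`, read off from the Gram matrix. -/

/-- Coefficient at `A_0`. -/
def coeff0 (q : M) (z : V n) : ℝ := -form n z (F.Ainf q)

/-- Coefficient at `A_i`. -/
def coeff (q : M) (i : Fin (n - 1)) (z : V n) : ℝ :=
  ∑ j, (F.g q)⁻¹ i j * form n z (F.A j q)

/-- Coefficient at `A_n`. -/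
def coeffn (q : M) (z : V n) : ℝ := form n z (F.An q)

/-- Coefficient at `A_{n+1}`. -/
def coeffInf (q : M) (z : V n) : ℝ := -form n z (F.A0 q)

/-! The 1-forms `ω_ξ^η` of `dA_ξ = ω_ξ^η A_η`, for the indices that are needed.
In `omegaXY`, `X` is the lower index and `Y` the upper one; `I` stands for `i, j = 1, …, n-1`
and `Inf` for `n+1`. -/

/-- `ω_0^0` -/
def omega00 (q : M) (v : TangentSpace (𝓡 n) q) : ℝ := F.coeff0 q (mvfderiv (𝓡 n) F.A0 q v)

/-- `ω_0^i` -/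
def omega0I (q : M) (i : Fin (n - 1)) (v : TangentSpace (𝓡 n) q) : ℝ :=
  F.coeff q i (mvfderiv (𝓡 n) F.A0 q v)

/-- `ω_i^0` -/
def omegaI0 (q : M) (i : Fin (n - 1)) (v : TangentSpace (𝓡 n) q) : ℝ :=
  F.coeff0 q (mvfderiv (𝓡 n) (F.A i) q v)

/-- `ω_i^j` -/
def omegaIJ (q : M) (i j : Fin (n - 1)) (v : TangentSpace (𝓡 n) q) : ℝ :=
  F.coeff q j (mvfderiv (𝓡 n) (F.A i) q v)

/-- `ω_i^n` -/
def omegaIn (q : M) (i : Fin (n - 1)) (v : TangentSpace (𝓡 n) q) : ℝ :=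
  F.coeffn q (mvfderiv (𝓡 n) (F.A i) q v)

/-- `ω_i^{n+1}` -/
def omegaIInf (q : M) (i : Fin (n - 1)) (v : TangentSpace (𝓡 n) q) : ℝ :=
  F.coeffInf q (mvfderiv (𝓡 n) (F.A i) q v)

/-- `ω_n^0` -/
def omegan0 (q : M) (v : TangentSpace (𝓡 n) q) : ℝ := F.coeff0 q (mvfderiv (𝓡 n) F.An q v)

/-- `ω_n^i` -/
def omeganI (q : M) (i : Fin (n - 1)) (v : TangentSpace (𝓡 n) q) : ℝ :=
  F.coeff q i (mvfderiv (𝓡 n) F.An q v)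

/-- `ν` is the matrix of the second fundamental form at `q`: `ω_i^{n+1} = ν_{ij} ω_n^j`. -/
def IsNu (q : M) (ν : Matrix (Fin (n - 1)) (Fin (n - 1)) ℝ) : Prop :=
  ∀ i v, F.omegaIInf q i v = ∑ j, ν i j * F.omeganI q j v

/-- `L` is the matrix `(λ_{ij})` at `q`: `ω_i^n = λ_{ij} ω_0^j`. -/
def IsLambda (q : M) (L : Matrix (Fin (n - 1)) (Fin (n - 1)) ℝ) : Prop :=
  ∀ i v, F.omegaIn q i v = ∑ j, L i j * F.omega0I q j v

/-- `λ = (1/(n-1)) λ_{ij} g^{ij}` for a given matrix `(λ_{ij})` at `q`. -/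
def meanLambda (q : M) (L : Matrix (Fin (n - 1)) (Fin (n - 1)) ℝ) : ℝ :=
  1 / ((n : ℝ) - 1) * ∑ i, ∑ j, L i j * (F.g q)⁻¹ i j

/-- `a_{ij} = λ_{ij} - λ g_{ij}` for a given matrix `(λ_{ij})` at `q`. -/
def aTensor (q : M) (L : Matrix (Fin (n - 1)) (Fin (n - 1)) ℝ) :
    Matrix (Fin (n - 1)) (Fin (n - 1)) ℝ :=
  L - F.meanLambda q L • F.g q

/-- The quantities `λ_{ij}` near `p` and `λ_{ijk}` at `p` of the frame `F`. -/
structure Coeffs where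
  lam : M → Matrix (Fin (n - 1)) (Fin (n - 1)) ℝ
  smooth_lam : ∀ i j, ContMDiffOn (𝓡 n) 𝓘(ℝ, ℝ) ∞ (fun q => lam q i j) F.dom
  /-- `ω_i^n = λ_{ij} ω_0^j` -/
  isLambda : ∀ q ∈ F.dom, F.IsLambda q (lam q)
  lam3 : Fin (n - 1) → Fin (n - 1) → Fin (n - 1) → ℝ
  /-- `∇λ_{ij} + λ_{ij} ω_0^0 + g_{ij} ω_n^0 = λ_{ijk} ω_0^k`, where
  `∇λ_{ij} = dλ_{ij} - λ_{ik} ω_j^k - λ_{kj} ω_i^k` -/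
  lam3_eq : ∀ i j (v : TangentSpace (𝓡 n) p),
    mvfderiv (𝓡 n) (fun q => lam q i j) p v
        - ∑ k, lam p i k * F.omegaIJ p j k v - ∑ k, lam p k j * F.omegaIJ p i k v
        + lam p i j * F.omega00 p v + F.g p i j * F.omegan0 p v
      = ∑ k, lam3 i j k * F.omega0I p k v

/-- The tangent subspace at `A_0` of the submanifold `V^{n-1}` of the absolute described by the
point `A_0`. -/
def tangentV : Submodule ℝ (V n) :=
  Submodule.span ℝ {F.A0 p} ⊔ LinearMap.range (mvfderiv (𝓡 n) F.A0 p).toLinearMap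

namespace Coeffs

variable {F} (Λ : F.Coeffs)

/-- The harmonic pole `C = A_n + λ A_0` of the point `A_0` on the generator. -/
def harmonicPole (q : M) : V n := F.An q + F.meanLambda q (Λ.lam q) • F.A0 q

/-- The tangent subspace at `C` of the submanifold `W` described by the harmonic pole `C`. -/
def tangentW : Submodule ℝ (V n) :=
  Submodule.span ℝ {Λ.harmonicPole p}
    ⊔ LinearMap.range (mvfderiv (𝓡 n) Λ.harmonicPole p).toLinearMap

/-- `λ_k = (1/(n-1)) g^{ij} λ_{ijk}` -/
def lam1 (k : Fin (n - 1)) : ℝ :=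
  1 / ((n : ℝ) - 1) * ∑ i, ∑ j, (F.g p)⁻¹ i j * Λ.lam3 i j k

/-- The affinor `a_i^j = g^{jk} a_{ki}` (first argument: lower index). -/
def affinor (i j : Fin (n - 1)) : ℝ :=
  ∑ k, (F.g p)⁻¹ j k * F.aTensor p (Λ.lam p) k i

/-- The points `C_i = λ_i A_0 - a_i^j A_j`. -/
def point (i : Fin (n - 1)) : V n := Λ.lam1 i • F.A0 p - ∑ j, Λ.affinor i j • F.A j p

/-- The subspace `C_1 ∧ … ∧ C_{n-1}`. -/
def wedge : Submodule ℝ (V n) := Submodule.span ℝ (Set.range Λ.point)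

end Coeffs

end AdaptedFrame

/-- The tensor `ν_{ij}` has maximal rank `n - 1` at every point (its rank does not depend on the
frame). -/
def HasMaximalRank (X : M → ℙ ℝ (V n)) : Prop :=
  ∀ p, ∃ (F : AdaptedFrame X p) (ν : Matrix (Fin (n - 1)) (Fin (n - 1)) ℝ),
    F.IsNu p ν ∧ ν.rank = n - 1

/-- The tensor `a_{ij}` is nondegenerate at every point (its rank does not depend on the frame). -/
def HasNondegenerateA (X : M → ℙ ℝ (V n)) : Prop :=
  ∀ p, ∃ (F : AdaptedFrame X p) (L : Matrix (Fin (n - 1)) (Fin (n - 1)) ℝ),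
    F.IsLambda p L ∧ (F.aTensor p L).det ≠ 0

/-- The field of subspaces `ζ = C_1 ∧ … ∧ C_{n-1}`, spanned by the points `C_i` of all adapted
frames; that every single frame gives the same subspace is part of the result. -/
def zeta (X : M → ℙ ℝ (V n)) (p : M) : Submodule ℝ (V n) :=
  ⨆ (F : AdaptedFrame X p) (Λ : F.Coeffs), Λ.wedge

/-- `Z` is a normalization of the hypersurface: a smooth field of `(n-2)`-dimensional projective
subspaces `Z p` of the tangent subspaces `T_{A_0}(V^{n-1})` that do not contain the point `A_0`. -/
structure IsNormalization (X : M → ℙ ℝ (V n)) (Z : M → Submodule ℝ (V n)) : Prop where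
  finrank_eq : ∀ p, Module.finrank ℝ (Z p) = n - 1
  le_tangentV : ∀ p (F : AdaptedFrame X p), Z p ≤ F.tangentV
  notMem : ∀ p (F : AdaptedFrame X p), F.A0 p ∉ Z p
  smooth : ∀ p, ∃ (O : Set M) (c : Fin (n - 1) → M → V n), IsOpen O ∧ p ∈ O ∧
    (∀ i, ContMDiffOn (𝓡 n) 𝓘(ℝ, V n) ∞ (c i) O) ∧
    ∀ q ∈ O, Z q = Submodule.span ℝ (Set.range fun i => c i q)

/-- The vectors tangent to the hypersurface at `p` that are carried by the projective subspace `S`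
through `X p`. All normalized representatives give the same subspace. -/
def tangentVectorsIn (X : M → ℙ ℝ (V n)) (p : M) (S : Submodule ℝ (V n)) :
    Submodule ℝ (TangentSpace (𝓡 n) p) :=
  ⨅ (O : Set M) (x : M → V n) (_ : p ∈ O ∧ IsLift X O x),
    S.comap (mvfderiv (𝓡 n) x p).toLinearMap

/-- The screen `Δ_x = x ∧ ζ` defined at `p` by a normalization `Z`. -/
def screen (X : M → ℙ ℝ (V n)) (Z : M → Submodule ℝ (V n)) (p : M) :
    Submodule ℝ (TangentSpace (𝓡 n) p) :=
  tangentVectorsIn X p ((X p).submodule ⊔ Z p)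

/-- The isotropic direction at `p`, i.e. the direction of the generator. -/
def isotropicDirection (X : M → ℙ ℝ (V n)) (p : M) : Submodule ℝ (TangentSpace (𝓡 n) p) :=
  tangentVectorsIn X p (generator X p)

/-- `Δ` is a screen distribution: a smooth distribution of `(n-1)`-dimensional elements
complementary to the isotropic direction. -/
structure IsScreenDistribution (X : M → ℙ ℝ (V n))
    (Δ : (p : M) → Submodule ℝ (TangentSpace (𝓡 n) p)) [IsManifold (𝓡 n) ∞ M] : Prop where
  finrank_eq : ∀ p, Module.finrank ℝ (Δ p) = n - 1
  isCompl : ∀ p, IsCompl (Δ p) (isotropicDirection X p)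
  smooth : ∀ p, ∃ (O : Set M) (E : Fin (n - 1) → (q : M) → TangentSpace (𝓡 n) q),
    IsOpen O ∧ p ∈ O ∧
    (∀ i, ContMDiffOn (𝓡 n) (𝓡 n).tangent ∞
      (fun q => (⟨q, E i q⟩ : TangentBundle (𝓡 n) M)) O) ∧
    ∀ q ∈ O, Δ q = Submodule.span ℝ (Set.range fun i => E i q)

/-- The frame `F` is adapted to the normalization `Z`: the points `A_i` are placed in `Z`. -/
def AdaptedFrame.IsReduced {X : M → ℙ ℝ (V n)} {p : M} (F : AdaptedFrame X p)
    (Z : M → Submodule ℝ (V n)) : Prop :=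
  ∀ q ∈ F.dom, ∀ i, F.A i q ∈ Z q

/-- `∇` is the affine connection induced by the normalization `Z`: with respect to the coframe
`(ω_n^0, ω_n^i)` of every frame with `A_i ∈ Z`, its connection form is the matrix
`(ω_0^0, ω_i^0; ω_0^i, ω_j^i)`. Recall that Mathlib writes `∇ Y p v` for `(∇_v Y)(p)`. -/
def IsInducedConnection [IsManifold (𝓡 n) ∞ M] (X : M → ℙ ℝ (V n)) (Z : M → Submodule ℝ (V n))
    (D : CovariantDerivative (𝓡 n) (EuclideanSpace ℝ (Fin n))
      (TangentSpace (𝓡 n) : M → Type _)) : Prop :=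
  ∀ (p : M) (F : AdaptedFrame X p), F.IsReduced Z →
    ∀ Y : (q : M) → TangentSpace (𝓡 n) q,
      MDifferentiableAt (𝓡 n) (𝓡 n).tangent (fun q => (⟨q, Y q⟩ : TangentBundle (𝓡 n) M)) p →
      ∀ v : TangentSpace (𝓡 n) p,
        F.omegan0 p (D.toFun Y p v)
            = mvfderiv (𝓡 n) (fun q => F.omegan0 q (Y q)) p v
              + F.omega00 p v * F.omegan0 p (Y p)
              + ∑ i, F.omegaI0 p i v * F.omeganI p i (Y p) ∧
        ∀ i, F.omeganI p i (D.toFun Y p v)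
            = mvfderiv (𝓡 n) (fun q => F.omeganI q i (Y q)) p v
              + F.omega0I p i v * F.omegan0 p (Y p)
              + ∑ j, F.omegaIJ p j i v * F.omeganI p j (Y p)

end Hypersurface

section Comparison

variable {n : ℕ} {M M' : Type u}
  [TopologicalSpace M] [ChartedSpace (EuclideanSpace ℝ (Fin n)) M]
  [TopologicalSpace M'] [ChartedSpace (EuclideanSpace ℝ (Fin n)) M']

/-- Near `p`, the motion `T` carries each point `X q` to the point `X' (φ q)`. -/
def CarriesPoints (X : M → ℙ ℝ (V n)) (X' : M' → ℙ ℝ (V n)) (T : V n ≃ₗ[ℝ] V n) (φ : M → M')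
    (p : M) : Prop :=
  ∀ᶠ q in 𝓝 p, (X' (φ q)).submodule = (X q).submodule.map T.toLinearMap

/-- Near `p`, the motion `T` carries the generator through `X q` to a line through `X' (φ q)`;
so the point `X' (φ q)` may be displaced along the generator. -/
def CarriesGenerators (X : M → ℙ ℝ (V n)) (X' : M' → ℙ ℝ (V n)) (T : V n ≃ₗ[ℝ] V n)
    (φ : M → M') (p : M) : Prop :=
  ∀ᶠ q in 𝓝 p, (X' (φ q)).submodule ≤ (generator X q).map T.toLinearMap

/-- `X` at `p` and `X'` at `φ p` have the same 3-jet, after identification of neighbourhoods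
by `φ`. -/
def SameThirdOrderJet (X : M → ℙ ℝ (V n)) (X' : M' → ℙ ℝ (V n)) (φ : M → M') (p : M) : Prop :=
  ∃ (O : Set M) (x : M → V n) (O' : Set M') (x' : M' → V n),
    p ∈ O ∧ IsLift X O x ∧ φ p ∈ O' ∧ IsLift X' O' x' ∧
    ∀ k ≤ 3, iteratedFDeriv ℝ k (x ∘ (extChartAt (𝓡 n) p).symm) (extChartAt (𝓡 n) p p)
      = iteratedFDeriv ℝ k ((x' ∘ φ) ∘ (extChartAt (𝓡 n) p).symm) (extChartAt (𝓡 n) p p)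

end Comparison

end

end DeSitter

/-! The subspace ζ is the image of the differential of the harmonic pole C = A_n + λA_0; everything
else follows from this and from the invariance of C.

Put N(v)_i = (dA_n(v), A_i) and Y(v)_i = (dA_0(v), A_i) (`nMap`, `yMap`). Maximal rank means that N
and Y have the same kernel, the isotropic direction, so N = -μY with a unique matrix μ = (λ_{ij})g⁻¹
(`exists_mu`, `isLambda_iff`). The exterior derivative of this relation, evaluated on an isotropic
vector and an arbitrary one, shows that the left-hand side of the structure equation of λ_{ij}
vanishes on isotropic vectors (`dMat_mu_of_yMap_eq_zero`). It is therefore a combination of the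
ω_0^k, and the λ_{ijk} exist (`nonempty_coeffs`). Its trace is dλ + λω_0^0 + ω_n^0 = λ_k ω_0^k,
whence dC = ω_0^k C_k (`mvfderiv_harmonicPole_eq`) and, the ω_0^k being independent, ζ = range dC
(`wedge_eq_range`). Modulo A_0 the point C_i is -a_i^j A_j, so nondegeneracy of a makes the C_i
independent and keeps A_0 out of ζ.

Invariance: if a motion T carries generators to generators, adapted frames are related by A_n' =
T(εA_n + tA_0), A_0' = T(sA_0) with ε = ±1 (`exists_isTransport`). Then μ' is conjugate to s⁻¹(εμ -
t), and comparing traces gives C' = ±TC (`IsTransport.harmonicPole_eq`). The case T = 1 is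
independence of the frame. For the order of contact, C is written through a lift x, a normalized
pole y and their first derivatives. As y solves the linear equations (y, x) = 0, (y, dx) = 0, the
3-jet of x fixes the 1-jets of y and dy (`sameJet_pole`), hence that of C.

Where a is nondegenerate, the A_i can be moved along the lines A_iA_0 into ζ (`exists_isReduced`).
In such a frame the screen is ω_n^0 = 0, and the connection is given by dA_n(∇_vY) =
proj(v(dA_n(Y))), where proj kills A_n and A_{n+1} (`dAn_eq_proj_iff`). Since ζ and x determine
A_{n+1} up to a factor (`smul_Ainf_eq`), proj does not depend on the frame. Torsion vanishes because
proj fixes dA_n([Y, Z]). -/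

namespace DeSitter

/-! ### Differential calculus of vector-valued functions and fields on a manifold. -/

section Calculus

open Filter

variable {n : ℕ} {M : Type*} [TopologicalSpace M] [ChartedSpace (EuclideanSpace ℝ (Fin n)) M]
  {F G H : Type*} [NormedAddCommGroup F] [NormedSpace ℝ F] [NormedAddCommGroup G] [NormedSpace ℝ G]
  [NormedAddCommGroup H] [NormedSpace ℝ H] {p : M}

lemma mvfderiv_eq_of_hasMFDerivAt {f : M → F} {f' : TangentSpace (𝓡 n) p →L[ℝ] F}
    (h : HasMFDerivAt (𝓡 n) 𝓘(ℝ, F) f p f') : mvfderiv (𝓡 n) f p = f' := by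
  have := h.mfderiv
  ext v
  simp only [mvfderiv, this]
  rfl

lemma hasMFDerivAt_mvfderiv {f : M → F} (h : MDifferentiableAt (𝓡 n) 𝓘(ℝ, F) f p) :
    HasMFDerivAt (𝓡 n) 𝓘(ℝ, F) f p (mvfderiv (𝓡 n) f p) := h.hasMFDerivAt

lemma mvfderiv_congr {f g : M → F} (h : f =ᶠ[𝓝 p] g) :
    mvfderiv (𝓡 n) f p = mvfderiv (𝓡 n) g p := by
  by_cases hf : MDifferentiableAt (𝓡 n) 𝓘(ℝ, F) f p
  · exact mvfderiv_eq_of_hasMFDerivAt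
      ((hasMFDerivAt_mvfderiv (hf.congr_of_eventuallyEq h.symm)).congr_of_eventuallyEq h)
  · have hg : ¬ MDifferentiableAt (𝓡 n) 𝓘(ℝ, F) g p := fun hg => hf (hg.congr_of_eventuallyEq h)
    ext v
    simp [mvfderiv, mfderiv_zero_of_not_mdifferentiableAt hf,
      mfderiv_zero_of_not_mdifferentiableAt hg]

lemma mvfderiv_clm_comp (L : F →L[ℝ] G) {f : M → F} (hf : MDifferentiableAt (𝓡 n) 𝓘(ℝ, F) f p)
    (v : TangentSpace (𝓡 n) p) :
    mvfderiv (𝓡 n) (fun q => L (f q)) p v = L (mvfderiv (𝓡 n) f p v) := by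
  have h := HasMFDerivAt.comp p (L.hasMFDerivAt (x := f p)) (hasMFDerivAt_mvfderiv hf)
  rw [mvfderiv_eq_of_hasMFDerivAt (f := fun q => L (f q)) h]
  rfl

lemma mvfderiv_comp_space {Φ : F → G} {f : M → F} (hΦ : DifferentiableAt ℝ Φ (f p))
    (hf : MDifferentiableAt (𝓡 n) 𝓘(ℝ, F) f p) (v : TangentSpace (𝓡 n) p) :
    mvfderiv (𝓡 n) (fun q => Φ (f q)) p v = fderiv ℝ Φ (f p) (mvfderiv (𝓡 n) f p v) := by
  have h := HasMFDerivAt.comp p hΦ.hasFDerivAt.hasMFDerivAt (hasMFDerivAt_mvfderiv hf)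
  rw [mvfderiv_eq_of_hasMFDerivAt (f := fun q => Φ (f q)) h]
  rfl

lemma mvfderiv_prodMk {f : M → F} {g : M → G}
    (hf : MDifferentiableAt (𝓡 n) 𝓘(ℝ, F) f p) (hg : MDifferentiableAt (𝓡 n) 𝓘(ℝ, G) g p)
    (v : TangentSpace (𝓡 n) p) :
    mvfderiv (𝓡 n) (fun q => (f q, g q)) p v
      = (mvfderiv (𝓡 n) f p v, mvfderiv (𝓡 n) g p v) := by
  have h : HasMFDerivAt (𝓡 n) 𝓘(ℝ, F × G) (fun q => (f q, g q)) p
      (show TangentSpace (𝓡 n) p →L[ℝ] F × G from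
        (mvfderiv (𝓡 n) f p).prod (mvfderiv (𝓡 n) g p)) :=
    ⟨hf.continuousAt.prodMk hg.continuousAt,
      (hasMFDerivAt_mvfderiv hf).2.prodMk (hasMFDerivAt_mvfderiv hg).2⟩
  rw [mvfderiv_eq_of_hasMFDerivAt h]
  rfl

lemma mvfderiv_bilin (B : F →L[ℝ] G →L[ℝ] H) {f : M → F} {g : M → G}
    (hf : MDifferentiableAt (𝓡 n) 𝓘(ℝ, F) f p) (hg : MDifferentiableAt (𝓡 n) 𝓘(ℝ, G) g p)
    (v : TangentSpace (𝓡 n) p) :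
    mvfderiv (𝓡 n) (fun q => B (f q) (g q)) p v
      = B (mvfderiv (𝓡 n) f p v) (g p) + B (f p) (mvfderiv (𝓡 n) g p v) := by
  have hb := B.hasFDerivAt_of_bilinear (hasFDerivAt_fst (𝕜 := ℝ) (p := (f p, g p)))
    (hasFDerivAt_snd (𝕜 := ℝ) (p := (f p, g p)))
  rw [mvfderiv_comp_space (Φ := fun z : F × G => B z.1 z.2) (f := fun q => (f q, g q))
    hb.differentiableAt (hf.prodMk_space hg), hb.fderiv, mvfderiv_prodMk hf hg, add_comm]
  rfl

lemma mdifferentiableAt_bilin (B : F →L[ℝ] G →L[ℝ] H) {f : M → F} {g : M → G}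
    (hf : MDifferentiableAt (𝓡 n) 𝓘(ℝ, F) f p) (hg : MDifferentiableAt (𝓡 n) 𝓘(ℝ, G) g p) :
    MDifferentiableAt (𝓡 n) 𝓘(ℝ, H) (fun q => B (f q) (g q)) p := by
  have hb := B.hasFDerivAt_of_bilinear (hasFDerivAt_fst (𝕜 := ℝ) (p := (f p, g p)))
    (hasFDerivAt_snd (𝕜 := ℝ) (p := (f p, g p)))
  exact MDifferentiableAt.comp p (g := fun z : F × G => B z.1 z.2)
    hb.differentiableAt.mdifferentiableAt (hf.prodMk_space hg)

lemma contMDiffOn_bilin (B : F →L[ℝ] G →L[ℝ] H) {f : M → F} {g : M → G} {O : Set M}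
    (hf : ContMDiffOn (𝓡 n) 𝓘(ℝ, F) ∞ f O) (hg : ContMDiffOn (𝓡 n) 𝓘(ℝ, G) ∞ g O) :
    ContMDiffOn (𝓡 n) 𝓘(ℝ, H) ∞ (fun q => B (f q) (g q)) O :=
  (ContDiff.contMDiff (f := fun z : F × G => B z.1 z.2)
    (B.isBoundedBilinearMap.contDiff)).comp_contMDiffOn (hf.prodMk_space hg)

lemma mdiffAt_of_smoothOn {f : M → F} {O : Set M} (hO : IsOpen O)
    (hf : ContMDiffOn (𝓡 n) 𝓘(ℝ, F) ∞ f O) (hp : p ∈ O) :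
    MDifferentiableAt (𝓡 n) 𝓘(ℝ, F) f p :=
  (hf.contMDiffAt (hO.mem_nhds hp)).mdifferentiableAt (by simp)

lemma hasMFDerivAt_sum {ι : Type*} (s : Finset ι) {f : ι → M → F}
    (hf : ∀ i ∈ s, MDifferentiableAt (𝓡 n) 𝓘(ℝ, F) (f i) p) :
    HasMFDerivAt (𝓡 n) 𝓘(ℝ, F) (fun q => ∑ i ∈ s, f i q) p
      (show TangentSpace (𝓡 n) p →L[ℝ] F from ∑ i ∈ s, mvfderiv (𝓡 n) (f i) p) :=
  ⟨tendsto_finsetSum _ fun i hi => (hf i hi).continuousAt,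
    HasFDerivWithinAt.fun_sum fun i hi => (hasMFDerivAt_mvfderiv (hf i hi)).2⟩

lemma mvfderiv_sum {ι : Type*} (s : Finset ι) {f : ι → M → F}
    (hf : ∀ i ∈ s, MDifferentiableAt (𝓡 n) 𝓘(ℝ, F) (f i) p) (v : TangentSpace (𝓡 n) p) :
    mvfderiv (𝓡 n) (fun q => ∑ i ∈ s, f i q) p v = ∑ i ∈ s, mvfderiv (𝓡 n) (f i) p v := by
  rw [mvfderiv_eq_of_hasMFDerivAt (hasMFDerivAt_sum s hf)]
  exact sum_apply _ _ _

lemma mdifferentiableAt_sum {ι : Type*} (s : Finset ι) {f : ι → M → F}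
    (hf : ∀ i ∈ s, MDifferentiableAt (𝓡 n) 𝓘(ℝ, F) (f i) p) :
    MDifferentiableAt (𝓡 n) 𝓘(ℝ, F) (fun q => ∑ i ∈ s, f i q) p :=
  (hasMFDerivAt_sum s hf).mdifferentiableAt

variable [IsManifold (𝓡 n) ∞ M]

/-- The derivative of a smooth function along a smooth vector field is smooth. -/
lemma contMDiffOn_mvfderiv_apply {f : M → F} {O : Set M} (hO : IsOpen O)
    (hf : ContMDiffOn (𝓡 n) 𝓘(ℝ, F) ∞ f O) {Y : (q : M) → TangentSpace (𝓡 n) q}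
    (hY : ContMDiffOn (𝓡 n) (𝓡 n).tangent ∞
      (fun q => (⟨q, Y q⟩ : TangentBundle (𝓡 n) M)) O) :
    ContMDiffOn (𝓡 n) 𝓘(ℝ, F) ∞ (fun q => mvfderiv (𝓡 n) f q (Y q)) O := by
  have h1 := hf.contMDiffOn_tangentMapWithin (m := ∞) (by simp) hO.uniqueMDiffOn
  have h2 := h1.comp hY (fun q hq => hq)
  have h3 := (contMDiff_snd_tangentBundle_modelSpace F 𝓘(ℝ, F) (n := ∞)).comp_contMDiffOn h2
  refine h3.congr fun q hq => ?_
  simp only [Function.comp, tangentMapWithin, mfderivWithin_of_isOpen hO hq]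
  rfl

/-- The connection has to be computed on fields differentiable only at `p`, so a version at one
point is needed: the tangent map of `f` is smooth on the total space and is composed with the
section. -/
lemma mdifferentiableAt_mvfderiv_apply {f : M → F} {O : Set M} (hO : IsOpen O) (hp : p ∈ O)
    (hf : ContMDiffOn (𝓡 n) 𝓘(ℝ, F) ∞ f O) {Y : (q : M) → TangentSpace (𝓡 n) q}
    (hY : MDifferentiableAt (𝓡 n) (𝓡 n).tangent
      (fun q => (⟨q, Y q⟩ : TangentBundle (𝓡 n) M)) p) :
    MDifferentiableAt (𝓡 n) 𝓘(ℝ, F) (fun q => mvfderiv (𝓡 n) f q (Y q)) p := by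
  have h1 := hf.contMDiffOn_tangentMapWithin (m := ∞) (by simp) hO.uniqueMDiffOn
  have hop : IsOpen (Bundle.TotalSpace.proj (F := EuclideanSpace ℝ (Fin n))
      (E := (TangentSpace (𝓡 n) : M → Type _)) ⁻¹' O) :=
    hO.preimage (FiberBundle.continuous_proj _ _)
  have h2 := (h1.contMDiffAt (x := (⟨p, Y p⟩ : TangentBundle (𝓡 n) M))
    (hop.mem_nhds hp)).mdifferentiableAt (by simp)
  have h3 := MDifferentiableAt.comp p h2 hY
  have h4 := MDifferentiableAt.comp p
    ((contMDiff_snd_tangentBundle_modelSpace F 𝓘(ℝ, F) (n := ∞)).mdifferentiable (by simp) _) h3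
  refine h4.congr_of_eventuallyEq ?_
  filter_upwards [hO.mem_nhds hp] with q hq
  simp only [Function.comp, tangentMapWithin, mfderivWithin_of_isOpen hO hq]
  rfl

/-- The derivative of the inverse of the chart at `p`. -/
noncomputable def chartInvDeriv (p : M) (u : EuclideanSpace ℝ (Fin n)) :
    EuclideanSpace ℝ (Fin n) →L[ℝ] TangentSpace (𝓡 n) ((extChartAt (𝓡 n) p).symm u) :=
  mfderivWithin 𝓘(ℝ, EuclideanSpace ℝ (Fin n)) (𝓡 n) (extChartAt (𝓡 n) p).symm
    (Set.range (𝓡 n)) u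

lemma isInvertible_chartInvDeriv {u : EuclideanSpace ℝ (Fin n)}
    (hu : u ∈ (extChartAt (𝓡 n) p).target) : (chartInvDeriv p u).IsInvertible :=
  isInvertible_mfderivWithin_extChartAt_symm hu

lemma hasMFDerivAt_extChartAt_symm {u : EuclideanSpace ℝ (Fin n)}
    (hu : u ∈ (extChartAt (𝓡 n) p).target) :
    HasMFDerivAt 𝓘(ℝ, EuclideanSpace ℝ (Fin n)) (𝓡 n) (extChartAt (𝓡 n) p).symm u
      (chartInvDeriv p u) := by
  have h := (mdifferentiableWithinAt_extChartAt_symm hu).hasMFDerivWithinAt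
  rw [chartInvDeriv]
  simpa using! h

lemma hasFDerivAt_comp_chart {f : M → F} {u : EuclideanSpace ℝ (Fin n)}
    (hu : u ∈ (extChartAt (𝓡 n) p).target)
    (hf : MDifferentiableAt (𝓡 n) 𝓘(ℝ, F) f ((extChartAt (𝓡 n) p).symm u)) :
    HasFDerivAt (f ∘ (extChartAt (𝓡 n) p).symm)
      ((mvfderiv (𝓡 n) f ((extChartAt (𝓡 n) p).symm u)).comp (chartInvDeriv p u)) u := by
  refine hasMFDerivAt_iff_hasFDerivAt.1 ?_
  exact HasMFDerivAt.comp u (hasMFDerivAt_mvfderiv hf) (hasMFDerivAt_extChartAt_symm hu)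

/-- A vector field read in the chart at `p`. -/
noncomputable def chartField (p : M) (Y : (q : M) → TangentSpace (𝓡 n) q) :
    EuclideanSpace ℝ (Fin n) → EuclideanSpace ℝ (Fin n) :=
  VectorField.mpullbackWithin 𝓘(ℝ, EuclideanSpace ℝ (Fin n)) (𝓡 n)
    (extChartAt (𝓡 n) p).symm Y (Set.range (𝓡 n))

lemma chartInvDeriv_chartField {u : EuclideanSpace ℝ (Fin n)}
    (hu : u ∈ (extChartAt (𝓡 n) p).target) (Y : (q : M) → TangentSpace (𝓡 n) q) :
    chartInvDeriv p u (chartField p Y u) = Y ((extChartAt (𝓡 n) p).symm u) :=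
  (isInvertible_chartInvDeriv hu).self_apply_inverse _

lemma differentiableAt_chartField {Y : (q : M) → TangentSpace (𝓡 n) q}
    (hY : MDifferentiableAt (𝓡 n) (𝓡 n).tangent
      (fun q => (⟨q, Y q⟩ : TangentBundle (𝓡 n) M)) p) :
    DifferentiableAt ℝ (chartField p Y) (extChartAt (𝓡 n) p p) := by
  have h : DifferentiableWithinAt ℝ (chartField p Y)
      ((extChartAt (𝓡 n) p).symm ⁻¹' Set.univ ∩ Set.range (𝓡 n)) (extChartAt (𝓡 n) p p) :=
    (mdifferentiableWithinAt_univ.2 hY).differentiableWithinAt_mpullbackWithin_vectorField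
  rwa [Set.preimage_univ, Set.univ_inter, ModelWithCorners.range_eq_univ,
    differentiableWithinAt_univ] at h

/-- The tangent space at `p` is the model space, identified through this very chart. -/
lemma mfderiv_extChartAt_self (p : M) :
    mfderiv (𝓡 n) 𝓘(ℝ, EuclideanSpace ℝ (Fin n)) (extChartAt (𝓡 n) p) p
      = ContinuousLinearMap.id ℝ (EuclideanSpace ℝ (Fin n)) := by
  have hd : MDifferentiableAt (𝓡 n) 𝓘(ℝ, EuclideanSpace ℝ (Fin n)) (extChartAt (𝓡 n) p) p :=
    mdifferentiableAt_extChartAt (mem_chart_source _ p)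
  have h : fderivWithin ℝ (writtenInExtChartAt (𝓡 n) 𝓘(ℝ, EuclideanSpace ℝ (Fin n)) p
      (extChartAt (𝓡 n) p)) (Set.range (𝓡 n)) (extChartAt (𝓡 n) p p)
      = ContinuousLinearMap.id ℝ (EuclideanSpace ℝ (Fin n)) := by
    rw [ModelWithCorners.range_eq_univ, fderivWithin_univ, ← fderiv_id (𝕜 := ℝ)
      (x := extChartAt (𝓡 n) p p)]
    refine Filter.EventuallyEq.fderiv_eq ?_
    filter_upwards [extChartAt_target_mem_nhds p] with u hu
    exact (extChartAt (𝓡 n) p).right_inv hu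
  exact hd.mfderiv.trans h

/-- The commutator of derivations along vector fields is the derivation along the bracket. -/
lemma mvfderiv_mlieBracket {f : M → F} {O : Set M} (hO : IsOpen O) (hp : p ∈ O)
    (hf : ContMDiffOn (𝓡 n) 𝓘(ℝ, F) ∞ f O) {Y Z : (q : M) → TangentSpace (𝓡 n) q}
    (hY : MDifferentiableAt (𝓡 n) (𝓡 n).tangent
      (fun q => (⟨q, Y q⟩ : TangentBundle (𝓡 n) M)) p)
    (hZ : MDifferentiableAt (𝓡 n) (𝓡 n).tangent
      (fun q => (⟨q, Z q⟩ : TangentBundle (𝓡 n) M)) p) :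
    mvfderiv (𝓡 n) (fun q => mvfderiv (𝓡 n) f q (Z q)) p (Y p)
      - mvfderiv (𝓡 n) (fun q => mvfderiv (𝓡 n) f q (Y q)) p (Z p)
      = mvfderiv (𝓡 n) f p (VectorField.mlieBracket (𝓡 n) Y Z p) := by
  set c := extChartAt (𝓡 n) p with hc
  have hu0 : c p ∈ c.target := mem_extChartAt_target p
  have hcp : c.symm (c p) = p := extChartAt_to_inv p
  have hfh : ContDiffAt ℝ ∞ (f ∘ c.symm) (c p) := by
    have h1 : ContMDiffAt (𝓡 n) 𝓘(ℝ, F) ∞ f (c.symm (c p)) := by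
      rw [hcp]; exact hf.contMDiffAt (hO.mem_nhds hp)
    have h2 : ContMDiffAt 𝓘(ℝ, EuclideanSpace ℝ (Fin n)) (𝓡 n) ∞ c.symm (c p) :=
      (contMDiffOn_extChartAt_symm p).contMDiffAt (extChartAt_target_mem_nhds p)
    exact (h1.comp _ h2).contDiffAt
  have hev : ∀ᶠ u in 𝓝 (c p), u ∈ c.target ∧ c.symm u ∈ O := by
    refine Filter.Eventually.and (extChartAt_target_mem_nhds p)
      ((continuousAt_extChartAt_symm p).eventually_mem ?_)
    rw [hcp]; exact hO.mem_nhds hp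
  have hfd : ∀ {g : M → F}, MDifferentiableAt (𝓡 n) 𝓘(ℝ, F) g p →
      ∀ T : (q : M) → TangentSpace (𝓡 n) q,
      mvfderiv (𝓡 n) g p (T p) = fderiv ℝ (g ∘ c.symm) (c p) (chartField p T (c p)) := by
    intro g hg T
    have hg' : MDifferentiableAt (𝓡 n) 𝓘(ℝ, F) g (c.symm (c p)) := by rwa [hcp]
    rw [(hasFDerivAt_comp_chart hu0 hg').fderiv, ContinuousLinearMap.comp_apply,
      chartInvDeriv_chartField hu0, ← hc, hcp]
  -- In the chart, S(Tf) = f''(S, T) + f'(DT·S). On antisymmetrizing, the first term drops out by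
  -- symmetry and the second gives the bracket.
  have key : ∀ {T S : (q : M) → TangentSpace (𝓡 n) q},
      MDifferentiableAt (𝓡 n) (𝓡 n).tangent
        (fun q => (⟨q, T q⟩ : TangentBundle (𝓡 n) M)) p →
      mvfderiv (𝓡 n) (fun q => mvfderiv (𝓡 n) f q (T q)) p (S p)
        = fderiv ℝ (fderiv ℝ (f ∘ c.symm)) (c p) (chartField p S (c p)) (chartField p T (c p))
          + fderiv ℝ (f ∘ c.symm) (c p)
            (fderiv ℝ (chartField p T) (c p) (chartField p S (c p))) := by
    intro T S hT
    rw [hfd (mdifferentiableAt_mvfderiv_apply hO hp hf hT)]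
    have he : (fun q => mvfderiv (𝓡 n) f q (T q)) ∘ c.symm
        =ᶠ[𝓝 (c p)] fun u => fderiv ℝ (f ∘ c.symm) u (chartField p T u) := by
      filter_upwards [hev] with u hu
      rw [(hasFDerivAt_comp_chart hu.1 (mdiffAt_of_smoothOn hO hf hu.2)).fderiv,
        ContinuousLinearMap.comp_apply, chartInvDeriv_chartField hu.1]
      rfl
    rw [he.fderiv_eq]
    have hd : DifferentiableAt ℝ (fderiv ℝ (f ∘ c.symm)) (c p) :=
      (hfh.fderiv_right (m := 1) (by norm_cast)).differentiableAt (by simp)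
    rw [(hd.hasFDerivAt.clm_apply (differentiableAt_chartField hT).hasFDerivAt).fderiv]
    rw [add_comm]
    rfl
  rw [key hZ, key hY]
  have hsymm : IsSymmSndFDerivAt ℝ (f ∘ c.symm) (c p) :=
    hfh.isSymmSndFDerivAt (by rw [minSmoothness_of_isRCLikeNormedField]; norm_cast)
  have hbr : VectorField.mlieBracket (𝓡 n) Y Z p
      = VectorField.lieBracket ℝ (chartField p Y) (chartField p Z) (c p) := by
    have h := VectorField.mlieBracketWithin_apply (I := 𝓡 n) (V := Y) (W := Z) (s := Set.univ)
      (x₀ := p)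
    rw [VectorField.mlieBracketWithin_univ, Set.preimage_univ, Set.univ_inter] at h
    have h2 : VectorField.lieBracketWithin ℝ (chartField p Y) (chartField p Z)
        (Set.range (𝓡 n)) (c p)
        = VectorField.lieBracket ℝ (chartField p Y) (chartField p Z) (c p) := by
      rw [ModelWithCorners.range_eq_univ, VectorField.lieBracketWithin_univ]
    rw [h, mfderiv_extChartAt_self]
    refine Eq.trans ?_ h2
    exact congrArg (fun L : EuclideanSpace ℝ (Fin n) →L[ℝ] EuclideanSpace ℝ (Fin n) =>
      L (VectorField.lieBracketWithin ℝ (chartField p Y) (chartField p Z)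
        (Set.range (𝓡 n)) (c p))) ContinuousLinearMap.inverse_id
  have hmv : mvfderiv (𝓡 n) f p = fderiv ℝ (f ∘ c.symm) (c p) := by
    rw [(mdiffAt_of_smoothOn hO hf hp).mvfderiv, ModelWithCorners.range_eq_univ,
      fderivWithin_univ]
    rfl
  have hfin : mvfderiv (𝓡 n) f p (VectorField.mlieBracket (𝓡 n) Y Z p)
      = fderiv ℝ (f ∘ c.symm) (c p) (fderiv ℝ (chartField p Z) (c p) (chartField p Y (c p)))
        - fderiv ℝ (f ∘ c.symm) (c p)
          (fderiv ℝ (chartField p Y) (c p) (chartField p Z (c p))) := by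
    rw [hbr, hmv]
    exact map_sub (fderiv ℝ (f ∘ c.symm) (c p)) _ _
  rw [hsymm.eq, hfin]
  abel

/-- A smooth frame of the tangent bundle near a point. -/
lemma exists_smooth_frame (p : M) : ∃ (O : Set M)
    (e : Fin n → (q : M) → TangentSpace (𝓡 n) q), IsOpen O ∧ p ∈ O ∧
      (∀ a, ContMDiffOn (𝓡 n) (𝓡 n).tangent ∞
        (fun q => (⟨q, e a q⟩ : TangentBundle (𝓡 n) M)) O) ∧
      ∀ q ∈ O, LinearIndependent ℝ (fun a => e a q) := by
  let t := trivializationAt (EuclideanSpace ℝ (Fin n)) (TangentSpace (𝓡 n) : M → Type _) p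
  let b := (EuclideanSpace.basisFun (Fin n) ℝ).toBasis
  have h := t.isLocalFrameOn_localFrame_baseSet (𝓡 n) ∞ b
  exact ⟨t.baseSet, t.localFrame b, t.open_baseSet,
    FiberBundle.mem_baseSet_trivializationAt' p, h.contMDiffOn, fun q hq => h.linearIndependent hq⟩

/-- A smooth linear combination of smooth vector fields. -/
lemma contMDiffOn_sum_smul_field {ι : Type*} [Fintype ι] {O : Set M}
    {e : ι → (q : M) → TangentSpace (𝓡 n) q} {c : ι → M → ℝ}
    (he : ∀ a, ContMDiffOn (𝓡 n) (𝓡 n).tangent ∞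
        (fun q => (⟨q, e a q⟩ : TangentBundle (𝓡 n) M)) O)
    (hc : ∀ a, ContMDiffOn (𝓡 n) 𝓘(ℝ, ℝ) ∞ (c a) O) :
    ContMDiffOn (𝓡 n) (𝓡 n).tangent ∞
      (fun q => (⟨q, ∑ a, c a q • e a q⟩ : TangentBundle (𝓡 n) M)) O :=
  ContMDiffOn.sum_section fun a _ => (hc a).smul_section (he a)

/-- Every tangent vector extends to a differentiable vector field. -/
lemma exists_field_extend (v : TangentSpace (𝓡 n) p) :
    ∃ Y : (q : M) → TangentSpace (𝓡 n) q, Y p = v ∧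
      MDifferentiableAt (𝓡 n) (𝓡 n).tangent
        (fun q => (⟨q, Y q⟩ : TangentBundle (𝓡 n) M)) p :=
  ⟨FiberBundle.extend (EuclideanSpace ℝ (Fin n)) v, by simp, FiberBundle.mdifferentiableAt_extend ..⟩

end Calculus

/-! ### Nondegeneracy of the scalar product. -/

section Form

variable {n : ℕ}

lemma form_symm (x y : V n) : form n x y = form n y x := by
  simp [form, mul_comm]

lemma eq_zero_of_form_eq_zero {x : V n} (h : ∀ y, form n x y = 0) : x = 0 := by
  ext i
  have hi := h (EuclideanSpace.single i 1)
  induction i using Fin.lastCases with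
  | last => simpa [form, Fin.castSucc_ne_last] using hi
  | cast j =>
    simpa [form, (Fin.castSucc_ne_last j).symm, PiLp.single_apply, Fin.castSucc_inj] using hi

/-- The form as a continuous bilinear map. -/
noncomputable def formL (n : ℕ) : V n →L[ℝ] V n →L[ℝ] ℝ := (form n).toContinuousBilinearMap

end Form

/-! ### Derivatives of scalar products. -/

section FormCalculus

variable {n : ℕ} {M : Type*} [TopologicalSpace M] [ChartedSpace (EuclideanSpace ℝ (Fin n)) M]
  {p : M}

lemma mvfderiv_form {f g : M → V n} (hf : MDifferentiableAt (𝓡 n) 𝓘(ℝ, V n) f p)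
    (hg : MDifferentiableAt (𝓡 n) 𝓘(ℝ, V n) g p) (v : TangentSpace (𝓡 n) p) :
    mvfderiv (𝓡 n) (fun q => form n (f q) (g q)) p v
      = form n (mvfderiv (𝓡 n) f p v) (g p) + form n (f p) (mvfderiv (𝓡 n) g p v) :=
  mvfderiv_bilin (formL n) hf hg v

lemma contMDiffOn_form {f g : M → V n} {O : Set M} (hf : ContMDiffOn (𝓡 n) 𝓘(ℝ, V n) ∞ f O)
    (hg : ContMDiffOn (𝓡 n) 𝓘(ℝ, V n) ∞ g O) :
    ContMDiffOn (𝓡 n) 𝓘(ℝ, ℝ) ∞ (fun q => form n (f q) (g q)) O :=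
  contMDiffOn_bilin (formL n) hf hg

lemma form_mvfderiv_add_eq_zero {f g : M → V n} {O : Set M} (hO : IsOpen O) (hp : p ∈ O)
    (hf : ContMDiffOn (𝓡 n) 𝓘(ℝ, V n) ∞ f O) (hg : ContMDiffOn (𝓡 n) 𝓘(ℝ, V n) ∞ g O) {c : ℝ}
    (h : ∀ q ∈ O, form n (f q) (g q) = c) (v : TangentSpace (𝓡 n) p) :
    form n (mvfderiv (𝓡 n) f p v) (g p) + form n (f p) (mvfderiv (𝓡 n) g p v) = 0 := by
  rw [← mvfderiv_form (mdiffAt_of_smoothOn hO hf hp) (mdiffAt_of_smoothOn hO hg hp),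
    mvfderiv_congr (g := fun _ => c) (by filter_upwards [hO.mem_nhds hp] with q hq using h q hq),
    mvfderiv_const]
  rfl

end FormCalculus

/-! ### Algebra of one adapted frame, its first derivatives, and the tensor λ_{ij}. -/

section Frame

variable {n : ℕ} {M : Type u} [TopologicalSpace M] [ChartedSpace (EuclideanSpace ℝ (Fin n)) M]
  {X : M → ℙ ℝ (V n)} {p : M}

instance (q : M) : FiniteDimensional ℝ (TangentSpace (𝓡 n) q) :=
  inferInstanceAs (FiniteDimensional ℝ (EuclideanSpace ℝ (Fin n)))

lemma finrank_tangentSpace (q : M) : Module.finrank ℝ (TangentSpace (𝓡 n) q) = n :=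
  (finrank_euclideanSpace (𝕜 := ℝ) (ι := Fin n)).trans (Fintype.card_fin n)

namespace AdaptedFrame

variable (F : AdaptedFrame X p)

/-- The same frame, near another point of its domain. -/
def moveTo {q : M} (hq : q ∈ F.dom) : AdaptedFrame X q :=
  { F with mem_dom := hq }

/-- The frame on a smaller domain. -/
def restrict {O : Set M} (hO : IsOpen O) (hp : p ∈ O) : AdaptedFrame X p where
  dom := F.dom ∩ O
  isOpen_dom := F.isOpen_dom.inter hO
  mem_dom := ⟨F.mem_dom, hp⟩
  A0 := F.A0
  A := F.A
  An := F.An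
  Ainf := F.Ainf
  smooth_A0 := F.smooth_A0.mono Set.inter_subset_left
  smooth_A i := (F.smooth_A i).mono Set.inter_subset_left
  isLift_An := ⟨F.isOpen_dom.inter hO, F.isLift_An.smooth.mono Set.inter_subset_left,
    fun q hq => F.isLift_An.normalized q hq.1, fun q hq => F.isLift_An.represents q hq.1⟩
  smooth_Ainf := F.smooth_Ainf.mono Set.inter_subset_left
  form_A0_A0 q hq := F.form_A0_A0 q hq.1
  form_A0_A q hq := F.form_A0_A q hq.1
  form_A0_An q hq := F.form_A0_An q hq.1
  form_A0_Ainf q hq := F.form_A0_Ainf q hq.1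
  form_A_An q hq := F.form_A_An q hq.1
  form_A_Ainf q hq := F.form_A_Ainf q hq.1
  form_An_Ainf q hq := F.form_An_Ainf q hq.1
  form_Ainf_Ainf q hq := F.form_Ainf_Ainf q hq.1
  linearIndependent_A q hq := F.linearIndependent_A q hq.1
  tangent q hq := F.tangent q hq.1

lemma smooth_An : ContMDiffOn (𝓡 n) 𝓘(ℝ, V n) ∞ F.An F.dom := F.isLift_An.smooth

variable {F} {q : M} (hq : q ∈ F.dom)
include hq

lemma form_An_An : form n (F.An q) (F.An q) = 1 := F.isLift_An.normalized q hq
lemma form_An_A0 : form n (F.An q) (F.A0 q) = 0 := by rw [form_symm, F.form_A0_An q hq]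
lemma form_Ainf_A0 : form n (F.Ainf q) (F.A0 q) = -1 := by rw [form_symm, F.form_A0_Ainf q hq]
lemma form_Ainf_An : form n (F.Ainf q) (F.An q) = 0 := by rw [form_symm, F.form_An_Ainf q hq]
lemma form_A_A0 (i) : form n (F.A i q) (F.A0 q) = 0 := by rw [form_symm, F.form_A0_A q hq]
lemma form_An_A (i) : form n (F.An q) (F.A i q) = 0 := by rw [form_symm, F.form_A_An q hq]
lemma form_Ainf_A (i) : form n (F.Ainf q) (F.A i q) = 0 := by rw [form_symm, F.form_A_Ainf q hq]

lemma mdiff_A0 : MDifferentiableAt (𝓡 n) 𝓘(ℝ, V n) F.A0 q :=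
  mdiffAt_of_smoothOn F.isOpen_dom F.smooth_A0 hq
lemma mdiff_An : MDifferentiableAt (𝓡 n) 𝓘(ℝ, V n) F.An q :=
  mdiffAt_of_smoothOn F.isOpen_dom F.smooth_An hq
lemma mdiff_Ainf : MDifferentiableAt (𝓡 n) 𝓘(ℝ, V n) F.Ainf q :=
  mdiffAt_of_smoothOn F.isOpen_dom F.smooth_Ainf hq
lemma mdiff_A (i) : MDifferentiableAt (𝓡 n) 𝓘(ℝ, V n) (F.A i) q :=
  mdiffAt_of_smoothOn F.isOpen_dom (F.smooth_A i) hq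

lemma linearIndependent_frame :
    LinearIndependent ℝ (Sum.elim (fun i => F.A i q) ![F.A0 q, F.An q, F.Ainf q]) := by
  rw [Fintype.linearIndependent_iff]
  intro c hc
  simp only [Fintype.sum_sum_type, Sum.elim_inl, Sum.elim_inr, Fin.sum_univ_three] at hc
  simp only [Matrix.cons_val_zero, Matrix.cons_val_one, Matrix.cons_val] at hc
  have h0 := congrArg (fun z => form n z (F.A0 q)) hc
  have hn := congrArg (fun z => form n z (F.An q)) hc
  have hi := congrArg (fun z => form n z (F.Ainf q)) hc
  simp only [map_add, map_sum, map_smul, LinearMap.add_apply, LinearMap.sum_apply,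
    LinearMap.smul_apply, form_A_A0 hq, form_An_A0 hq, form_Ainf_A0 hq, F.form_A0_A0 q hq,
    F.form_A_An q hq, F.form_A0_An q hq, form_An_An hq, form_Ainf_An hq, F.form_A_Ainf q hq,
    F.form_A0_Ainf q hq, F.form_An_Ainf q hq, F.form_Ainf_Ainf q hq, mul_zero,
    Finset.sum_const_zero, smul_eq_mul, map_zero, LinearMap.zero_apply] at h0 hn hi
  have e0 : c (Sum.inr 0) = 0 := by linarith
  have e1 : c (Sum.inr 1) = 0 := by linarith
  have e2 : c (Sum.inr 2) = 0 := by linarith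
  rw [e0, e1, e2] at hc
  simp only [zero_smul, add_zero] at hc
  have hA := Fintype.linearIndependent_iff.1 (F.linearIndependent_A q hq) _ hc
  rintro (i | i)
  · exact hA i
  · fin_cases i
    exacts [e0, e1, e2]

/-- The frame has (n - 1) + 3 independent members in dimension n + 2; for n = 0 truncated
subtraction would make this 3 vectors in a plane. -/
lemma one_le_dim : 1 ≤ n := by
  have := (linearIndependent_frame hq).fintype_card_le_finrank
  simp at this
  omega

lemma eq_zero_of_orthogonal_frame {z : V n} (h0 : form n z (F.A0 q) = 0)
    (hA : ∀ i, form n z (F.A i q) = 0) (hn : form n z (F.An q) = 0)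
    (hi : form n z (F.Ainf q) = 0) : z = 0 := by
  have hspan := (linearIndependent_frame hq).span_eq_top_of_card_eq_finrank' (by
    have := one_le_dim hq
    simp; omega)
  refine eq_zero_of_form_eq_zero fun y => ?_
  have hy : y ∈ Submodule.span ℝ (Set.range
      (Sum.elim (fun i => F.A i q) ![F.A0 q, F.An q, F.Ainf q])) := hspan ▸ Submodule.mem_top
  induction hy using Submodule.span_induction with
  | mem x hx =>
    obtain ⟨i | i, rfl⟩ := hx
    · exact hA i
    · fin_cases i
      exacts [h0, hn, hi]
  | zero => simp
  | add x y _ _ hx hy => rw [map_add, hx, hy, add_zero]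
  | smul a x _ hx => rw [map_smul, hx, smul_zero]

omit hq in
lemma g_apply (i j) : F.g q i j = form n (F.A i q) (F.A j q) := rfl

omit hq in
lemma g_transpose : (F.g q).transpose = F.g q := by
  ext i j
  simp [g_apply, form_symm]

/-- A combination of the A_i in the radical of g is orthogonal to the whole frame, hence zero, and
the A_i are independent. -/
lemma isUnit_det_g : IsUnit (F.g q).det := by
  rw [isUnit_iff_ne_zero]
  intro h
  obtain ⟨c, hc0, hc⟩ := Matrix.exists_vecMul_eq_zero_iff.2 h
  have hz : ∑ i, c i • F.A i q = 0 := by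
    refine eq_zero_of_orthogonal_frame hq ?_ ?_ ?_ ?_
    · simp [map_sum, form_A_A0 hq]
    · intro j
      have := congrFun hc j
      simpa [Matrix.vecMul, dotProduct, g_apply] using this
    · simp [map_sum, F.form_A_An q hq]
    · simp [map_sum, F.form_A_Ainf q hq]
  exact hc0 (funext (Fintype.linearIndependent_iff.1 (F.linearIndependent_A q hq) c hz))

lemma ginv_mul : (F.g q)⁻¹ * F.g q = 1 := Matrix.nonsing_inv_mul _ (isUnit_det_g hq)
lemma mul_ginv : F.g q * (F.g q)⁻¹ = 1 := Matrix.mul_nonsing_inv _ (isUnit_det_g hq)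

omit hq in
lemma ginv_symm (i j) : (F.g q)⁻¹ i j = (F.g q)⁻¹ j i := by
  have h : ((F.g q)⁻¹).transpose = (F.g q)⁻¹ := by
    rw [Matrix.transpose_nonsing_inv, g_transpose]
  exact congrFun (congrFun h j) i

lemma sum_coeff_mul_g (z : V n) (j) : ∑ i, F.coeff q i z * F.g q i j = form n z (F.A j q) := by
  have h : ∀ k, ∑ i, (F.g q)⁻¹ i k * F.g q i j = if k = j then 1 else 0 := by
    intro k
    have := congrFun (congrFun (ginv_mul hq) k) j
    rw [Matrix.one_apply] at this
    rw [← this, Matrix.mul_apply]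
    exact Finset.sum_congr rfl fun i _ => by rw [ginv_symm]
  simp only [coeff, Finset.sum_mul]
  rw [Finset.sum_comm]
  calc _ = ∑ k, form n z (F.A k q) * ∑ i, (F.g q)⁻¹ i k * F.g q i j := by
        refine Finset.sum_congr rfl fun k _ => ?_
        rw [Finset.mul_sum]
        exact Finset.sum_congr rfl fun i _ => by ring
    _ = _ := by simp [h]

lemma expand (z : V n) : z = F.coeff0 q z • F.A0 q + ∑ i, F.coeff q i z • F.A i q
    + F.coeffn q z • F.An q + F.coeffInf q z • F.Ainf q := by
  rw [← sub_eq_zero]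
  refine eq_zero_of_orthogonal_frame hq ?_ ?_ ?_ ?_ <;>
  simp only [map_sub, map_add, map_sum, map_smul, LinearMap.sub_apply, LinearMap.add_apply,
    LinearMap.sum_apply,
    LinearMap.smul_apply, form_A_A0 hq, form_An_A0 hq, form_Ainf_A0 hq, F.form_A0_A0 q hq,
    F.form_A_An q hq, F.form_A0_An q hq, form_An_An hq, form_Ainf_An hq, F.form_A_Ainf q hq,
    F.form_A0_Ainf q hq, F.form_An_Ainf q hq, F.form_Ainf_Ainf q hq,
    Finset.sum_const_zero, smul_eq_mul, mul_zero, coeff0, coeffn, coeffInf]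
  · ring
  · intro j
    rw [F.form_A0_A q hq, form_An_A hq, form_Ainf_A hq]
    have := sum_coeff_mul_g hq z j
    simp only [g_apply] at this
    rw [this]; ring
  · ring
  · ring

/-! ### First derivatives of the frame -/

lemma form_dAn_An (v : TangentSpace (𝓡 n) q) :
    form n (mvfderiv (𝓡 n) F.An q v) (F.An q) = 0 := by
  have h := form_mvfderiv_add_eq_zero F.isOpen_dom hq F.smooth_An F.smooth_An
    (fun q hq => form_An_An hq) v
  rw [form_symm (F.An q)] at h
  linarith

lemma form_dA0_A0 (v : TangentSpace (𝓡 n) q) :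
    form n (mvfderiv (𝓡 n) F.A0 q v) (F.A0 q) = 0 := by
  have h := form_mvfderiv_add_eq_zero F.isOpen_dom hq F.smooth_A0 F.smooth_A0 F.form_A0_A0 v
  rw [form_symm (F.A0 q)] at h
  linarith

/-- Differentiate (A_0, A_n) = 0; the other term is zero because A_0 is the pole of the tangent
hyperplane. This is ω_0^n = 0. -/
lemma form_dA0_An (v : TangentSpace (𝓡 n) q) :
    form n (mvfderiv (𝓡 n) F.A0 q v) (F.An q) = 0 := by
  have h := form_mvfderiv_add_eq_zero F.isOpen_dom hq F.smooth_A0 F.smooth_An F.form_A0_An v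
  rwa [form_symm (F.A0 q), F.tangent q hq v, add_zero] at h

lemma form_dA_A0 (i) (v : TangentSpace (𝓡 n) q) :
    form n (mvfderiv (𝓡 n) (F.A i) q v) (F.A0 q)
      = -form n (mvfderiv (𝓡 n) F.A0 q v) (F.A i q) := by
  have h := form_mvfderiv_add_eq_zero F.isOpen_dom hq (F.smooth_A i) F.smooth_A0
    (fun q hq => form_A_A0 hq i) v
  rw [form_symm (F.A i q)] at h
  linarith

lemma form_dA_An (i) (v : TangentSpace (𝓡 n) q) :
    form n (mvfderiv (𝓡 n) (F.A i) q v) (F.An q)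
      = -form n (mvfderiv (𝓡 n) F.An q v) (F.A i q) := by
  have h := form_mvfderiv_add_eq_zero F.isOpen_dom hq (F.smooth_A i) F.smooth_An
    (fun q hq => F.form_A_An q hq i) v
  rw [form_symm (F.A i q)] at h
  linarith

lemma dAn_eq (v : TangentSpace (𝓡 n) q) : mvfderiv (𝓡 n) F.An q v
    = F.omegan0 q v • F.A0 q + ∑ i, F.omeganI q i v • F.A i q := by
  have h := expand hq (mvfderiv (𝓡 n) F.An q v)
  rwa [coeffn, coeffInf, form_dAn_An hq, F.tangent q hq, neg_zero, zero_smul, zero_smul,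
    add_zero, add_zero] at h

lemma dA0_eq (v : TangentSpace (𝓡 n) q) : mvfderiv (𝓡 n) F.A0 q v
    = F.omega00 q v • F.A0 q + ∑ i, F.omega0I q i v • F.A i q := by
  have h := expand hq (mvfderiv (𝓡 n) F.A0 q v)
  rwa [coeffn, coeffInf, form_dA0_An hq, form_dA0_A0 hq, neg_zero, zero_smul, zero_smul,
    add_zero, add_zero] at h

omit hq in
/-- A vector orthogonal to the point and its derivatives is proportional to the pole. -/
lemma eq_smul_A0 (hq : q ∈ F.dom) {z : V n} (h0 : form n z (F.A0 q) = 0)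
    (hA : ∀ i, form n z (F.A i q) = 0) (hn : form n z (F.An q) = 0) :
    z = (-form n z (F.Ainf q)) • F.A0 q := by
  have h := expand hq z
  rw [coeffn, coeffInf, h0, hn] at h
  simpa [coeff, hA, coeff0] using h

omit hq
variable (F q)

/-- The scalar products `(dA_n, A_i)`. -/
noncomputable def nMap : TangentSpace (𝓡 n) q →ₗ[ℝ] (Fin (n - 1) → ℝ) :=
  LinearMap.pi fun i => (form n).flip (F.A i q) ∘ₗ (mvfderiv (𝓡 n) F.An q).toLinearMap

/-- The scalar products `(dA_0, A_i)`. -/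
noncomputable def yMap : TangentSpace (𝓡 n) q →ₗ[ℝ] (Fin (n - 1) → ℝ) :=
  LinearMap.pi fun i => (form n).flip (F.A i q) ∘ₗ (mvfderiv (𝓡 n) F.A0 q).toLinearMap

lemma nMap_apply (v i) : F.nMap q v i = form n (mvfderiv (𝓡 n) F.An q v) (F.A i q) := rfl
lemma yMap_apply (v i) : F.yMap q v i = form n (mvfderiv (𝓡 n) F.A0 q v) (F.A i q) := rfl

lemma omeganI_eq (i v) : F.omeganI q i v = ((F.g q)⁻¹.mulVec (F.nMap q v)) i := rfl
lemma omega0I_eq (i v) : F.omega0I q i v = ((F.g q)⁻¹.mulVec (F.yMap q v)) i := rfl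

/-- The form `ν` has maximal rank at `q`: the kernels of `ω_0^i` and `ω_n^i` agree. -/
def IsRegularAt : Prop := ∀ v, F.yMap q v = 0 ↔ F.nMap q v = 0

variable {F q}
include hq

lemma ginv_mulVec_eq_zero {b : Fin (n - 1) → ℝ} : (F.g q)⁻¹.mulVec b = 0 ↔ b = 0 := by
  constructor
  · intro h
    rw [← Matrix.one_mulVec b, ← mul_ginv hq, ← Matrix.mulVec_mulVec, h, Matrix.mulVec_zero]
  · rintro rfl; exact Matrix.mulVec_zero _

lemma g_mulVec_ginv (b : Fin (n - 1) → ℝ) : (F.g q).mulVec ((F.g q)⁻¹.mulVec b) = b := by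
  rw [Matrix.mulVec_mulVec, mul_ginv hq, Matrix.one_mulVec]

lemma ginv_mulVec_g (b : Fin (n - 1) → ℝ) : (F.g q)⁻¹.mulVec ((F.g q).mulVec b) = b := by
  rw [Matrix.mulVec_mulVec, ginv_mul hq, Matrix.one_mulVec]

lemma dAn_eq_smul (v : TangentSpace (𝓡 n) q) (h : F.nMap q v = 0) :
    mvfderiv (𝓡 n) F.An q v = F.omegan0 q v • F.A0 q := by
  have := dAn_eq hq v
  simpa [omeganI_eq, h] using this

lemma dA0_eq_smul (v : TangentSpace (𝓡 n) q) (h : F.yMap q v = 0) :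
    mvfderiv (𝓡 n) F.A0 q v = F.omega00 q v • F.A0 q := by
  have := dA0_eq hq v
  simpa [omega0I_eq, h] using this

/-- From (A_i, A_0) = 0 one gets ω_i^{n+1} = (dA_0, A_i), so the hypothesis reads Y = ν g⁻¹ N with ν
invertible. -/
lemma isRegularAt_of_isNu {ν : Matrix (Fin (n - 1)) (Fin (n - 1)) ℝ} (hν : F.IsNu q ν)
    (hr : ν.rank = n - 1) : F.IsRegularAt q := by
  have hy : ∀ v, F.yMap q v = ν.mulVec ((F.g q)⁻¹.mulVec (F.nMap q v)) := by
    intro v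
    ext i
    have h := hν i v
    rw [omegaIInf, coeffInf, form_dA_A0 hq, neg_neg] at h
    exact h
  have hsurj : Function.Surjective ν.mulVecLin := by
    rw [← LinearMap.range_eq_top]
    apply Submodule.eq_top_of_finrank_eq
    rw [Module.finrank_fin_fun]
    exact hr
  have hinj : Function.Injective ν.mulVecLin := LinearMap.injective_iff_surjective.2 hsurj
  intro v
  rw [hy]
  constructor
  · intro h
    rw [← Matrix.mulVec_zero ν] at h
    exact (ginv_mulVec_eq_zero hq).1 (hinj h)
  · intro h; rw [h]; simp

section Immersed

variable (hX : IsLightlikeHypersurface X)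
include hX

lemma dAn_injective : Function.Injective (mvfderiv (𝓡 n) F.An q) :=
  hX.immersion q F.dom F.An hq F.isLift_An

/-- The forms `ω_n^0, ω_n^i` form a coframe. -/
lemma exists_dAn_eq (a : ℝ) (b : Fin (n - 1) → ℝ) :
    ∃ v, mvfderiv (𝓡 n) F.An q v = a • F.A0 q + ∑ i, b i • F.A i q := by
  -- This is (ω_n^0, N). It is injective because dA_n is, and bijective because 1 + (n - 1) = n.
  let θ : TangentSpace (𝓡 n) q →ₗ[ℝ] ℝ × (Fin (n - 1) → ℝ) :=
    (-((form n).flip (F.Ainf q) ∘ₗ (mvfderiv (𝓡 n) F.An q).toLinearMap)).prod (F.nMap q)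
  have hinj : Function.Injective θ := by
    rw [injective_iff_map_eq_zero]
    intro v hv
    have h1 : F.omegan0 q v = 0 := (Prod.ext_iff.1 hv).1
    have h2 : F.nMap q v = 0 := (Prod.ext_iff.1 hv).2
    have h3 := dAn_eq_smul hq v h2
    rw [h1, zero_smul] at h3
    exact dAn_injective hq hX (h3.trans (map_zero _).symm)
  have hdim : Module.finrank ℝ (TangentSpace (𝓡 n) q)
      = Module.finrank ℝ (ℝ × (Fin (n - 1) → ℝ)) := by
    have := one_le_dim hq
    rw [finrank_tangentSpace]; simp; omega
  obtain ⟨v, hv⟩ := (LinearMap.injective_iff_surjective_of_finrank_eq_finrank hdim).1 hinj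
    (a, (F.g q).mulVec b)
  refine ⟨v, ?_⟩
  have h1 : F.omegan0 q v = a := (Prod.ext_iff.1 hv).1
  have h2 : F.nMap q v = (F.g q).mulVec b := (Prod.ext_iff.1 hv).2
  rw [dAn_eq hq, h1]
  simp only [omeganI_eq, h2, ginv_mulVec_g hq]

lemma nMap_surjective : Function.Surjective (F.nMap q) := by
  intro b
  obtain ⟨v, hv⟩ := exists_dAn_eq hq hX 0 ((F.g q)⁻¹.mulVec b)
  refine ⟨v, ?_⟩
  have hb := g_mulVec_ginv hq b
  ext j
  rw [nMap_apply, hv, ← congrFun hb j, Matrix.mulVec, dotProduct]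
  simp only [zero_smul, zero_add, map_sum, LinearMap.sum_apply, map_smul, LinearMap.smul_apply,
    smul_eq_mul]
  exact Finset.sum_congr rfl fun i _ => by rw [g_apply, form_symm, mul_comm]

/-- A vector orthogonal to the point and its derivatives is proportional to the pole. -/
lemma eq_smul_A0_of_tangent {z : V n} (h0 : form n z (F.An q) = 0)
    (h : ∀ v, form n z (mvfderiv (𝓡 n) F.An q v) = 0) :
    z = (-form n z (F.Ainf q)) • F.A0 q := by
  refine eq_smul_A0 hq ?_ (fun i => ?_) h0
  · obtain ⟨v, hv⟩ := exists_dAn_eq hq hX 1 0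
    simpa [hv] using h v
  · obtain ⟨v, hv⟩ := exists_dAn_eq hq hX 0 (Pi.single i 1)
    simpa [hv, Pi.single_apply, Finset.sum_ite_eq] using h v

variable (hr : F.IsRegularAt q)
include hr

/-- Y has the same kernel as N, hence the same rank, and N is onto. -/
lemma yMap_surjective : Function.Surjective (F.yMap q) := by
  have hk : LinearMap.ker (F.yMap q) = LinearMap.ker (F.nMap q) := by
    ext v; exact hr v
  rw [← LinearMap.range_eq_top]
  apply Submodule.eq_top_of_finrank_eq
  have h1 := (F.yMap q).finrank_range_add_finrank_ker
  have h2 := (F.nMap q).finrank_range_add_finrank_ker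
  rw [LinearMap.range_eq_top.2 (nMap_surjective hq hX), finrank_top] at h2
  rw [hk] at h1
  omega

/-- The matrix `μ = (λ_{ij}) g⁻¹`, with `(dA_n, A_i) = - μ_i^j (dA_0, A_j)`. -/
lemma exists_mu : ∃ μ : Matrix (Fin (n - 1)) (Fin (n - 1)) ℝ,
    ∀ v, F.nMap q v = -(μ.mulVec (F.yMap q v)) := by
  obtain ⟨σ, hσ⟩ := (F.yMap q).exists_rightInverse_of_surjective
    (LinearMap.range_eq_top.2 (yMap_surjective hq hX hr))
  refine ⟨-LinearMap.toMatrix' (F.nMap q ∘ₗ σ), fun v => ?_⟩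
  rw [Matrix.neg_mulVec, neg_neg, LinearMap.toMatrix'_mulVec, LinearMap.comp_apply]
  -- The error v - σ(Yv) lies in ker Y = ker N, so N factors through Y as N∘σ.
  have h1 : F.yMap q (v - σ (F.yMap q v)) = 0 := by
    rw [map_sub, sub_eq_zero]
    exact (LinearMap.congr_fun hσ (F.yMap q v)).symm
  have h2 := (hr _).1 h1
  rwa [map_sub, sub_eq_zero] at h2

lemma mu_unique {μ μ' : Matrix (Fin (n - 1)) (Fin (n - 1)) ℝ}
    (h : ∀ v, F.nMap q v = -(μ.mulVec (F.yMap q v)))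
    (h' : ∀ v, F.nMap q v = -(μ'.mulVec (F.yMap q v))) : μ = μ' := by
  apply Matrix.mulVec_injective
  funext b
  obtain ⟨v, rfl⟩ := yMap_surjective hq hX hr b
  exact neg_injective ((h v).symm.trans (h' v))

omit hX hr in
-- (A_i, A_n) = 0 gives ω_i^n = -N_i, and ω_0 = g⁻¹Y. All later work is done with the matrix μ =
-- Lg⁻¹, which changes by conjugation, scaling and a scalar shift.
lemma isLambda_iff {L : Matrix (Fin (n - 1)) (Fin (n - 1)) ℝ} :
    F.IsLambda q L ↔ ∀ v, F.nMap q v = -((L * (F.g q)⁻¹).mulVec (F.yMap q v)) := by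
  have key : ∀ i v, F.omegaIn q i v = ∑ j, L i j * F.omega0I q j v
      ↔ F.nMap q v i = -((L * (F.g q)⁻¹).mulVec (F.yMap q v)) i := by
    intro i v
    rw [omegaIn, coeffn, form_dA_An hq, ← Matrix.mulVec_mulVec, nMap_apply]
    change _ = L.mulVec ((F.g q)⁻¹.mulVec (F.yMap q v)) i ↔ _
    constructor <;> intro h <;> linarith
  constructor
  · exact fun h v => funext fun i => (key i v).1 (h i v)
  · exact fun h i v => (key i v).2 (congrFun (h v) i)

lemma exists_isLambda : ∃ L, F.IsLambda q L := by
  obtain ⟨μ, hμ⟩ := exists_mu hq hX hr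
  refine ⟨μ * F.g q, (isLambda_iff hq).2 ?_⟩
  rwa [Matrix.mul_assoc, mul_ginv hq, mul_one]

lemma isLambda_unique {L L' : Matrix (Fin (n - 1)) (Fin (n - 1)) ℝ} (h : F.IsLambda q L)
    (h' : F.IsLambda q L') : L = L' := by
  have := mu_unique hq hX hr ((isLambda_iff hq).1 h) ((isLambda_iff hq).1 h')
  have h2 := congrArg (· * F.g q) this
  simpa [Matrix.mul_assoc, ginv_mul hq] using h2

end Immersed

omit hq in
lemma meanLambda_eq (L : Matrix (Fin (n - 1)) (Fin (n - 1)) ℝ) :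
    F.meanLambda q L = 1 / ((n : ℝ) - 1) * (L * (F.g q)⁻¹).trace := by
  simp only [meanLambda, Matrix.trace, Matrix.diag, Matrix.mul_apply]
  congr 1
  exact Finset.sum_congr rfl fun i _ => Finset.sum_congr rfl fun j _ => by rw [ginv_symm]

end AdaptedFrame
end Frame
-- Independence of the normalized representative of the point.
section Lifts

variable {n : ℕ} {M : Type u} [TopologicalSpace M] [ChartedSpace (EuclideanSpace ℝ (Fin n)) M]
  {X : M → ℙ ℝ (V n)} {p : M}

/-- From 2ε dε = 0 with ε ≠ 0. Thus the signs relating two lifts never contribute derivatives. -/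
lemma mvfderiv_eq_zero_of_sq {ε : M → ℝ} {O : Set M} (hO : IsOpen O)
    (hε : ContMDiffOn (𝓡 n) 𝓘(ℝ, ℝ) ∞ ε O) (hsq : ∀ q ∈ O, ε q * ε q = 1) {q : M} (hq : q ∈ O)
    (v : TangentSpace (𝓡 n) q) : mvfderiv (𝓡 n) ε q v = 0 := by
  have hd := mdiffAt_of_smoothOn hO hε hq
  have h1 := mvfderiv_bilin (ContinuousLinearMap.mul ℝ ℝ) hd hd v
  simp only [ContinuousLinearMap.mul_apply'] at h1
  rw [mvfderiv_congr (g := fun _ => (1 : ℝ))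
    (by filter_upwards [hO.mem_nhds hq] with q hq using hsq q hq), mvfderiv_const] at h1
  have h0 : ε q ≠ 0 := fun h => by simpa [h] using hsq q hq
  have h2 : (2 * ε q) * mvfderiv (𝓡 n) ε q v = 0 := by
    have : (0 : TangentSpace (𝓡 n) q →L[ℝ] ℝ) v = 0 := rfl
    rw [this] at h1
    linarith
  exact (mul_eq_zero.1 h2).resolve_left (by simpa using h0)

lemma mvfderiv_smul_apply {F : Type*} [NormedAddCommGroup F] [NormedSpace ℝ F] {a : M → ℝ}
    {f : M → F} (ha : MDifferentiableAt (𝓡 n) 𝓘(ℝ, ℝ) a p)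
    (hf : MDifferentiableAt (𝓡 n) 𝓘(ℝ, F) f p) (v : TangentSpace (𝓡 n) p) :
    mvfderiv (𝓡 n) (fun q => a q • f q) p v
      = mvfderiv (𝓡 n) a p v • f p + a p • mvfderiv (𝓡 n) f p v :=
  mvfderiv_bilin (ContinuousLinearMap.lsmul ℝ ℝ) ha hf v

lemma mdifferentiableAt_smul {F : Type*} [NormedAddCommGroup F] [NormedSpace ℝ F] {a : M → ℝ}
    {f : M → F} (ha : MDifferentiableAt (𝓡 n) 𝓘(ℝ, ℝ) a p)
    (hf : MDifferentiableAt (𝓡 n) 𝓘(ℝ, F) f p) :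
    MDifferentiableAt (𝓡 n) 𝓘(ℝ, F) (fun q => a q • f q) p :=
  mdifferentiableAt_bilin (ContinuousLinearMap.lsmul ℝ ℝ) ha hf

lemma mvfderiv_add_apply {F : Type*} [NormedAddCommGroup F] [NormedSpace ℝ F]
    {f g : M → F} (hf : MDifferentiableAt (𝓡 n) 𝓘(ℝ, F) f p)
    (hg : MDifferentiableAt (𝓡 n) 𝓘(ℝ, F) g p) (v : TangentSpace (𝓡 n) p) :
    mvfderiv (𝓡 n) (fun q => f q + g q) p v
      = mvfderiv (𝓡 n) f p v + mvfderiv (𝓡 n) g p v := by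
  rw [mvfderiv_fun_add hf hg]; rfl

lemma IsLift.eq_smul {O O' : Set M} {x x' : M → V n} (h : IsLift X O x) (h' : IsLift X O' x')
    {q : M} (hq : q ∈ O) (hq' : q ∈ O') :
    x' q = form n (x q) (x' q) • x q ∧ form n (x q) (x' q) * form n (x q) (x' q) = 1 := by
  have h1 : x' q ∈ Submodule.span ℝ {x q} := by
    rw [← h.represents q hq, h'.represents q hq']
    exact Submodule.mem_span_singleton_self _
  obtain ⟨a, ha⟩ := Submodule.mem_span_singleton.1 h1
  have h2 : form n (x q) (x' q) = a := by
    rw [← ha, map_smul, h.normalized q hq, smul_eq_mul, mul_one]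
  refine ⟨by rw [h2, ha], ?_⟩
  have h3 := h'.normalized q hq'
  rw [← ha, map_smul, map_smul, LinearMap.smul_apply, h.normalized q hq] at h3
  rw [h2]
  simpa using h3

lemma IsLift.mvfderiv_eq_smul {O O' : Set M} {x x' : M → V n} (h : IsLift X O x)
    (h' : IsLift X O' x') {q : M} (hq : q ∈ O) (hq' : q ∈ O') (v : TangentSpace (𝓡 n) q) :
    mvfderiv (𝓡 n) x' q v = form n (x q) (x' q) • mvfderiv (𝓡 n) x q v := by
  have hO := h.isOpen.inter h'.isOpen
  have hε := contMDiffOn_form (h.smooth.mono (Set.inter_subset_left (t := O')))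
    (h'.smooth.mono (Set.inter_subset_right (s := O)))
  rw [mvfderiv_congr (g := fun q => form n (x q) (x' q) • x q)
    (by filter_upwards [hO.mem_nhds ⟨hq, hq'⟩] with q hq using (h.eq_smul h' hq.1 hq.2).1),
    mvfderiv_smul_apply (mdiffAt_of_smoothOn hO hε ⟨hq, hq'⟩)
      (mdiffAt_of_smoothOn h.isOpen h.smooth hq),
    mvfderiv_eq_zero_of_sq hO hε (fun q hq => (h.eq_smul h' hq.1 hq.2).2) ⟨hq, hq'⟩,
    zero_smul, zero_add]

namespace AdaptedFrame

variable {F : AdaptedFrame X p} {q : M} (hq : q ∈ F.dom)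
include hq

lemma A0_ne_zero : F.A0 q ≠ 0 := fun h => by
  have := F.form_A0_Ainf q hq
  simp [h] at this

lemma span_An : (X q).submodule = Submodule.span ℝ {F.An q} := F.isLift_An.represents q hq

/-- Other lifts differ from A_n by a sign to first order, so the tangent plane is that of A_n, whose
orthogonal complement is the line of A_0. -/
lemma orthogonal_tangentPlane (hX : IsLightlikeHypersurface X) :
    (form n).orthogonal (tangentPlane X q) = Submodule.span ℝ {F.A0 q} := by
  have hlift : ∀ O x, q ∈ O ∧ IsLift X O x →
      Submodule.span ℝ {x q} ⊔ LinearMap.range (mvfderiv (𝓡 n) x q).toLinearMap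
        ≤ tangentPlane X q := fun O x h => le_iSup_of_le O (le_iSup_of_le x (le_iSup_of_le h le_rfl))
  apply le_antisymm
  · intro z hz
    have h1 : form n z (F.An q) = 0 := by
      rw [form_symm]
      exact hz _ (hlift F.dom F.An ⟨hq, F.isLift_An⟩
        (Submodule.mem_sup_left (Submodule.mem_span_singleton_self _)))
    have h2 : ∀ v, form n z (mvfderiv (𝓡 n) F.An q v) = 0 := fun v => by
      rw [form_symm]
      exact hz _ (hlift F.dom F.An ⟨hq, F.isLift_An⟩
        (Submodule.mem_sup_right (LinearMap.mem_range_self _ v)))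
    rw [eq_smul_A0_of_tangent hq hX h1 h2]
    exact Submodule.smul_mem _ _ (Submodule.mem_span_singleton_self _)
  · rw [Submodule.span_singleton_le_iff_mem]
    have : tangentPlane X q ≤ LinearMap.ker ((form n).flip (F.A0 q)) := by
      refine iSup_le fun O => iSup_le fun x => iSup_le fun h => sup_le ?_ ?_
      · rw [Submodule.span_singleton_le_iff_mem, LinearMap.mem_ker]
        change form n (x q) (F.A0 q) = 0
        rw [(F.isLift_An.eq_smul h.2 hq h.1).1, map_smul, LinearMap.smul_apply, form_An_A0 hq,
          smul_zero]
      · rintro _ ⟨v, rfl⟩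
        rw [LinearMap.mem_ker]
        change form n (mvfderiv (𝓡 n) x q v) (F.A0 q) = 0
        rw [F.isLift_An.mvfderiv_eq_smul h.2 hq h.1, map_smul, LinearMap.smul_apply,
          F.tangent q hq, smul_zero]
    exact fun z hz => this hz

lemma generator_eq (hX : IsLightlikeHypersurface X) :
    generator X q = Submodule.span ℝ {F.An q} ⊔ Submodule.span ℝ {F.A0 q} := by
  rw [generator, orthogonal_tangentPlane hq hX, span_An hq]

end AdaptedFrame

end Lifts

/-! ### Comparison of two frames under a motion and a displacement along the generators. -/

section Transport

variable {n : ℕ} {M M' : Type u} [TopologicalSpace M] [ChartedSpace (EuclideanSpace ℝ (Fin n)) M]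
  [TopologicalSpace M'] [ChartedSpace (EuclideanSpace ℝ (Fin n)) M']
  {X : M → ℙ ℝ (V n)} {X' : M' → ℙ ℝ (V n)} {p : M} {φ : M → M'} {T : V n ≃ₗ[ℝ] V n}

lemma mvfderiv_comp_map {F : Type*} [NormedAddCommGroup F] [NormedSpace ℝ F] {f : M' → F}
    (hf : MDifferentiableAt (𝓡 n) 𝓘(ℝ, F) f (φ p)) (hφ : MDifferentiableAt (𝓡 n) (𝓡 n) φ p)
    (v : TangentSpace (𝓡 n) p) :
    mvfderiv (𝓡 n) (fun q => f (φ q)) p v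
      = mvfderiv (𝓡 n) f (φ p) (mfderiv (𝓡 n) (𝓡 n) φ p v) :=
  mfderiv_comp_apply p hf hφ v

lemma IsLocalDiffeomorphAt.exists_nhds (h : IsLocalDiffeomorphAt (𝓡 n) (𝓡 n) ∞ φ p) :
    ∃ O : Set M, IsOpen O ∧ p ∈ O ∧ ∀ q ∈ O, IsLocalDiffeomorphAt (𝓡 n) (𝓡 n) ∞ φ q := by
  obtain ⟨Φ, hp, hΦ⟩ := h
  exact ⟨Φ.source, Φ.open_source, hp, fun q hq => ⟨Φ, hq, hΦ⟩⟩

lemma IsLocalDiffeomorphAt.surjective_mfderiv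
    (h : IsLocalDiffeomorphAt (𝓡 n) (𝓡 n) ∞ φ p) :
    Function.Surjective (mfderiv (𝓡 n) (𝓡 n) φ p) :=
  (h.mfderivToContinuousLinearEquiv (by simp)).surjective

/-- A linear automorphism as a continuous linear map. -/
noncomputable def toCLM (T : V n ≃ₗ[ℝ] V n) : V n →L[ℝ] V n :=
  LinearMap.toContinuousLinearMap T.toLinearMap

/-- One product rule for all transported fields: two terms are needed for A_n, while A_0, the
harmonic pole and dA_n(Y) use it with b = 0. -/
lemma mvfderiv_of_comp_eq {f' : M' → V n} {f g : M → V n} {a b : M → ℝ}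
    (hf' : MDifferentiableAt (𝓡 n) 𝓘(ℝ, V n) f' (φ p))
    (hφ : IsLocalDiffeomorphAt (𝓡 n) (𝓡 n) ∞ φ p)
    (ha : MDifferentiableAt (𝓡 n) 𝓘(ℝ, ℝ) a p) (hb : MDifferentiableAt (𝓡 n) 𝓘(ℝ, ℝ) b p)
    (hf : MDifferentiableAt (𝓡 n) 𝓘(ℝ, V n) f p) (hg : MDifferentiableAt (𝓡 n) 𝓘(ℝ, V n) g p)
    (h : ∀ᶠ q in 𝓝 p, f' (φ q) = T (a q • f q + b q • g q)) (v : TangentSpace (𝓡 n) p) :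
    mvfderiv (𝓡 n) f' (φ p) (mfderiv (𝓡 n) (𝓡 n) φ p v)
      = T (mvfderiv (𝓡 n) a p v • f p + a p • mvfderiv (𝓡 n) f p v
        + (mvfderiv (𝓡 n) b p v • g p + b p • mvfderiv (𝓡 n) g p v)) := by
  have haf := mdifferentiableAt_smul ha hf
  have hbg := mdifferentiableAt_smul hb hg
  rw [← mvfderiv_comp_map hf' (hφ.mdifferentiableAt (by simp)),
    mvfderiv_congr (g := fun q => toCLM T (a q • f q + b q • g q)) h,
    mvfderiv_clm_comp (toCLM T) (f := fun q => a q • f q + b q • g q) (haf.add hbg),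
    mvfderiv_add_apply haf hbg,
    mvfderiv_smul_apply ha hf, mvfderiv_smul_apply hb hg]
  rfl

/-- Near `p` the frame `F'` arises from `F` by the motion `T`, a displacement of the point along the
generator, and a change of normalization of the points `A_0`. -/
structure IsTransport (F : AdaptedFrame X p) (F' : AdaptedFrame X' (φ p)) (T : V n ≃ₗ[ℝ] V n)
    (O : Set M) (ε s t : M → ℝ) : Prop where
  isOpen : IsOpen O
  mem : p ∈ O
  subset : O ⊆ F.dom
  mapsTo : ∀ q ∈ O, φ q ∈ F'.dom
  localDiffeo : ∀ q ∈ O, IsLocalDiffeomorphAt (𝓡 n) (𝓡 n) ∞ φ q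
  smooth_ε : ContMDiffOn (𝓡 n) 𝓘(ℝ, ℝ) ∞ ε O
  smooth_s : ContMDiffOn (𝓡 n) 𝓘(ℝ, ℝ) ∞ s O
  smooth_t : ContMDiffOn (𝓡 n) 𝓘(ℝ, ℝ) ∞ t O
  sq : ∀ q ∈ O, ε q * ε q = 1
  ne_zero : ∀ q ∈ O, s q ≠ 0
  An_eq : ∀ q ∈ O, F'.An (φ q) = T (ε q • F.An q + t q • F.A0 q)
  A0_eq : ∀ q ∈ O, F'.A0 (φ q) = T (s q • F.A0 q)

/-- The first relation is the hypothesis on generators. For the second, T(A_0) is orthogonal to A_n'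
and to all its derivatives, so it is proportional to the pole A_0'. -/
lemma exists_isTransport (hX : IsLightlikeHypersurface X) (hX' : IsLightlikeHypersurface X')
    (F : AdaptedFrame X p) (F' : AdaptedFrame X' (φ p)) (hT : IsMotion T)
    (hφ : IsLocalDiffeomorphAt (𝓡 n) (𝓡 n) ∞ φ p) (hg : CarriesGenerators X X' T φ p) :
    ∃ O ε s t, IsTransport F F' T O ε s t := by
  obtain ⟨O₁, hO₁, hp₁, hd⟩ := IsLocalDiffeomorphAt.exists_nhds hφ
  obtain ⟨O₂, hO₂, hO₂o, hp₂⟩ := eventually_nhds_iff.1 hg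
  obtain ⟨O₃, hO₃, hO₃o, hp₃⟩ := eventually_nhds_iff.1
    (hφ.contMDiffAt.continuousAt.eventually_mem (F'.isOpen_dom.mem_nhds F'.mem_dom))
  set O := F.dom ∩ O₁ ∩ O₂ ∩ O₃ with hOdef
  have hO : IsOpen O := ((F.isOpen_dom.inter hO₁).inter hO₂o).inter hO₃o
  have hφs : ContMDiffOn (𝓡 n) (𝓡 n) ∞ φ O :=
    fun q hq => (hd q hq.1.1.2).contMDiffAt.contMDiffWithinAt
  have sF : ∀ {f : M → V n}, ContMDiffOn (𝓡 n) 𝓘(ℝ, V n) ∞ f F.dom →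
      ContMDiffOn (𝓡 n) 𝓘(ℝ, V n) ∞ (fun q => T (f q)) O := fun hf =>
    (toCLM T).contMDiff.comp_contMDiffOn (hf.mono fun q hq => hq.1.1.1)
  have sF' : ∀ {f : M' → V n}, ContMDiffOn (𝓡 n) 𝓘(ℝ, V n) ∞ f F'.dom →
      ContMDiffOn (𝓡 n) 𝓘(ℝ, V n) ∞ (fun q => f (φ q)) O := fun hf =>
    hf.comp hφs fun q hq => hO₃ q hq.2
  -- Defining the coefficients by scalar products with the moved frame makes them smooth at once.
  let ε : M → ℝ := fun q => form n (F'.An (φ q)) (T (F.An q))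
  let t : M → ℝ := fun q => -form n (F'.An (φ q)) (T (F.Ainf q))
  let s : M → ℝ := fun q => -form n (F'.A0 (φ q)) (T (F.Ainf q))
  have hε : ContMDiffOn (𝓡 n) 𝓘(ℝ, ℝ) ∞ ε O := contMDiffOn_form (sF' F'.smooth_An) (sF F.smooth_An)
  have ht : ContMDiffOn (𝓡 n) 𝓘(ℝ, ℝ) ∞ t O :=
    (contMDiffOn_form (sF' F'.smooth_An) (sF F.smooth_Ainf)).neg
  have hs : ContMDiffOn (𝓡 n) 𝓘(ℝ, ℝ) ∞ s O :=
    (contMDiffOn_form (sF' F'.smooth_A0) (sF F.smooth_Ainf)).neg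
  have hAn : ∀ q ∈ O, F'.An (φ q) = T (ε q • F.An q + t q • F.A0 q) ∧ ε q * ε q = 1 := by
    intro q hq
    have hqF := hq.1.1.1
    have h1 : F'.An (φ q) ∈ (X' (φ q)).submodule := by
      rw [AdaptedFrame.span_An (hO₃ q hq.2)]; exact Submodule.mem_span_singleton_self _
    obtain ⟨z, hz, hzT⟩ := hO₂ q hq.1.2 h1
    rw [SetLike.mem_coe, AdaptedFrame.generator_eq hqF hX, Submodule.mem_sup] at hz
    obtain ⟨_, hy, _, hw, rfl⟩ := hz
    obtain ⟨a, rfl⟩ := Submodule.mem_span_singleton.1 hy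
    obtain ⟨b, rfl⟩ := Submodule.mem_span_singleton.1 hw
    have hzT' : F'.An (φ q) = T (a • F.An q + b • F.A0 q) := hzT.symm
    have ha : ε q = a := by
      simp only [ε]
      rw [hzT', hT, map_add, map_smul, map_smul, LinearMap.add_apply, LinearMap.smul_apply,
        LinearMap.smul_apply, AdaptedFrame.form_An_An hqF, F.form_A0_An q hqF]
      simp
    have hb : t q = b := by
      simp only [t]
      rw [hzT', hT, map_add, map_smul, map_smul, LinearMap.add_apply, LinearMap.smul_apply,
        LinearMap.smul_apply, F.form_An_Ainf q hqF, F.form_A0_Ainf q hqF]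
      simp
    refine ⟨by rw [ha, hb, hzT'], ?_⟩
    have h2 := AdaptedFrame.form_An_An (hO₃ q hq.2)
    rw [hzT', hT] at h2
    simp only [map_add, map_smul, LinearMap.add_apply, LinearMap.smul_apply,
      AdaptedFrame.form_An_An hqF, F.form_A0_An q hqF, AdaptedFrame.form_An_A0 hqF,
      F.form_A0_A0 q hqF, smul_eq_mul] at h2
    rw [ha]; linarith
  have hA0 : ∀ q ∈ O, F'.A0 (φ q) = T (s q • F.A0 q) := by
    intro q hq
    have hqF := hq.1.1.1
    have hqF' := hO₃ q hq.2
    have h1 : form n (T (F.A0 q)) (F'.An (φ q)) = 0 := by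
      rw [(hAn q hq).1, hT, map_add, map_smul, map_smul, F.form_A0_An q hqF, F.form_A0_A0 q hqF]
      simp
    -- A_0 is orthogonal to A_0, dA_0 and dA_n, so the displacement term tA_0 does no harm.
    have h2 : ∀ w, form n (T (F.A0 q)) (mvfderiv (𝓡 n) F'.An (φ q) w) = 0 := by
      intro w
      obtain ⟨v, rfl⟩ := IsLocalDiffeomorphAt.surjective_mfderiv (hd q hq.1.1.2) w
      rw [mvfderiv_of_comp_eq (AdaptedFrame.mdiff_An hqF') (hd q hq.1.1.2)
        (mdiffAt_of_smoothOn hO hε hq) (mdiffAt_of_smoothOn hO ht hq)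
        (AdaptedFrame.mdiff_An hqF) (AdaptedFrame.mdiff_A0 hqF)
        (by filter_upwards [hO.mem_nhds hq] with r hr using (hAn r hr).1), hT]
      simp only [map_add, map_smul, F.form_A0_An q hqF, F.form_A0_A0 q hqF,
        form_symm (F.A0 q) (mvfderiv _ _ _ _), F.tangent q hqF, AdaptedFrame.form_dA0_A0 hqF]
      simp
    have h3 := AdaptedFrame.eq_smul_A0_of_tangent hqF' hX' h1 h2
    set c := -form n (T (F.A0 q)) (F'.Ainf (φ q))
    have hc : c ≠ 0 := by
      intro hc
      rw [hc, zero_smul] at h3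
      exact AdaptedFrame.A0_ne_zero hqF (T.map_eq_zero_iff.1 h3)
    have h4 : F'.A0 (φ q) = T (c⁻¹ • F.A0 q) := by
      rw [map_smul, h3, smul_smul, inv_mul_cancel₀ hc, one_smul]
    have h5 : s q = c⁻¹ := by
      simp only [s]
      rw [h4, hT, map_smul, LinearMap.smul_apply, F.form_A0_Ainf q hqF]
      simp
    rw [h5, h4]
  refine ⟨O, ε, s, t, hO, ⟨⟨⟨F.mem_dom, hp₁⟩, hp₂⟩, hp₃⟩, fun q hq => hq.1.1.1,
    fun q hq => hO₃ q hq.2, fun q hq => hd q hq.1.1.2, hε, hs, ht, fun q hq => (hAn q hq).2,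
    fun q hq h0 => ?_, fun q hq => (hAn q hq).1, hA0⟩
  have := hA0 q hq
  rw [h0, zero_smul, map_zero] at this
  exact AdaptedFrame.A0_ne_zero (hO₃ q hq.2) this

namespace IsTransport

open AdaptedFrame

variable {F : AdaptedFrame X p} {F' : AdaptedFrame X' (φ p)} {O : Set M} {ε s t : M → ℝ}
  (h : IsTransport F F' T O ε s t) {q : M} (hq : q ∈ O)
include h hq

lemma mvfderiv_An (v : TangentSpace (𝓡 n) q) :
    mvfderiv (𝓡 n) F'.An (φ q) (mfderiv (𝓡 n) (𝓡 n) φ q v)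
      = T (ε q • mvfderiv (𝓡 n) F.An q v
        + (mvfderiv (𝓡 n) t q v • F.A0 q + t q • mvfderiv (𝓡 n) F.A0 q v)) := by
  rw [mvfderiv_of_comp_eq (mdiff_An (h.mapsTo q hq)) (h.localDiffeo q hq)
    (mdiffAt_of_smoothOn h.isOpen h.smooth_ε hq) (mdiffAt_of_smoothOn h.isOpen h.smooth_t hq)
    (mdiff_An (h.subset hq)) (mdiff_A0 (h.subset hq))
    (by filter_upwards [h.isOpen.mem_nhds hq] with r hr using h.An_eq r hr),
    mvfderiv_eq_zero_of_sq h.isOpen h.smooth_ε h.sq hq, zero_smul, zero_add]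

lemma mvfderiv_A0 (v : TangentSpace (𝓡 n) q) :
    mvfderiv (𝓡 n) F'.A0 (φ q) (mfderiv (𝓡 n) (𝓡 n) φ q v)
      = T (mvfderiv (𝓡 n) s q v • F.A0 q + s q • mvfderiv (𝓡 n) F.A0 q v) := by
  have hF := mdiff_A0 (h.subset hq)
  rw [mvfderiv_of_comp_eq (b := fun _ => 0) (mdiff_A0 (h.mapsTo q hq)) (h.localDiffeo q hq)
    (mdiffAt_of_smoothOn h.isOpen h.smooth_s hq) mdifferentiableAt_const hF hF
    (by filter_upwards [h.isOpen.mem_nhds hq] with r hr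
        simpa using h.A0_eq r hr), mvfderiv_const]
  simp

variable (hT : IsMotion T)
include hT

/-- The matrix relating the points `A_i` of the two frames. -/
lemma exists_matrix : ∃ P : Matrix (Fin (n - 1)) (Fin (n - 1)) ℝ, IsUnit P.det ∧
    (∃ c : Fin (n - 1) → ℝ, ∀ i, F'.A i (φ q) = T (c i • F.A0 q + ∑ j, P i j • F.A j q)) ∧
    ∀ v, F'.yMap (φ q) (mfderiv (𝓡 n) (𝓡 n) φ q v) = P.mulVec (s q • F.yMap q v) ∧
      F'.nMap (φ q) (mfderiv (𝓡 n) (𝓡 n) φ q v)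
        = P.mulVec (ε q • F.nMap q v + t q • F.yMap q v) := by
  have hqF := h.subset hq
  have hqF' := h.mapsTo q hq
  have hs0 := h.ne_zero q hq
  have hε0 : ε q ≠ 0 := fun h0 => by simpa [h0] using h.sq q hq
  -- The preimage of A_i' is orthogonal to A_0 and A_n, so it has no component at A_{n+1} or A_n.
  have hA : ∀ i, F'.A i (φ q) = T (F.coeff0 q (T.symm (F'.A i (φ q))) • F.A0 q
      + ∑ j, F.coeff q j (T.symm (F'.A i (φ q))) • F.A j q) := by
    intro i
    have h0 : form n (T.symm (F'.A i (φ q))) (F.A0 q) = 0 := by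
      have := form_A_A0 hqF' i
      rw [h.A0_eq q hq, ← T.apply_symm_apply (F'.A i (φ q)), hT, map_smul] at this
      exact (smul_eq_zero.1 this).resolve_left hs0
    have h1 : form n (T.symm (F'.A i (φ q))) (F.An q) = 0 := by
      have := F'.form_A_An _ hqF' i
      rw [h.An_eq q hq, ← T.apply_symm_apply (F'.A i (φ q)), hT, map_add, map_smul, map_smul,
        h0, smul_zero, add_zero] at this
      exact (smul_eq_zero.1 this).resolve_left hε0
    have h2 := expand hqF (T.symm (F'.A i (φ q)))
    rw [coeffn, coeffInf, h0, h1, neg_zero, zero_smul, zero_smul, add_zero, add_zero] at h2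
    conv_lhs => rw [← T.apply_symm_apply (F'.A i (φ q)), h2]
  set P : Matrix (Fin (n - 1)) (Fin (n - 1)) ℝ :=
    Matrix.of fun i j => F.coeff q j (T.symm (F'.A i (φ q))) with hP
  set c : Fin (n - 1) → ℝ := fun i => F.coeff0 q (T.symm (F'.A i (φ q))) with hc
  have hA' : ∀ i, F'.A i (φ q) = T (c i • F.A0 q + ∑ j, P i j • F.A j q) := hA
  have hpair : ∀ i z, form n z (F.A0 q) = 0 → form n (T z) (F'.A i (φ q))
      = ∑ j, P i j * form n z (F.A j q) := by
    intro i z hz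
    rw [hA' i, hT, map_add, map_smul, hz, smul_zero, zero_add, map_sum]
    simp
  refine ⟨P, ?_, ⟨c, hA'⟩, fun v => ⟨?_, ?_⟩⟩
  -- The A_0 parts are invisible to g, so g' = PgPᵀ, and invertibility of g' forces that of P.
  · have hg : F'.g (φ q) = P * F.g q * P.transpose := by
      ext i j
      rw [g_apply, hA' i, hpair j]
      · simp only [Matrix.mul_apply, Matrix.transpose_apply, map_add, map_smul, map_sum,
          LinearMap.add_apply, LinearMap.smul_apply, LinearMap.sum_apply, F.form_A0_A q hqF,
          mul_zero, zero_add, g_apply, smul_eq_mul]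
        exact Finset.sum_congr rfl fun k _ => mul_comm _ _
      · simp [F.form_A0_A0 q hqF, form_A_A0 hqF]
    have hu := isUnit_det_g hqF'
    rw [hg, Matrix.det_mul, Matrix.det_mul] at hu
    exact isUnit_of_mul_isUnit_left (isUnit_of_mul_isUnit_left hu)
  · ext i
    rw [yMap_apply, h.mvfderiv_A0 hq, hpair]
    · simp only [map_add, map_smul, LinearMap.add_apply, LinearMap.smul_apply,
        F.form_A0_A q hqF, smul_zero, zero_add, Matrix.mulVec, dotProduct]
      rfl
    · simp [F.form_A0_A0 q hqF, form_dA0_A0 hqF]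
  · ext i
    rw [nMap_apply, h.mvfderiv_An hq, hpair]
    · simp only [map_add, map_smul, LinearMap.add_apply, LinearMap.smul_apply,
        F.form_A0_A q hqF, smul_zero, zero_add, Matrix.mulVec, dotProduct]
      rfl
    · simp [F.form_A0_A0 q hqF, form_dA0_A0 hqF, F.tangent q hqF]

/-- No displacement is allowed here: the kernel of εN + tY = (t - εμ)Y may exceed that of Y, which
happens at the singular points of the generator. -/
lemma isRegularAt_of (hr : F.IsRegularAt q) (ht : t q = 0) : F'.IsRegularAt (φ q) := by
  obtain ⟨P, hP, -, hv⟩ := h.exists_matrix hq hT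
  have hinj : Function.Injective P.mulVec :=
    Matrix.mulVec_injective_of_isUnit ((Matrix.isUnit_iff_isUnit_det P).2 hP)
  have h0 : ∀ b, P.mulVec b = 0 ↔ b = 0 := fun b =>
    ⟨fun hb => hinj (hb.trans (Matrix.mulVec_zero P).symm), fun hb => by rw [hb, Matrix.mulVec_zero]⟩
  have hs0 := h.ne_zero q hq
  have hε0 : ε q ≠ 0 := fun h0 => by simpa [h0] using h.sq q hq
  intro w
  obtain ⟨v, rfl⟩ := IsLocalDiffeomorphAt.surjective_mfderiv (h.localDiffeo q hq) w
  rw [(hv v).1, (hv v).2, h0, h0, smul_eq_zero, or_iff_right hs0, ht, zero_smul, add_zero,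
    smul_eq_zero, or_iff_right hε0, hr v]

variable (hn : 2 ≤ n) (hX : IsLightlikeHypersurface X) (hr : F.IsRegularAt q)
  {L L' : Matrix (Fin (n - 1)) (Fin (n - 1)) ℝ} (hL : F.IsLambda q L) (hL' : F'.IsLambda (φ q) L')
include hn hX hr hL hL'

/-- Inserting the transformed N and Y into N' = -μ'Y' gives sμ' = P(εμ - t)P⁻¹; the claim is the
trace of this divided by n - 1. Exactly this shift makes A_n + λA_0 insensitive to the displacement.
-/
lemma meanLambda_eq : s q * F'.meanLambda (φ q) L' = ε q * F.meanLambda q L - t q := by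
  obtain ⟨P, hP, -, hv⟩ := h.exists_matrix hq hT
  have hμL := (isLambda_iff (h.subset hq)).1 hL
  have hμL' := (isLambda_iff (h.mapsTo q hq)).1 hL'
  rw [AdaptedFrame.meanLambda_eq, AdaptedFrame.meanLambda_eq]
  generalize L * (F.g q)⁻¹ = μ at *
  generalize L' * (F'.g (φ q))⁻¹ = μ' at *
  -- An identity of matrices may be tested on vectors Y(v), since Y is onto.
  have hrel : P * (t q • 1 - ε q • μ) = -(s q • (μ' * P)) := by
    apply Matrix.mulVec_injective
    funext b
    obtain ⟨v, rfl⟩ := yMap_surjective (h.subset hq) hX hr b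
    have h1 := hμL' (mfderiv (𝓡 n) (𝓡 n) φ q v)
    rw [(hv v).1, (hv v).2, hμL v, Matrix.mulVec_smul, Matrix.mulVec_smul] at h1
    rw [← Matrix.mulVec_mulVec _ P, Matrix.sub_mulVec, Matrix.smul_mulVec, Matrix.one_mulVec,
      Matrix.smul_mulVec, Matrix.neg_mulVec, Matrix.smul_mulVec, ← Matrix.mulVec_mulVec _ μ' P,
      ← h1]
    congr 1
    module
  have htr : t q * ((n : ℝ) - 1) - ε q * μ.trace = -(s q * μ'.trace) := by
    have h1 : (P * (t q • 1 - ε q • μ) * P⁻¹).trace = (-(s q • (μ' * P)) * P⁻¹).trace := by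
      rw [hrel]
    rw [Matrix.trace_mul_comm, ← Matrix.mul_assoc, Matrix.nonsing_inv_mul _ hP, Matrix.one_mul,
      neg_mul, Matrix.smul_mul, Matrix.mul_assoc, Matrix.mul_nonsing_inv _ hP, Matrix.mul_one,
      Matrix.trace_neg, Matrix.trace_sub, Matrix.trace_smul, Matrix.trace_smul, Matrix.trace_smul,
      Matrix.trace_one, Fintype.card_fin, Nat.cast_sub (by omega)] at h1
    simpa using h1
  have hn1 : (n : ℝ) - 1 ≠ 0 := by
    have : (2 : ℝ) ≤ n := by exact_mod_cast hn
    linarith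
  field_simp
  linarith

/-- The harmonic pole is invariant up to sign. -/
lemma harmonicPole_eq :
    F'.An (φ q) + F'.meanLambda (φ q) L' • F'.A0 (φ q)
      = T (ε q • (F.An q + F.meanLambda q L • F.A0 q)) := by
  rw [h.An_eq q hq, h.A0_eq q hq, ← map_smul, ← map_add, smul_smul, mul_comm _ (s q),
    h.meanLambda_eq hq hT hn hX hr hL hL']
  congr 1
  module

end IsTransport

end Transport

/-! ### The case T = 1: change of frame on one hypersurface. -/

section Identity

variable {n : ℕ} {M : Type u} [TopologicalSpace M] [ChartedSpace (EuclideanSpace ℝ (Fin n)) M]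
  {X : M → ℙ ℝ (V n)} {p : M}

lemma isMotion_refl : IsMotion (LinearEquiv.refl ℝ (V n)) := fun _ _ => rfl

lemma isLocalDiffeomorphAt_id (p : M) : IsLocalDiffeomorphAt (𝓡 n) (𝓡 n) ∞ (id : M → M) p :=
  (Diffeomorph.refl (𝓡 n) M ∞).isLocalDiffeomorph p

omit [ChartedSpace (EuclideanSpace ℝ (Fin n)) M] in
lemma carriesPoints_id (X : M → ℙ ℝ (V n)) (p : M) :
    CarriesPoints X X (LinearEquiv.refl ℝ (V n)) id p :=
  Filter.Eventually.of_forall fun _ => (Submodule.map_id _).symm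

lemma CarriesPoints.carriesGenerators {M' : Type u} [TopologicalSpace M']
    [ChartedSpace (EuclideanSpace ℝ (Fin n)) M'] {X' : M' → ℙ ℝ (V n)} {T : V n ≃ₗ[ℝ] V n}
    {φ : M → M'} (h : CarriesPoints X X' T φ p) : CarriesGenerators X X' T φ p := by
  filter_upwards [h] with q hq
  rw [hq]
  exact Submodule.map_mono le_sup_left

lemma IsTransport.displacement_eq_zero {M' : Type u} [TopologicalSpace M']
    [ChartedSpace (EuclideanSpace ℝ (Fin n)) M'] {X' : M' → ℙ ℝ (V n)} {T : V n ≃ₗ[ℝ] V n}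
    {φ : M → M'} {F : AdaptedFrame X p} {F' : AdaptedFrame X' (φ p)} {O : Set M} {ε s t : M → ℝ}
    (h : IsTransport F F' T O ε s t) {q : M} (hq : q ∈ O)
    (hc : (X' (φ q)).submodule = (X q).submodule.map T.toLinearMap) : t q = 0 := by
  have h1 : F'.An (φ q) ∈ (X' (φ q)).submodule := by
    rw [AdaptedFrame.span_An (h.mapsTo q hq)]; exact Submodule.mem_span_singleton_self _
  rw [hc] at h1
  obtain ⟨z, hz, hzT⟩ := h1
  rw [SetLike.mem_coe, AdaptedFrame.span_An (h.subset hq)] at hz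
  obtain ⟨a, rfl⟩ := Submodule.mem_span_singleton.1 hz
  have h2 : T (a • F.An q) = T (ε q • F.An q + t q • F.A0 q) := hzT.trans (h.An_eq q hq)
  have h3 := congrArg (fun z => form n z (F.Ainf q)) (T.injective h2)
  simpa [F.form_An_Ainf q (h.subset hq), F.form_A0_Ainf q (h.subset hq)] using h3

lemma exists_isTransport_id (hX : IsLightlikeHypersurface X) (F F' : AdaptedFrame X p) :
    ∃ O ε s t, IsTransport (φ := id) F F' (LinearEquiv.refl ℝ (V n)) O ε s t :=
  exists_isTransport hX hX F (φ := id) F' isMotion_refl (isLocalDiffeomorphAt_id p)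
    (carriesPoints_id X p).carriesGenerators

/-- The rank is given in some frame at each point; an identity transport without displacement
carries regularity to every frame, at every point of its domain. -/
lemma AdaptedFrame.isRegularAt (hX : IsLightlikeHypersurface X) (hrank : HasMaximalRank X)
    (F : AdaptedFrame X p) {q : M} (hq : q ∈ F.dom) : F.IsRegularAt q := by
  obtain ⟨F₀, ν, hν, hr⟩ := hrank q
  obtain ⟨O, ε, s, t, h⟩ := exists_isTransport_id hX F₀ (F.moveTo hq)
  exact h.isRegularAt_of h.mem isMotion_refl (isRegularAt_of_isNu F₀.mem_dom hν hr)
    (h.displacement_eq_zero h.mem (Submodule.map_id _).symm)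

end Identity

/-! ### Smoothness of determinants, products and inverses of matrix functions. -/

section SmoothMatrix

variable {n : ℕ} {M : Type*} [TopologicalSpace M] [ChartedSpace (EuclideanSpace ℝ (Fin n)) M]
  {ι κ τ : Type*} {O : Set M}

lemma contDiff_det [Fintype ι] [DecidableEq ι] : ContDiff ℝ ∞ fun A : ι → ι → ℝ => (Matrix.of A).det := by
  simp only [Matrix.det_apply, Matrix.of_apply]
  exact ContDiff.sum fun σ _ => (contDiff_prod fun i _ => contDiff_apply_apply ℝ ℝ _ _).const_smul _

lemma contMDiffOn_matrix_det [Fintype ι] [DecidableEq ι] {A : M → Matrix ι ι ℝ}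
    (hA : ∀ i j, ContMDiffOn (𝓡 n) 𝓘(ℝ, ℝ) ∞ (fun q => A q i j) O) :
    ContMDiffOn (𝓡 n) 𝓘(ℝ, ℝ) ∞ (fun q => (A q).det) O :=
  contDiff_det.contMDiff.comp_contMDiffOn
    (contMDiffOn_pi_space.2 fun i => contMDiffOn_pi_space.2 fun j => hA i j)

lemma contMDiffOn_matrix_mul [Fintype κ] {A : M → Matrix ι κ ℝ} {B : M → Matrix κ τ ℝ}
    (hA : ∀ i j, ContMDiffOn (𝓡 n) 𝓘(ℝ, ℝ) ∞ (fun q => A q i j) O)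
    (hB : ∀ i j, ContMDiffOn (𝓡 n) 𝓘(ℝ, ℝ) ∞ (fun q => B q i j) O) (i j) :
    ContMDiffOn (𝓡 n) 𝓘(ℝ, ℝ) ∞ (fun q => (A q * B q) i j) O := by
  simp only [Matrix.mul_apply]
  exact contMDiffOn_finsetSum fun k _ => (hA i k).mul (hB k j)

lemma contMDiffOn_matrix_inv [Fintype ι] [DecidableEq ι] {A : M → Matrix ι ι ℝ}
    (hA : ∀ i j, ContMDiffOn (𝓡 n) 𝓘(ℝ, ℝ) ∞ (fun q => A q i j) O)
    (h0 : ∀ q ∈ O, (A q).det ≠ 0) (i j) :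
    ContMDiffOn (𝓡 n) 𝓘(ℝ, ℝ) ∞ (fun q => (A q)⁻¹ i j) O := by
  have h1 : ContMDiffOn (𝓡 n) 𝓘(ℝ, ℝ) ∞ (fun q => ((A q).det)⁻¹) O :=
    (contMDiffOn_matrix_det hA).inv₀ h0
  have h2 : ContMDiffOn (𝓡 n) 𝓘(ℝ, ℝ) ∞ (fun q => (A q).adjugate i j) O := by
    simp only [Matrix.adjugate_apply]
    refine contMDiffOn_matrix_det fun k l => ?_
    by_cases hk : k = j
    · subst hk
      simp only [Matrix.updateRow_self]
      exact contMDiffOn_const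
    · simp only [Matrix.updateRow_ne hk]
      exact hA k l
  refine (h1.mul h2).congr fun q hq => ?_
  rw [Matrix.inv_def, Ring.inverse_eq_inv', Matrix.smul_apply, smul_eq_mul]
  rfl

end SmoothMatrix

/-! ### Smoothness of a field tested after an immersion. -/

section SmoothField

variable {n : ℕ} {M : Type*} [TopologicalSpace M] [ChartedSpace (EuclideanSpace ℝ (Fin n)) M]
  [IsManifold (𝓡 n) ∞ M] {W : Type*} [NormedAddCommGroup W] [InnerProductSpace ℝ W]

/-- A vector field with smooth image under the differential of an immersion is smooth. -/
lemma contMDiffOn_field_of_mvfderiv_eq {f w : M → W} {O : Set M} (hO : IsOpen O)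
    (hf : ContMDiffOn (𝓡 n) 𝓘(ℝ, W) ∞ f O) (hw : ContMDiffOn (𝓡 n) 𝓘(ℝ, W) ∞ w O)
    (hinj : ∀ q ∈ O, Function.Injective (mvfderiv (𝓡 n) f q))
    {Y : (q : M) → TangentSpace (𝓡 n) q} (hY : ∀ q ∈ O, mvfderiv (𝓡 n) f q (Y q) = w q) :
    ContMDiffOn (𝓡 n) (𝓡 n).tangent ∞ (fun q => (⟨q, Y q⟩ : TangentBundle (𝓡 n) M)) O := by
  intro p hp
  obtain ⟨O₁, e, hO₁, hp₁, he, hli⟩ := exists_smooth_frame (n := n) p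
  have hU := hO.inter hO₁
  have hs : ∀ a, ContMDiffOn (𝓡 n) 𝓘(ℝ, W) ∞ (fun q => mvfderiv (𝓡 n) f q (e a q)) (O ∩ O₁) :=
    fun a => contMDiffOn_mvfderiv_apply hU (hf.mono Set.inter_subset_left)
      ((he a).mono Set.inter_subset_right)
  have hinner : ∀ {g h : M → W}, ContMDiffOn (𝓡 n) 𝓘(ℝ, W) ∞ g (O ∩ O₁) →
      ContMDiffOn (𝓡 n) 𝓘(ℝ, W) ∞ h (O ∩ O₁) →
      ContMDiffOn (𝓡 n) 𝓘(ℝ, ℝ) ∞ (fun q => inner ℝ (g q) (h q)) (O ∩ O₁) :=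
    fun hg hh => contMDiffOn_bilin (innerSL ℝ) hg hh
  -- The components of Y solve linear equations with this Gram matrix. A Euclidean product is used
  -- because the pseudo-Euclidean form degenerates on a lightlike tangent hyperplane.
  let N : M → Matrix (Fin n) (Fin n) ℝ := fun q => Matrix.of fun a b =>
    inner ℝ (mvfderiv (𝓡 n) f q (e a q)) (mvfderiv (𝓡 n) f q (e b q))
  have hN : ∀ q ∈ O ∩ O₁, (N q).det ≠ 0 := by
    intro q hq hdet
    obtain ⟨c, hc0, hc⟩ := Matrix.exists_vecMul_eq_zero_iff.2 hdet
    have h1 : mvfderiv (𝓡 n) f q (∑ a, c a • e a q) = 0 := by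
      rw [← inner_self_eq_zero (𝕜 := ℝ)]
      have : ∀ b, inner ℝ (mvfderiv (𝓡 n) f q (∑ a, c a • e a q))
          (mvfderiv (𝓡 n) f q (e b q)) = 0 := by
        intro b
        have := congrFun hc b
        simpa [map_sum, sum_inner, real_inner_smul_left, Matrix.vecMul, dotProduct, N] using this
      have h2 : ∑ a, c a • mvfderiv (𝓡 n) f q (e a q)
          = mvfderiv (𝓡 n) f q (∑ a, c a • e a q) := by simp [map_sum]
      generalize mvfderiv (𝓡 n) f q (∑ a, c a • e a q) = z at this h2
      nth_rewrite 2 [← h2]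
      rw [inner_sum]
      exact Finset.sum_eq_zero fun b _ => by rw [real_inner_smul_right, this, mul_zero]
    have h2 := hinj q hq.1 (h1.trans (map_zero _).symm)
    exact hc0 (funext (Fintype.linearIndependent_iff.1 (hli q hq.2) c h2))
  have hNs : ∀ a b, ContMDiffOn (𝓡 n) 𝓘(ℝ, ℝ) ∞ (fun q => N q a b) (O ∩ O₁) :=
    fun a b => hinner (hs a) (hs b)
  have hsum := contMDiffOn_sum_smul_field (O := O ∩ O₁)
    (fun a => (he a).mono Set.inter_subset_right)
    (c := fun a q => ∑ b, (N q)⁻¹ a b * inner ℝ (mvfderiv (𝓡 n) f q (e b q)) (w q))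
    (fun a => contMDiffOn_finsetSum fun b _ => (contMDiffOn_matrix_inv hNs hN a b).mul
      (hinner (hs b) (hw.mono Set.inter_subset_left)))
  have hloc : ContMDiffOn (𝓡 n) (𝓡 n).tangent ∞
      (fun q => (⟨q, Y q⟩ : TangentBundle (𝓡 n) M)) (O ∩ O₁) := by
    refine hsum.congr fun q hq => ?_
    congr 1
    have hspan := (hli q hq.2).span_eq_top_of_card_eq_finrank' (by
      rw [finrank_tangentSpace, Fintype.card_fin])
    obtain ⟨c, hc⟩ : ∃ c : Fin n → ℝ, ∑ a, c a • e a q = Y q :=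
      (Submodule.mem_span_range_iff_exists_fun ℝ).1 (hspan ▸ Submodule.mem_top)
    have hb : (fun b => inner ℝ (mvfderiv (𝓡 n) f q (e b q)) (w q)) = (N q).mulVec c := by
      funext b
      rw [← hY q hq.1, ← hc, map_sum, inner_sum]
      simp [Matrix.mulVec, dotProduct, real_inner_smul_right, N, mul_comm]
    have hcc : (N q)⁻¹.mulVec (fun b => inner ℝ (mvfderiv (𝓡 n) f q (e b q)) (w q)) = c := by
      rw [hb, Matrix.mulVec_mulVec, Matrix.nonsing_inv_mul _ (isUnit_iff_ne_zero.2 (hN q hq)),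
        Matrix.one_mulVec]
    rw [← hc]
    exact Finset.sum_congr rfl fun a _ => by rw [← congrFun hcc a]; rfl
  exact (hloc.contMDiffAt (hU.mem_nhds ⟨hp, hp₁⟩)).contMDiffWithinAt

end SmoothField

/-! ### Dual fields and smoothness of λ_{ij}. -/

section Coefficients

variable {n : ℕ} {M : Type u} [TopologicalSpace M] [ChartedSpace (EuclideanSpace ℝ (Fin n)) M]
  {X : M → ℙ ℝ (V n)} {p : M}

namespace AdaptedFrame

variable {F : AdaptedFrame X p} {q : M}

lemma smooth_g (i j) : ContMDiffOn (𝓡 n) 𝓘(ℝ, ℝ) ∞ (fun q => F.g q i j) F.dom :=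
  contMDiffOn_form (F.smooth_A i) (F.smooth_A j)

lemma smooth_ginv (i j) : ContMDiffOn (𝓡 n) 𝓘(ℝ, ℝ) ∞ (fun q => (F.g q)⁻¹ i j) F.dom :=
  contMDiffOn_matrix_inv smooth_g (fun _ hq => (isUnit_det_g hq).ne_zero) i j

lemma nMap_dual {v : TangentSpace (𝓡 n) q} {i}
    (hv : mvfderiv (𝓡 n) F.An q v = F.A i q) : F.nMap q v = F.g q i := by
  ext j
  rw [nMap_apply, hv, g_apply]

variable [IsManifold (𝓡 n) ∞ M]

/-- The vector fields dual to the coframe `(ω_n^0, ω_n^i)`. -/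
lemma exists_dual_fields (hX : IsLightlikeHypersurface X) (F : AdaptedFrame X p) :
    ∃ (E₀ : (q : M) → TangentSpace (𝓡 n) q) (E : Fin (n - 1) → (q : M) → TangentSpace (𝓡 n) q),
      ContMDiffOn (𝓡 n) (𝓡 n).tangent ∞ (fun q => (⟨q, E₀ q⟩ : TangentBundle (𝓡 n) M)) F.dom ∧
      (∀ i, ContMDiffOn (𝓡 n) (𝓡 n).tangent ∞
        (fun q => (⟨q, E i q⟩ : TangentBundle (𝓡 n) M)) F.dom) ∧
      (∀ q ∈ F.dom, mvfderiv (𝓡 n) F.An q (E₀ q) = F.A0 q) ∧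
      ∀ q ∈ F.dom, ∀ i, mvfderiv (𝓡 n) F.An q (E i q) = F.A i q := by
  have h0 : ∀ q, ∃ v : TangentSpace (𝓡 n) q, q ∈ F.dom → mvfderiv (𝓡 n) F.An q v = F.A0 q := by
    intro q
    by_cases hq : q ∈ F.dom
    · obtain ⟨v, hv⟩ := exists_dAn_eq hq hX 1 0
      exact ⟨v, fun _ => by simpa using hv⟩
    · exact ⟨0, fun h => absurd h hq⟩
  have h1 : ∀ i q, ∃ v : TangentSpace (𝓡 n) q, q ∈ F.dom →
      mvfderiv (𝓡 n) F.An q v = F.A i q := by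
    intro i q
    by_cases hq : q ∈ F.dom
    · obtain ⟨v, hv⟩ := exists_dAn_eq hq hX 0 (Pi.single i 1)
      exact ⟨v, fun _ => by simpa [Pi.single_apply] using hv⟩
    · exact ⟨0, fun h => absurd h hq⟩
  choose E₀ hE₀ using h0
  choose E hE using h1
  have hinj : ∀ q ∈ F.dom, Function.Injective (mvfderiv (𝓡 n) F.An q) :=
    fun q hq => dAn_injective hq hX
  exact ⟨E₀, E,
    contMDiffOn_field_of_mvfderiv_eq F.isOpen_dom F.smooth_An F.smooth_A0 hinj (fun q hq => hE₀ q hq),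
    fun i => contMDiffOn_field_of_mvfderiv_eq F.isOpen_dom F.smooth_An (F.smooth_A i) hinj
      (fun q hq => hE i q hq), fun q hq => hE₀ q hq, fun q hq i => hE i q hq⟩

/-- On the dual fields E_j the values of N form the matrix g. If Y denotes the matrix of values of
`yMap`, then g = -λg⁻¹Y, so Y is invertible and λ = -gY⁻¹g is smooth. -/
lemma exists_smooth_lambda (hX : IsLightlikeHypersurface X) (hr : ∀ q ∈ F.dom, F.IsRegularAt q) :
    ∃ lam : M → Matrix (Fin (n - 1)) (Fin (n - 1)) ℝ,
      (∀ i j, ContMDiffOn (𝓡 n) 𝓘(ℝ, ℝ) ∞ (fun q => lam q i j) F.dom) ∧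
      ∀ q ∈ F.dom, F.IsLambda q (lam q) := by
  obtain ⟨E₀, E, -, hEs, -, hE⟩ := exists_dual_fields hX F
  let Y : M → Matrix (Fin (n - 1)) (Fin (n - 1)) ℝ := fun q => Matrix.of fun i j => F.yMap q (E j q) i
  have hYs : ∀ i j, ContMDiffOn (𝓡 n) 𝓘(ℝ, ℝ) ∞ (fun q => Y q i j) F.dom := fun i j =>
    contMDiffOn_form (contMDiffOn_mvfderiv_apply F.isOpen_dom F.smooth_A0 (hEs j)) (F.smooth_A i)
  have hmu : ∀ q ∈ F.dom, ∃ L, F.IsLambda q L ∧ -(L * (F.g q)⁻¹ * Y q) = F.g q := by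
    intro q hq
    obtain ⟨L, hL⟩ := exists_isLambda hq hX (hr q hq)
    refine ⟨L, hL, ?_⟩
    ext i j
    have h := congrFun ((isLambda_iff hq).1 hL (E j q)) i
    rw [nMap_dual (hE q hq j)] at h
    have hs : F.g q i j = F.g q j i := congrFun (congrFun (g_transpose (F := F)) j) i
    rw [hs, h]
    rfl
  have hYdet : ∀ q ∈ F.dom, (Y q).det ≠ 0 := by
    intro q hq h0
    obtain ⟨L, -, h⟩ := hmu q hq
    have := congrArg Matrix.det h
    rw [← Matrix.neg_mul, Matrix.det_mul, h0, mul_zero] at this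
    exact (isUnit_det_g hq).ne_zero this.symm
  refine ⟨fun q => -(F.g q * (Y q)⁻¹ * F.g q), fun i j => ?_, fun q hq => ?_⟩
  · exact (contMDiffOn_matrix_mul (contMDiffOn_matrix_mul smooth_g
      (contMDiffOn_matrix_inv hYs hYdet)) smooth_g i j).neg
  · obtain ⟨L, hL, h⟩ := hmu q hq
    have hd := isUnit_iff_ne_zero.2 (hYdet q hq)
    have hLe : L = -(F.g q * (Y q)⁻¹ * F.g q) := by
      nth_rewrite 1 [← h]
      rw [Matrix.neg_mul, Matrix.neg_mul, neg_neg, Matrix.mul_assoc (L * _), Matrix.mul_nonsing_inv _ hd,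
        Matrix.mul_one, Matrix.mul_assoc, ginv_mul hq, Matrix.mul_one]
    change F.IsLambda q (-(F.g q * (Y q)⁻¹ * F.g q))
    rwa [← hLe]

end AdaptedFrame

end Coefficients

/-! ### The structure equation of λ_{ij} and the existence of λ_{ijk}. -/

section Structure

variable {n : ℕ} {M : Type u} [TopologicalSpace M] [ChartedSpace (EuclideanSpace ℝ (Fin n)) M]
  {X : M → ℙ ℝ (V n)} {p : M}

namespace AdaptedFrame

variable {F : AdaptedFrame X p} {q : M}

variable (F q) in
/-- `ω_i^j`, as a matrix. -/
noncomputable def connMatrix (v : TangentSpace (𝓡 n) q) : Matrix (Fin (n - 1)) (Fin (n - 1)) ℝ :=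
  Matrix.of fun i j => F.omegaIJ q i j v

lemma form_dA_A (hq : q ∈ F.dom) (i j) (v : TangentSpace (𝓡 n) q) :
    form n (mvfderiv (𝓡 n) (F.A i) q v) (F.A j q) = (F.connMatrix q v * F.g q) i j :=
  (sum_coeff_mul_g hq _ j).symm

lemma mvfderiv_g (hq : q ∈ F.dom) (i j) (v : TangentSpace (𝓡 n) q) :
    mvfderiv (𝓡 n) (fun q => F.g q i j) q v
      = (F.connMatrix q v * F.g q + F.g q * (F.connMatrix q v).transpose) i j := by
  have h := mvfderiv_form (mdiff_A hq i) (mdiff_A hq j) v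
  rw [form_symm (F.A i q), form_dA_A hq, form_dA_A hq] at h
  rw [Matrix.add_apply]
  refine h.trans ?_
  congr 1
  rw [← g_transpose (F := F), ← Matrix.transpose_mul, Matrix.transpose_apply, g_transpose]

/-- For isotropic v the vector dA_i(v) is orthogonal to A_0, so only the A_j part of the combination
contributes. -/
lemma form_comb_dA (hq : q ∈ F.dom) {v : TangentSpace (𝓡 n) q} (hv : F.yMap q v = 0) (i)
    (c : ℝ) (b : Fin (n - 1) → ℝ) :
    form n (c • F.A0 q + ∑ j, b j • F.A j q) (mvfderiv (𝓡 n) (F.A i) q v)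
      = (F.connMatrix q v).mulVec ((F.g q).mulVec b) i := by
  have h0 : form n (F.A0 q) (mvfderiv (𝓡 n) (F.A i) q v) = 0 := by
    rw [form_symm, form_dA_A0 hq, ← yMap_apply, hv]; simp
  rw [Matrix.mulVec_mulVec]
  simp only [map_add, map_sum, map_smul, LinearMap.add_apply, LinearMap.sum_apply,
    LinearMap.smul_apply, h0, smul_eq_mul, mul_zero, zero_add, Matrix.mulVec, dotProduct]
  refine Finset.sum_congr rfl fun j _ => ?_
  rw [form_symm (F.A j q), form_dA_A hq, mul_comm]

lemma form_dAn_dA (hq : q ∈ F.dom) {v : TangentSpace (𝓡 n) q} (hv : F.yMap q v = 0) (i) (w) :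
    form n (mvfderiv (𝓡 n) F.An q w) (mvfderiv (𝓡 n) (F.A i) q v)
      = (F.connMatrix q v).mulVec (F.nMap q w) i := by
  rw [dAn_eq hq w, form_comb_dA hq hv]
  exact congrArg (fun b => (F.connMatrix q v).mulVec b i) (g_mulVec_ginv hq (F.nMap q w))

lemma form_dA0_dA (hq : q ∈ F.dom) {v : TangentSpace (𝓡 n) q} (hv : F.yMap q v = 0) (i) (w) :
    form n (mvfderiv (𝓡 n) F.A0 q w) (mvfderiv (𝓡 n) (F.A i) q v)
      = (F.connMatrix q v).mulVec (F.yMap q w) i := by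
  rw [dA0_eq hq w, form_comb_dA hq hv]
  exact congrArg (fun b => (F.connMatrix q v).mulVec b i) (g_mulVec_ginv hq (F.yMap q w))

/-- The entrywise differential of a matrix-valued function. -/
noncomputable def _root_.DeSitter.dMat (L : M → Matrix (Fin (n - 1)) (Fin (n - 1)) ℝ) (q : M)
    (v : TangentSpace (𝓡 n) q) : Matrix (Fin (n - 1)) (Fin (n - 1)) ℝ :=
  Matrix.of fun i j => mvfderiv (𝓡 n) (fun q => L q i j) q v

lemma _root_.DeSitter.dMat_mul {A B : M → Matrix (Fin (n - 1)) (Fin (n - 1)) ℝ}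
    (hA : ∀ i j, MDifferentiableAt (𝓡 n) 𝓘(ℝ, ℝ) (fun q => A q i j) q)
    (hB : ∀ i j, MDifferentiableAt (𝓡 n) 𝓘(ℝ, ℝ) (fun q => B q i j) q)
    (v : TangentSpace (𝓡 n) q) :
    dMat (fun q => A q * B q) q v = dMat A q v * B q + A q * dMat B q v := by
  ext i j
  have hm : ∀ k, MDifferentiableAt (𝓡 n) 𝓘(ℝ, ℝ) (fun q => A q i k * B q k j) q :=
    fun k => mdifferentiableAt_bilin (ContinuousLinearMap.mul ℝ ℝ) (hA i k) (hB k j)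
  have h := mvfderiv_sum Finset.univ (f := fun k q => A q i k * B q k j) (fun k _ => hm k) v
  simp only [dMat, Matrix.of_apply, Matrix.mul_apply, Matrix.add_apply]
  rw [h, ← Finset.sum_add_distrib]
  exact Finset.sum_congr rfl fun k _ => mvfderiv_bilin (ContinuousLinearMap.mul ℝ ℝ) (hA i k) (hB k j) v

variable [IsManifold (𝓡 n) ∞ M]

/-- The exterior derivative of the relation `(dA_n, A_i) = - μ_i^j (dA_0, A_j)`. -/
lemma exterior_derivative_mu (hq : q ∈ F.dom) {μ : M → Matrix (Fin (n - 1)) (Fin (n - 1)) ℝ}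
    (hμs : ∀ i j, MDifferentiableAt (𝓡 n) 𝓘(ℝ, ℝ) (fun q => μ q i j) q)
    (hμ : ∀ q ∈ F.dom, ∀ v, F.nMap q v = -((μ q).mulVec (F.yMap q v)))
    (v w : TangentSpace (𝓡 n) q) (i : Fin (n - 1)) :
    form n (mvfderiv (𝓡 n) F.An q w) (mvfderiv (𝓡 n) (F.A i) q v)
      - form n (mvfderiv (𝓡 n) F.An q v) (mvfderiv (𝓡 n) (F.A i) q w)
      + ((dMat μ q v).mulVec (F.yMap q w) i - (dMat μ q w).mulVec (F.yMap q v) i)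
      + ∑ j, μ q i j * (form n (mvfderiv (𝓡 n) F.A0 q w) (mvfderiv (𝓡 n) (F.A j) q v)
          - form n (mvfderiv (𝓡 n) F.A0 q v) (mvfderiv (𝓡 n) (F.A j) q w)) = 0 := by
  obtain ⟨Y₁, hY₁, hY₁d⟩ := exists_field_extend v
  obtain ⟨Y₂, hY₂, hY₂d⟩ := exists_field_extend w
  have hn : ∀ {Z : (q : M) → TangentSpace (𝓡 n) q}, MDifferentiableAt (𝓡 n) (𝓡 n).tangent
      (fun q => (⟨q, Z q⟩ : TangentBundle (𝓡 n) M)) q →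
      MDifferentiableAt (𝓡 n) 𝓘(ℝ, V n) (fun q => mvfderiv (𝓡 n) F.An q (Z q)) q :=
    fun hZ => mdifferentiableAt_mvfderiv_apply F.isOpen_dom hq F.smooth_An hZ
  have h0 : ∀ {Z : (q : M) → TangentSpace (𝓡 n) q}, MDifferentiableAt (𝓡 n) (𝓡 n).tangent
      (fun q => (⟨q, Z q⟩ : TangentBundle (𝓡 n) M)) q →
      MDifferentiableAt (𝓡 n) 𝓘(ℝ, V n) (fun q => mvfderiv (𝓡 n) F.A0 q (Z q)) q :=
    fun hZ => mdifferentiableAt_mvfderiv_apply F.isOpen_dom hq F.smooth_A0 hZ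
  have key : ∀ {Z : (q : M) → TangentSpace (𝓡 n) q}, MDifferentiableAt (𝓡 n) (𝓡 n).tangent
      (fun q => (⟨q, Z q⟩ : TangentBundle (𝓡 n) M)) q → ∀ u : TangentSpace (𝓡 n) q,
      (form n (mvfderiv (𝓡 n) (fun q => mvfderiv (𝓡 n) F.An q (Z q)) q u) (F.A i q)
        + form n (mvfderiv (𝓡 n) F.An q (Z q)) (mvfderiv (𝓡 n) (F.A i) q u))
      + ∑ j, (dMat μ q u i j * F.yMap q (Z q) j + μ q i j *
        (form n (mvfderiv (𝓡 n) (fun q => mvfderiv (𝓡 n) F.A0 q (Z q)) q u) (F.A j q)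
          + form n (mvfderiv (𝓡 n) F.A0 q (Z q)) (mvfderiv (𝓡 n) (F.A j) q u))) = 0 := by
    intro Z hZ u
    have e1 := mvfderiv_form (hn hZ) (mdiff_A hq i) u
    have e2 : ∀ j, mvfderiv (𝓡 n)
        (fun q => μ q i j * form n (mvfderiv (𝓡 n) F.A0 q (Z q)) (F.A j q)) q u
        = dMat μ q u i j * F.yMap q (Z q) j + μ q i j *
        (form n (mvfderiv (𝓡 n) (fun q => mvfderiv (𝓡 n) F.A0 q (Z q)) q u) (F.A j q)
          + form n (mvfderiv (𝓡 n) F.A0 q (Z q)) (mvfderiv (𝓡 n) (F.A j) q u)) := by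
      intro j
      have := mvfderiv_bilin (ContinuousLinearMap.mul ℝ ℝ) (hμs i j)
        (mdifferentiableAt_bilin (formL n) (h0 hZ) (mdiff_A hq j)) u
      refine this.trans ?_
      rw [mvfderiv_bilin (formL n) (h0 hZ) (mdiff_A hq j)]
      rfl
    have e3 := mvfderiv_sum Finset.univ
      (f := fun j q => μ q i j * form n (mvfderiv (𝓡 n) F.A0 q (Z q)) (F.A j q))
      (fun j _ => mdifferentiableAt_bilin (ContinuousLinearMap.mul ℝ ℝ) (hμs i j)
        (mdifferentiableAt_bilin (formL n) (h0 hZ) (mdiff_A hq j))) u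
    rw [Finset.sum_congr rfl fun j _ => e2 j] at e3
    rw [← e1, ← e3]
    have e4 : (fun q => form n (mvfderiv (𝓡 n) F.An q (Z q)) (F.A i q))
        =ᶠ[𝓝 q] fun q => (-ContinuousLinearMap.id ℝ ℝ)
          (∑ j, μ q i j * form n (mvfderiv (𝓡 n) F.A0 q (Z q)) (F.A j q)) := by
      filter_upwards [F.isOpen_dom.mem_nhds hq] with r hr
      exact congrFun (hμ r hr (Z r)) i
    rw [mvfderiv_congr e4, mvfderiv_clm_comp _ (mdifferentiableAt_sum Finset.univ
      (f := fun j q => μ q i j * form n (mvfderiv (𝓡 n) F.A0 q (Z q)) (F.A j q))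
      (fun j _ => mdifferentiableAt_bilin (ContinuousLinearMap.mul ℝ ℝ) (hμs i j)
        (mdifferentiableAt_bilin (formL n) (h0 hZ) (mdiff_A hq j))))]
    simp
  have k1 := key hY₂d v
  have k2 := key hY₁d w
  -- Second derivatives enter only through the commutator of Y₁ and Y₂, and the relation N = -μY
  -- applied to the bracket removes them.
  have b1 := mvfderiv_mlieBracket F.isOpen_dom hq F.smooth_An hY₁d hY₂d
  have b2 := mvfderiv_mlieBracket F.isOpen_dom hq F.smooth_A0 hY₁d hY₂d
  have b3 : F.nMap q (VectorField.mlieBracket (𝓡 n) Y₁ Y₂ q) i = _ :=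
    congrFun (hμ q hq (VectorField.mlieBracket (𝓡 n) Y₁ Y₂ q)) i
  rw [nMap_apply, ← b1, Pi.neg_apply, Matrix.mulVec, dotProduct] at b3
  simp only [yMap_apply, ← b2, map_sub, LinearMap.sub_apply, hY₁, hY₂] at b3
  rw [hY₁] at k2
  rw [hY₂] at k1
  simp only [Matrix.mulVec, dotProduct, yMap_apply, mul_add, mul_sub, Finset.sum_add_distrib,
    Finset.sum_sub_distrib] at k1 k2 b3 ⊢
  linarith

/-- For isotropic v both dA_0(v) and dA_n(v) are multiples of A_0, so every term of the exterior
derivative is a matrix applied to Y(w), and Y(w) is arbitrary. -/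
lemma dMat_mu_of_yMap_eq_zero (hq : q ∈ F.dom) (hX : IsLightlikeHypersurface X)
    (hr : F.IsRegularAt q) {μ : M → Matrix (Fin (n - 1)) (Fin (n - 1)) ℝ}
    (hμs : ∀ i j, MDifferentiableAt (𝓡 n) 𝓘(ℝ, ℝ) (fun q => μ q i j) q)
    (hμ : ∀ q ∈ F.dom, ∀ v, F.nMap q v = -((μ q).mulVec (F.yMap q v)))
    {v : TangentSpace (𝓡 n) q} (hv : F.yMap q v = 0) :
    dMat μ q v + μ q * F.connMatrix q v - F.connMatrix q v * μ q + F.omega00 q v • μ q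
      + F.omegan0 q v • 1 = 0 := by
  apply Matrix.mulVec_injective
  funext b
  obtain ⟨w, rfl⟩ := yMap_surjective hq hX hr b
  ext i
  have h := exterior_derivative_mu hq hμs hμ v w i
  have h0 : ∀ j, form n (F.A0 q) (mvfderiv (𝓡 n) (F.A j) q w) = -F.yMap q w j := fun j => by
    rw [form_symm, form_dA_A0 hq, ← yMap_apply]
  simp only [dA0_eq_smul hq v hv, dAn_eq_smul hq v ((hr v).1 hv), form_dAn_dA hq hv,
    form_dA0_dA hq hv, map_smul, LinearMap.smul_apply, h0, hv, hμ q hq w, Matrix.mulVec_zero,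
    Pi.zero_apply, smul_eq_mul, mul_sub, Finset.sum_sub_distrib, Matrix.mulVec_neg,
    Pi.neg_apply, sub_zero] at h
  have h1 : ∑ j, μ q i j * (F.connMatrix q v).mulVec (F.yMap q w) j
      = (μ q).mulVec ((F.connMatrix q v).mulVec (F.yMap q w)) i := rfl
  have h2 : ∑ j, μ q i j * (F.omega00 q v * -F.yMap q w j)
      = -(F.omega00 q v * (μ q).mulVec (F.yMap q w) i) := by
    simp only [Matrix.mulVec, dotProduct, Finset.mul_sum, ← Finset.sum_neg_distrib]
    exact Finset.sum_congr rfl fun j _ => by ring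
  rw [h1, h2] at h
  simp only [Matrix.add_mulVec, Matrix.sub_mulVec, Matrix.smul_mulVec, ← Matrix.mulVec_mulVec,
    Matrix.one_mulVec, Pi.add_apply, Pi.sub_apply, Pi.smul_apply, smul_eq_mul, Matrix.zero_mulVec,
    Pi.zero_apply]
  linarith

omit [IsManifold (𝓡 n) ∞ M]

/-- The left-hand side of the structure equation of `λ_{ij}`, as a matrix. -/
noncomputable def lamDefect (F : AdaptedFrame X p) (q : M)
    (L : M → Matrix (Fin (n - 1)) (Fin (n - 1)) ℝ) (v : TangentSpace (𝓡 n) q) :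
    Matrix (Fin (n - 1)) (Fin (n - 1)) ℝ :=
  dMat L q v - L q * (F.connMatrix q v).transpose - F.connMatrix q v * L q
    + F.omega00 q v • L q + F.omegan0 q v • F.g q

lemma lamDefect_apply (L : M → Matrix (Fin (n - 1)) (Fin (n - 1)) ℝ) (v : TangentSpace (𝓡 n) q)
    (i j) : F.lamDefect q L v i j = mvfderiv (𝓡 n) (fun q => L q i j) q v
        - ∑ k, L q i k * F.omegaIJ q j k v - ∑ k, L q k j * F.omegaIJ q i k v
        + L q i j * F.omega00 q v + F.g q i j * F.omegan0 q v := by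
  simp only [lamDefect, Matrix.add_apply, Matrix.sub_apply, Matrix.smul_apply, Matrix.mul_apply,
    Matrix.transpose_apply, dMat, connMatrix, Matrix.of_apply, smul_eq_mul]
  rw [mul_comm (F.omega00 q v), mul_comm (F.omegan0 q v)]
  simp only [mul_comm]

lemma smooth_mul_ginv {L : M → Matrix (Fin (n - 1)) (Fin (n - 1)) ℝ}
    (hL : ∀ i j, ContMDiffOn (𝓡 n) 𝓘(ℝ, ℝ) ∞ (fun q => L q i j) F.dom) (i j) :
    ContMDiffOn (𝓡 n) 𝓘(ℝ, ℝ) ∞ (fun q => (L q * (F.g q)⁻¹) i j) F.dom :=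
  contMDiffOn_matrix_mul hL smooth_ginv i j

/-- Write L = μg and use dg = ωg + gωᵀ: the term Lωᵀ cancels, and the two remaining connection terms
form the commutator of μ and ω. -/
lemma lamDefect_eq (hq : q ∈ F.dom) {L : M → Matrix (Fin (n - 1)) (Fin (n - 1)) ℝ}
    (hL : ∀ i j, ContMDiffOn (𝓡 n) 𝓘(ℝ, ℝ) ∞ (fun q => L q i j) F.dom)
    (v : TangentSpace (𝓡 n) q) :
    F.lamDefect q L v = (dMat (fun q => L q * (F.g q)⁻¹) q v
      + L q * (F.g q)⁻¹ * F.connMatrix q v - F.connMatrix q v * (L q * (F.g q)⁻¹)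
      + F.omega00 q v • (L q * (F.g q)⁻¹) + F.omegan0 q v • 1) * F.g q := by
  have hd := dMat_mul (A := fun q => L q * (F.g q)⁻¹) (B := fun q => F.g q) (q := q)
    (fun i j => mdiffAt_of_smoothOn F.isOpen_dom (smooth_mul_ginv hL i j) hq)
    (fun i j => mdiffAt_of_smoothOn F.isOpen_dom (smooth_g i j) hq) v
  have he : dMat (fun q => L q * (F.g q)⁻¹ * F.g q) q v = dMat L q v := by
    ext i j
    simp only [dMat, Matrix.of_apply]
    rw [mvfderiv_congr]
    filter_upwards [F.isOpen_dom.mem_nhds hq] with r hr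
    rw [Matrix.mul_assoc, ginv_mul hr, Matrix.mul_one]
  have hg : dMat (fun q => F.g q) q v
      = F.connMatrix q v * F.g q + F.g q * (F.connMatrix q v).transpose := by
    ext i j
    exact mvfderiv_g hq i j v
  have hc : L q * (F.g q)⁻¹ * F.g q = L q := by
    rw [Matrix.mul_assoc, ginv_mul hq, Matrix.mul_one]
  rw [lamDefect, ← he, hd, hg]
  simp only [Matrix.add_mul, Matrix.sub_mul, Matrix.smul_mul, Matrix.one_mul, Matrix.mul_add]
  rw [← Matrix.mul_assoc (L q * (F.g q)⁻¹) (F.g q), Matrix.mul_assoc (F.connMatrix q v) (L q * _), hc]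
  rw [Matrix.mul_assoc (L q * _) (F.connMatrix q v)]
  abel

variable (F q) in
/-- The coefficient at `A_i`, as a linear form. -/
noncomputable def coeffForm (i : Fin (n - 1)) : V n →ₗ[ℝ] ℝ :=
  ∑ j, (F.g q)⁻¹ i j • (form n).flip (F.A j q)

lemma coeffForm_apply (i) (z : V n) : F.coeffForm q i z = F.coeff q i z := by
  simp [coeffForm, coeff]

/-- A form vanishing on ker Y factors through Y, by means of a right inverse σ of Y. -/
lemma exists_sum_omega0I (hq : q ∈ F.dom) (hX : IsLightlikeHypersurface X) (hr : F.IsRegularAt q)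
    (f : TangentSpace (𝓡 n) q →ₗ[ℝ] ℝ) (hf : ∀ v, F.yMap q v = 0 → f v = 0) :
    ∃ c : Fin (n - 1) → ℝ, ∀ v, f v = ∑ k, c k * F.omega0I q k v := by
  obtain ⟨σ, hσ⟩ := (F.yMap q).exists_rightInverse_of_surjective
    (LinearMap.range_eq_top.2 (yMap_surjective hq hX hr))
  refine ⟨fun k => (f ∘ₗ σ ∘ₗ (F.g q).mulVecLin) (Pi.single k 1), fun v => ?_⟩
  have h1 : f v = (f ∘ₗ σ ∘ₗ (F.g q).mulVecLin) (fun k => F.omega0I q k v) := by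
    have h2 : (F.g q).mulVec (fun k => F.omega0I q k v) = F.yMap q v := g_mulVec_ginv hq _
    rw [LinearMap.comp_apply, LinearMap.comp_apply, Matrix.mulVecLin_apply, h2, ← sub_eq_zero,
      ← map_sub]
    refine hf _ ?_
    rw [map_sub, sub_eq_zero]
    exact (LinearMap.congr_fun hσ (F.yMap q v)).symm
  rw [h1, LinearMap.pi_apply_eq_sum_univ]
  refine Finset.sum_congr rfl fun k _ => ?_
  rw [smul_eq_mul, mul_comm]
  congr 2
  ext j
  simp [Pi.single_apply, eq_comm]

/-- The forms ω are defined as bare functions of v; the factorization through Y needs their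
linearity. -/
lemma exists_linear_lamDefect (L : M → Matrix (Fin (n - 1)) (Fin (n - 1)) ℝ) (i j) :
    ∃ f : TangentSpace (𝓡 n) q →ₗ[ℝ] ℝ, ∀ v, f v = F.lamDefect q L v i j := by
  refine ⟨(mvfderiv (𝓡 n) (fun q => L q i j) q).toLinearMap
    - ∑ k, L q i k • (F.coeffForm q k ∘ₗ (mvfderiv (𝓡 n) (F.A j) q).toLinearMap)
    - ∑ k, L q k j • (F.coeffForm q k ∘ₗ (mvfderiv (𝓡 n) (F.A i) q).toLinearMap)
    + L q i j • (-((form n).flip (F.Ainf q) ∘ₗ (mvfderiv (𝓡 n) F.A0 q).toLinearMap))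
    + F.g q i j • (-((form n).flip (F.Ainf q) ∘ₗ (mvfderiv (𝓡 n) F.An q).toLinearMap)),
    fun v => ?_⟩
  rw [lamDefect_apply]
  simp only [LinearMap.add_apply, LinearMap.sub_apply, LinearMap.sum_apply, LinearMap.smul_apply,
    LinearMap.comp_apply, LinearMap.neg_apply, coeffForm_apply, smul_eq_mul]
  rfl

variable [IsManifold (𝓡 n) ∞ M]

/-- The quantities `λ_{ij}` and `λ_{ijk}` exist for every adapted frame. -/
theorem nonempty_coeffs (hX : IsLightlikeHypersurface X) (hr : ∀ q ∈ F.dom, F.IsRegularAt q) :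
    Nonempty F.Coeffs := by
  obtain ⟨L, hLs, hL⟩ := exists_smooth_lambda hX hr
  have hz : ∀ v, F.yMap p v = 0 → F.lamDefect p L v = 0 := by
    intro v hv
    rw [lamDefect_eq F.mem_dom hLs, dMat_mu_of_yMap_eq_zero F.mem_dom hX (hr p F.mem_dom)
      (μ := fun q => L q * (F.g q)⁻¹)
      (fun i j => mdiffAt_of_smoothOn F.isOpen_dom (smooth_mul_ginv hLs i j) F.mem_dom)
      (fun q hq => (isLambda_iff hq).1 (hL q hq)) hv, Matrix.zero_mul]
  have h3 : ∀ i j, ∃ c : Fin (n - 1) → ℝ, ∀ v, F.lamDefect p L v i j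
      = ∑ k, c k * F.omega0I p k v := by
    intro i j
    obtain ⟨f, hf⟩ := exists_linear_lamDefect (F := F) (q := p) L i j
    obtain ⟨c, hc⟩ := exists_sum_omega0I F.mem_dom hX (hr p F.mem_dom) f
      (fun v hv => by rw [hf, hz v hv]; rfl)
    exact ⟨c, fun v => by rw [← hf, hc]⟩
  choose c hc using h3
  exact ⟨⟨L, hLs, hL, c, fun i j v => by rw [← hc, lamDefect_apply]⟩⟩

end AdaptedFrame

end Structure

/-! ### The points C_i as derivatives of the harmonic pole. -/

section Wedge

variable {n : ℕ} {M : Type u} [TopologicalSpace M] [ChartedSpace (EuclideanSpace ℝ (Fin n)) M]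
  {X : M → ℙ ℝ (V n)} {p : M}

namespace AdaptedFrame

variable {F : AdaptedFrame X p} {q : M}

lemma omega0I_surjective (hq : q ∈ F.dom) (hX : IsLightlikeHypersurface X)
    (hr : F.IsRegularAt q) (b : Fin (n - 1) → ℝ) : ∃ v, (fun k => F.omega0I q k v) = b := by
  obtain ⟨v, hv⟩ := yMap_surjective hq hX hr ((F.g q).mulVec b)
  refine ⟨v, ?_⟩
  have : (fun k => F.omega0I q k v) = (F.g q)⁻¹.mulVec (F.yMap q v) := rfl
  rw [this, hv, ginv_mulVec_g hq]

/-- The ω_0^i take all values, so dA_0 reaches every A_i modulo A_0. -/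
lemma tangentV_eq (hX : IsLightlikeHypersurface X) (hr : F.IsRegularAt p) :
    F.tangentV = Submodule.span ℝ {F.A0 p} ⊔ Submodule.span ℝ (Set.range fun i => F.A i p) := by
  have h0 : F.A0 p ∈ Submodule.span ℝ {F.A0 p} ⊔ Submodule.span ℝ (Set.range fun i => F.A i p) :=
    Submodule.mem_sup_left (Submodule.mem_span_singleton_self _)
  refine le_antisymm (sup_le le_sup_left ?_) (sup_le le_sup_left ?_)
  · rintro _ ⟨v, rfl⟩
    change mvfderiv (𝓡 n) F.A0 p v ∈ _
    rw [dA0_eq F.mem_dom v]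
    exact add_mem (Submodule.smul_mem _ _ h0) (sum_mem fun i _ => Submodule.smul_mem _ _
      (Submodule.mem_sup_right (Submodule.subset_span ⟨i, rfl⟩)))
  · rw [Submodule.span_le]
    rintro _ ⟨i, rfl⟩
    obtain ⟨v, hv⟩ := omega0I_surjective F.mem_dom hX hr (Pi.single i 1)
    have h1 := dA0_eq F.mem_dom v
    simp only [fun k => congrFun hv k, Pi.single_apply, ite_smul, one_smul, zero_smul,
      Finset.sum_ite_eq', Finset.mem_univ, if_true] at h1
    have h2 : F.A i p = mvfderiv (𝓡 n) F.A0 p v - F.omega00 p v • F.A0 p := by rw [h1]; abel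
    change F.A i p ∈ _
    rw [h2]
    exact sub_mem (Submodule.mem_sup_right (LinearMap.mem_range_self _ v))
      (Submodule.smul_mem _ _ (Submodule.mem_sup_left (Submodule.mem_span_singleton_self _)))

namespace Coeffs

variable (Λ : F.Coeffs)

lemma smooth_meanLambda :
    ContMDiffOn (𝓡 n) 𝓘(ℝ, ℝ) ∞ (fun q => F.meanLambda q (Λ.lam q)) F.dom := by
  simp only [AdaptedFrame.meanLambda]
  exact contMDiffOn_const.mul (contMDiffOn_finsetSum fun i _ => contMDiffOn_finsetSum fun j _ =>
    (Λ.smooth_lam i j).mul (smooth_ginv i j))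

lemma smooth_harmonicPole : ContMDiffOn (𝓡 n) 𝓘(ℝ, V n) ∞ Λ.harmonicPole F.dom :=
  F.smooth_An.add (contMDiffOn_bilin (ContinuousLinearMap.lsmul ℝ ℝ) Λ.smooth_meanLambda F.smooth_A0)

lemma mvfderiv_harmonicPole (hq : q ∈ F.dom) (v : TangentSpace (𝓡 n) q) :
    mvfderiv (𝓡 n) Λ.harmonicPole q v = mvfderiv (𝓡 n) F.An q v
      + (mvfderiv (𝓡 n) (fun q => F.meanLambda q (Λ.lam q)) q v • F.A0 q
        + F.meanLambda q (Λ.lam q) • mvfderiv (𝓡 n) F.A0 q v) := by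
  have hl := mdiffAt_of_smoothOn F.isOpen_dom Λ.smooth_meanLambda hq
  have h := mvfderiv_add_apply (mdiff_An hq) (mdifferentiableAt_smul hl (mdiff_A0 hq)) v
  rwa [mvfderiv_smul_apply hl (mdiff_A0 hq)] at h

variable {Λ}

lemma form_mvfderiv_harmonicPole_A0 (hq : q ∈ F.dom) (v : TangentSpace (𝓡 n) q) :
    form n (mvfderiv (𝓡 n) Λ.harmonicPole q v) (F.A0 q) = 0 := by
  rw [Λ.mvfderiv_harmonicPole hq]
  simp [F.tangent q hq, F.form_A0_A0 q hq, form_dA0_A0 hq]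

lemma form_mvfderiv_harmonicPole_An (hq : q ∈ F.dom) (v : TangentSpace (𝓡 n) q) :
    form n (mvfderiv (𝓡 n) Λ.harmonicPole q v) (F.An q) = 0 := by
  rw [Λ.mvfderiv_harmonicPole hq]
  simp [form_dAn_An hq, F.form_A0_An q hq, form_dA0_An hq]

/-- This is (dC, A_i): passing from A_n to C subtracts from μ its mean trace, which leaves ag⁻¹. -/
lemma nMap_add_eq (hq : q ∈ F.dom) {L : Matrix (Fin (n - 1)) (Fin (n - 1)) ℝ}
    (hL : F.IsLambda q L) (v : TangentSpace (𝓡 n) q) :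
    F.nMap q v + F.meanLambda q L • F.yMap q v
      = -((F.aTensor q L * (F.g q)⁻¹).mulVec (F.yMap q v)) := by
  rw [(isLambda_iff hq).1 hL v, aTensor, Matrix.sub_mul, Matrix.smul_mul, mul_ginv hq,
    Matrix.sub_mulVec, Matrix.smul_mulVec, Matrix.one_mulVec]
  abel

lemma form_mvfderiv_harmonicPole_A (hq : q ∈ F.dom) (v : TangentSpace (𝓡 n) q) (i) :
    form n (mvfderiv (𝓡 n) Λ.harmonicPole q v) (F.A i q)
      = -((F.aTensor q (Λ.lam q) * (F.g q)⁻¹).mulVec (F.yMap q v) i) := by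
  have h := congrFun (nMap_add_eq hq (Λ.isLambda q hq) v) i
  rw [Λ.mvfderiv_harmonicPole hq]
  simpa [F.form_A0_A q hq, nMap_apply, yMap_apply] using h

lemma isUnit_aTensor_mul (hq : q ∈ F.dom) (hd : (F.aTensor q (Λ.lam q)).det ≠ 0) :
    IsUnit (F.aTensor q (Λ.lam q) * (F.g q)⁻¹).det := by
  rw [Matrix.det_mul, isUnit_iff_ne_zero]
  exact mul_ne_zero hd (Matrix.isUnit_nonsing_inv_det _ (isUnit_det_g hq)).ne_zero

/-- The differential of the harmonic pole meets the line `A_0` only in zero. -/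
lemma yMap_eq_zero_of_smul_A0 (hq : q ∈ F.dom) (hd : (F.aTensor q (Λ.lam q)).det ≠ 0)
    {v : TangentSpace (𝓡 n) q} {c : ℝ} (h : mvfderiv (𝓡 n) Λ.harmonicPole q v = c • F.A0 q) :
    F.yMap q v = 0 := by
  have hi := Matrix.mulVec_injective_of_isUnit
    ((Matrix.isUnit_iff_isUnit_det _).2 (isUnit_aTensor_mul hq hd))
  refine hi ?_
  rw [Matrix.mulVec_zero]
  ext i
  have := form_mvfderiv_harmonicPole_A (Λ := Λ) hq v i
  rw [h, map_smul, LinearMap.smul_apply, F.form_A0_A q hq, smul_zero] at this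
  simpa using this.symm

variable (hn : 2 ≤ n)
include hn

/-- The structure equation contracted with g^{ij}; since tr 1 = n - 1, the coefficient of ω_n^0 is 1
after averaging. -/
lemma mvfderiv_meanLambda (v : TangentSpace (𝓡 n) p) :
    mvfderiv (𝓡 n) (fun q => F.meanLambda q (Λ.lam q)) p v
      + F.meanLambda p (Λ.lam p) * F.omega00 p v + F.omegan0 p v
      = ∑ k, Λ.lam1 k * F.omega0I p k v := by
  have hn1 : (n : ℝ) - 1 ≠ 0 := by
    have : (2 : ℝ) ≤ n := by exact_mod_cast hn
    linarith
  have hp := F.mem_dom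
  set μ : M → Matrix (Fin (n - 1)) (Fin (n - 1)) ℝ := fun q => Λ.lam q * (F.g q)⁻¹ with hμ
  have hμs : ∀ i, MDifferentiableAt (𝓡 n) 𝓘(ℝ, ℝ) (fun q => μ q i i) p := fun i =>
    mdiffAt_of_smoothOn F.isOpen_dom (smooth_mul_ginv Λ.smooth_lam i i) hp
  have h1 : mvfderiv (𝓡 n) (fun q => F.meanLambda q (Λ.lam q)) p v
      = 1 / ((n : ℝ) - 1) * (dMat μ p v).trace := by
    simp only [AdaptedFrame.meanLambda_eq, Matrix.trace, Matrix.diag]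
    have := mvfderiv_clm_comp ((1 / ((n : ℝ) - 1)) • ContinuousLinearMap.id ℝ ℝ)
      (mdifferentiableAt_sum Finset.univ (f := fun i q => μ q i i) (fun i _ => hμs i)) v
    rw [mvfderiv_sum Finset.univ (f := fun i q => μ q i i) (fun i _ => hμs i)] at this
    exact this
  have h2 := congrArg (fun A => (A * (F.g p)⁻¹).trace) (lamDefect_eq hp Λ.smooth_lam v)
  simp only [Matrix.mul_assoc _ (F.g p), mul_ginv hp, Matrix.mul_one] at h2
  have h3 : (F.lamDefect p Λ.lam v * (F.g p)⁻¹).trace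
      = ((n : ℝ) - 1) * ∑ k, Λ.lam1 k * F.omega0I p k v := by
    have : ∀ k, ((n : ℝ) - 1) * (Λ.lam1 k * F.omega0I p k v)
        = ∑ i, ∑ j, (F.g p)⁻¹ i j * Λ.lam3 i j k * F.omega0I p k v := by
      intro k
      rw [lam1, ← mul_assoc, ← mul_assoc, mul_one_div_cancel hn1, one_mul, Finset.sum_mul]
      exact Finset.sum_congr rfl fun i _ => Finset.sum_mul ..
    rw [Finset.mul_sum, Finset.sum_congr rfl fun k _ => this k, Finset.sum_comm]
    simp only [Matrix.trace, Matrix.diag, Matrix.mul_apply, lamDefect_apply, Λ.lam3_eq]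
    refine Finset.sum_congr rfl fun i _ => ?_
    rw [Finset.sum_comm]
    refine Finset.sum_congr rfl fun j _ => ?_
    rw [Finset.sum_mul]
    exact Finset.sum_congr rfl fun k _ => by rw [ginv_symm j i]; ring
  rw [h3] at h2
  simp only [Matrix.trace_add, Matrix.trace_sub, Matrix.trace_smul, Matrix.trace_one,
    Fintype.card_fin, Nat.cast_sub (show 1 ≤ n by omega), smul_eq_mul, Nat.cast_one] at h2
  -- The connection enters through a commutator, which is traceless.
  rw [Matrix.trace_mul_comm (Λ.lam p * _) (F.connMatrix p v), add_sub_cancel_right] at h2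
  rw [h1, AdaptedFrame.meanLambda_eq]
  have h4 : ∑ k, Λ.lam1 k * F.omega0I p k v = 1 / ((n : ℝ) - 1) * (((n : ℝ) - 1)
      * ∑ k, Λ.lam1 k * F.omega0I p k v) := by field_simp
  rw [h4, h2]
  field_simp
  rfl

/-- `dC = ω_0^k C_k`. -/
theorem mvfderiv_harmonicPole_eq (v : TangentSpace (𝓡 n) p) :
    mvfderiv (𝓡 n) Λ.harmonicPole p v = ∑ k, F.omega0I p k v • Λ.point k := by
  have hp := F.mem_dom
  -- The components of dC at A_j; the component at A_0 is the contracted structure equation.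
  have hj : ∀ j, F.omeganI p j v + F.meanLambda p (Λ.lam p) * F.omega0I p j v
      = -∑ k, F.omega0I p k v * Λ.affinor k j := by
    intro j
    have h := congrArg (fun b => (F.g p)⁻¹.mulVec b j) (nMap_add_eq hp (Λ.isLambda p hp) v)
    simp only [Matrix.mulVec_add, Matrix.mulVec_smul, Matrix.mulVec_neg, Pi.add_apply,
      Pi.smul_apply, Pi.neg_apply, smul_eq_mul] at h
    refine h.trans (congrArg Neg.neg ?_)
    rw [← Matrix.mulVec_mulVec, Matrix.mulVec_mulVec]
    change ((F.g p)⁻¹ * F.aTensor p (Λ.lam p)).mulVec (fun k => F.omega0I p k v) j = _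
    simp only [Matrix.mulVec, dotProduct, Matrix.mul_apply]
    exact Finset.sum_congr rfl fun k _ => mul_comm _ _
  have h0 := mvfderiv_meanLambda (Λ := Λ) hn v
  rw [Λ.mvfderiv_harmonicPole hp, dAn_eq hp, dA0_eq hp]
  have e1 : ∑ k, F.omega0I p k v • Λ.point k
      = (∑ k, Λ.lam1 k * F.omega0I p k v) • F.A0 p
        + ∑ j, (-∑ k, F.omega0I p k v * Λ.affinor k j) • F.A j p := by
    simp only [point, smul_sub, Finset.sum_sub_distrib, Finset.sum_smul, Finset.smul_sum, neg_smul,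
      Finset.sum_neg_distrib, smul_smul]
    rw [Finset.sum_comm, sub_eq_add_neg]
    simp only [mul_comm]
  simp only [← hj] at e1
  rw [e1, ← h0]
  simp only [add_smul, smul_add, Finset.smul_sum, Finset.sum_add_distrib, smul_smul]
  abel

variable (hX : IsLightlikeHypersurface X) (hr : F.IsRegularAt p)
include hX hr

/-- In dC = ω_0^k C_k the coefficients take all values. This description by C alone carries every
invariance statement. -/
lemma wedge_eq_range : Λ.wedge = LinearMap.range (mvfderiv (𝓡 n) Λ.harmonicPole p).toLinearMap := by
  apply le_antisymm
  · rw [wedge, Submodule.span_le]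
    rintro _ ⟨i, rfl⟩
    obtain ⟨v, hv⟩ := omega0I_surjective F.mem_dom hX hr (Pi.single i 1)
    refine ⟨v, (mvfderiv_harmonicPole_eq hn v).trans ?_⟩
    simp [fun k => congrFun hv k, Pi.single_apply]
  · rintro _ ⟨v, rfl⟩
    change mvfderiv (𝓡 n) Λ.harmonicPole p v ∈ _
    rw [mvfderiv_harmonicPole_eq hn]
    exact sum_mem fun k _ => Submodule.smul_mem _ _ (Submodule.subset_span ⟨k, rfl⟩)

omit hn in
lemma point_mem_tangentV (i) : Λ.point i ∈ F.tangentV := by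
  rw [tangentV_eq hX hr]
  exact sub_mem (Submodule.smul_mem _ _ (Submodule.mem_sup_left
    (Submodule.mem_span_singleton_self _))) (sum_mem fun j _ => Submodule.smul_mem _ _
      (Submodule.mem_sup_right (Submodule.subset_span ⟨j, rfl⟩)))

omit hn in
lemma wedge_le_tangentV : Λ.wedge ≤ F.tangentV := by
  rw [wedge, Submodule.span_le]
  rintro _ ⟨i, rfl⟩
  exact point_mem_tangentV hX hr i

/-- All of T_{A_0}(V) is orthogonal to A_n while (C, A_n) = 1, so a vector of the intersection has
no component along C. -/
lemma wedge_eq_inf : Λ.wedge = F.tangentV ⊓ Λ.tangentW := by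
  rw [tangentW, ← wedge_eq_range hn hX hr]
  refine le_antisymm (le_inf (wedge_le_tangentV hX hr) le_sup_right) ?_
  rintro z ⟨hz, hz'⟩
  obtain ⟨a, ha, w, hw, rfl⟩ := Submodule.mem_sup.1 hz'
  obtain ⟨c, rfl⟩ := Submodule.mem_span_singleton.1 ha
  have h1 : F.tangentV ≤ LinearMap.ker ((form n).flip (F.An p)) := by
    rw [tangentV_eq hX hr]
    refine sup_le ?_ ?_ <;> rw [Submodule.span_le]
    · rintro _ rfl
      exact F.form_A0_An p F.mem_dom
    · rintro _ ⟨i, rfl⟩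
      exact F.form_A_An p F.mem_dom i
  have h2 : form n (c • Λ.harmonicPole p + w) (F.An p) = 0 := h1 hz
  have h3 : form n w (F.An p) = 0 := h1 (wedge_le_tangentV hX hr hw)
  have h4 : form n (Λ.harmonicPole p) (F.An p) = 1 := by
    simp [harmonicPole, form_An_An F.mem_dom, F.form_A0_An p F.mem_dom]
  have hc : c = 0 := by simpa [h3, h4] using h2
  rwa [hc, zero_smul, zero_add]

variable (hd : (F.aTensor p (Λ.lam p)).det ≠ 0)
include hd

lemma linearIndependent_point : LinearIndependent ℝ Λ.point := by
  rw [Fintype.linearIndependent_iff]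
  intro c hc i
  obtain ⟨v, hv⟩ := omega0I_surjective F.mem_dom hX hr c
  have h1 : mvfderiv (𝓡 n) Λ.harmonicPole p v = (0 : ℝ) • F.A0 p := by
    rw [mvfderiv_harmonicPole_eq hn, zero_smul, ← hc]
    exact Finset.sum_congr rfl fun k _ => by rw [← congrFun hv k]
  have h2 := yMap_eq_zero_of_smul_A0 F.mem_dom hd h1
  rw [← congrFun hv i]
  change ((F.g p)⁻¹.mulVec (F.yMap p v)) i = 0
  rw [h2, Matrix.mulVec_zero]; rfl

/-- If dC(v) = A_0, pairing with the A_i and inverting a gives Y(v) = 0; but then every ω_0^k(v),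
and so dC(v), is zero. -/
lemma A0_notMem_wedge : F.A0 p ∉ Λ.wedge := by
  rw [wedge_eq_range hn hX hr]
  rintro ⟨v, hv⟩
  have hv' : mvfderiv (𝓡 n) Λ.harmonicPole p v = F.A0 p := hv
  have h2 := yMap_eq_zero_of_smul_A0 F.mem_dom hd (hv'.trans (one_smul ℝ _).symm)
  refine A0_ne_zero F.mem_dom (hv'.symm.trans ?_)
  rw [mvfderiv_harmonicPole_eq hn]
  refine Finset.sum_eq_zero fun k _ => ?_
  rw [omega0I_eq, h2, Matrix.mulVec_zero, Pi.zero_apply, zero_smul]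

end Coeffs

end AdaptedFrame

end Wedge

/-! ### Transformation of a_{ij}, of dC and of the span of the C_i. -/

section Comparison

variable {n : ℕ} {M M' : Type u} [TopologicalSpace M] [ChartedSpace (EuclideanSpace ℝ (Fin n)) M]
  [TopologicalSpace M'] [ChartedSpace (EuclideanSpace ℝ (Fin n)) M']
  {X : M → ℙ ℝ (V n)} {X' : M' → ℙ ℝ (V n)} {p : M} {φ : M → M'} {T : V n ≃ₗ[ℝ] V n}

namespace IsTransport

open AdaptedFrame

variable {F : AdaptedFrame X p} {F' : AdaptedFrame X' (φ p)} {O : Set M} {ε s t : M → ℝ}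
  (h : IsTransport F F' T O ε s t) (hT : IsMotion T) (hn : 2 ≤ n)
  (hX : IsLightlikeHypersurface X)
include h hT hn hX

/-- The trace-free part of μ does not see the displacement: s·a'g'⁻¹ = ε·P(ag⁻¹)P⁻¹. -/
lemma det_aTensor_ne_zero {q : M} (hq : q ∈ O) (hr : F.IsRegularAt q)
    {L L' : Matrix (Fin (n - 1)) (Fin (n - 1)) ℝ} (hL : F.IsLambda q L)
    (hL' : F'.IsLambda (φ q) L') (hd : (F.aTensor q L).det ≠ 0) :
    (F'.aTensor (φ q) L').det ≠ 0 := by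
  obtain ⟨P, hP, -, hv⟩ := h.exists_matrix hq hT
  have hm := h.meanLambda_eq hq hT hn hX hr hL hL'
  have hε0 : ε q ≠ 0 := fun h0 => by simpa [h0] using h.sq q hq
  have hα : (F.aTensor q L * (F.g q)⁻¹).det ≠ 0 := by
    rw [Matrix.det_mul]
    exact mul_ne_zero hd (Matrix.isUnit_nonsing_inv_det _ (isUnit_det_g (h.subset hq))).ne_zero
  have hrel : s q • (F'.aTensor (φ q) L' * (F'.g (φ q))⁻¹ * P)
      = ε q • (P * (F.aTensor q L * (F.g q)⁻¹)) := by
    apply Matrix.mulVec_injective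
    funext b
    obtain ⟨v, rfl⟩ := yMap_surjective (h.subset hq) hX hr b
    have h1 := Coeffs.nMap_add_eq (h.mapsTo q hq) hL' (mfderiv (𝓡 n) (𝓡 n) φ q v)
    have h2 := Coeffs.nMap_add_eq (h.subset hq) hL v
    generalize F.aTensor q L * (F.g q)⁻¹ = α at *
    generalize F'.aTensor (φ q) L' * (F'.g (φ q))⁻¹ = α' at *
    rw [(hv v).1, (hv v).2, ← Matrix.mulVec_smul, ← Matrix.mulVec_add, smul_smul,
      mul_comm _ (s q), hm] at h1
    have h3 : ε q • F.nMap q v + t q • F.yMap q v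
        + (ε q * F.meanLambda q L - t q) • F.yMap q v = -(ε q • α.mulVec (F.yMap q v)) := by
      rw [← smul_neg, ← h2]; module
    rw [h3, Matrix.mulVec_neg, neg_inj] at h1
    rw [Matrix.smul_mulVec, Matrix.smul_mulVec, ← Matrix.mulVec_mulVec _ P, ← Matrix.mulVec_smul,
      ← Matrix.mulVec_smul P, h1, Matrix.mulVec_mulVec]
  have h1 := congrArg Matrix.det hrel
  simp only [Matrix.det_smul, Matrix.det_mul] at h1 hα
  intro h0
  rw [h0, zero_mul, zero_mul, mul_zero] at h1
  exact mul_ne_zero (pow_ne_zero _ hε0) (mul_ne_zero hP.ne_zero hα) h1.symm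

lemma mvfderiv_harmonicPole (hr : ∀ q ∈ O, F.IsRegularAt q) (Λ : F.Coeffs) (Λ' : F'.Coeffs)
    (v : TangentSpace (𝓡 n) p) :
    mvfderiv (𝓡 n) Λ'.harmonicPole (φ p) (mfderiv (𝓡 n) (𝓡 n) φ p v)
      = T (ε p • mvfderiv (𝓡 n) Λ.harmonicPole p v) := by
  have hd := mdiffAt_of_smoothOn F.isOpen_dom Λ.smooth_harmonicPole F.mem_dom
  rw [mvfderiv_of_comp_eq (b := fun _ => 0)
    (mdiffAt_of_smoothOn F'.isOpen_dom Λ'.smooth_harmonicPole (h.mapsTo p h.mem))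
    (h.localDiffeo p h.mem) (mdiffAt_of_smoothOn h.isOpen h.smooth_ε h.mem)
    mdifferentiableAt_const hd hd
    (by filter_upwards [h.isOpen.mem_nhds h.mem] with r hr'
        rw [zero_smul, add_zero]
        exact h.harmonicPole_eq hr' hT hn hX (hr r hr') (Λ.isLambda r (h.subset hr'))
          (Λ'.isLambda (φ r) (h.mapsTo r hr'))), mvfderiv_const,
    mvfderiv_eq_zero_of_sq h.isOpen h.smooth_ε h.sq h.mem]
  congr 1
  have : (0 : TangentSpace (𝓡 n) p →L[ℝ] ℝ) v = 0 := rfl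
  rw [this]
  module

lemma wedge_eq_map (hX' : IsLightlikeHypersurface X') (hr : ∀ q ∈ O, F.IsRegularAt q)
    (hr' : F'.IsRegularAt (φ p)) (Λ : F.Coeffs) (Λ' : F'.Coeffs) :
    Λ'.wedge = Λ.wedge.map T.toLinearMap := by
  have hε0 : ε p ≠ 0 := fun h0 => by simpa [h0] using h.sq p h.mem
  rw [Coeffs.wedge_eq_range hn hX' hr', Coeffs.wedge_eq_range hn hX (hr p h.mem)]
  ext z
  constructor
  · rintro ⟨w, rfl⟩
    obtain ⟨v, rfl⟩ := IsLocalDiffeomorphAt.surjective_mfderiv (h.localDiffeo p h.mem) w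
    exact ⟨_, ⟨ε p • v, rfl⟩, ((h.mvfderiv_harmonicPole hT hn hX hr Λ Λ' v).trans
      (congrArg T (map_smul (mvfderiv (𝓡 n) Λ.harmonicPole p) _ _).symm)).symm⟩
  · rintro ⟨_, ⟨v, rfl⟩, rfl⟩
    refine ⟨mfderiv (𝓡 n) (𝓡 n) φ p ((ε p)⁻¹ • v), ?_⟩
    refine (h.mvfderiv_harmonicPole hT hn hX hr Λ Λ' _).trans ?_
    rw [map_smul (mvfderiv (𝓡 n) Λ.harmonicPole p), smul_smul, mul_inv_cancel₀ hε0, one_smul]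
    rfl

end IsTransport

end Comparison

/-! ### The field ζ: independence of the frame, equivariance, and the normalization property. -/

section Zeta

variable {n : ℕ} {M : Type u} [TopologicalSpace M] [ChartedSpace (EuclideanSpace ℝ (Fin n)) M]
  {X : M → ℙ ℝ (V n)} {p : M}

open AdaptedFrame

variable (hn : 2 ≤ n) (hX : IsLightlikeHypersurface X) (hrank : HasMaximalRank X)
include hn hX hrank

theorem zeta_eq_wedge {F : AdaptedFrame X p} (Λ : F.Coeffs) : zeta X p = Λ.wedge := by
  refine le_antisymm (iSup_le fun F' => iSup_le fun Λ' => ?_) (le_iSup_of_le F (le_iSup_of_le Λ le_rfl))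
  obtain ⟨O, ε, s, t, h⟩ := exists_isTransport_id hX F F'
  have := h.wedge_eq_map isMotion_refl hn hX hX
    (fun q hq => F.isRegularAt hX hrank (h.subset hq)) (F'.isRegularAt hX hrank F'.mem_dom) Λ Λ'
  rw [this]
  exact (Submodule.map_id _).le

lemma det_aTensor_ne_zero_of_frame {F F' : AdaptedFrame X p}
    {L L' : Matrix (Fin (n - 1)) (Fin (n - 1)) ℝ} (hL : F.IsLambda p L) (hL' : F'.IsLambda p L')
    (hd : (F.aTensor p L).det ≠ 0) : (F'.aTensor p L').det ≠ 0 := by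
  obtain ⟨O, ε, s, t, h⟩ := exists_isTransport_id hX F F'
  exact h.det_aTensor_ne_zero isMotion_refl hn hX h.mem (F.isRegularAt hX hrank F.mem_dom) hL hL' hd

lemma det_aTensor_ne_zero (ha : HasNondegenerateA X) (F : AdaptedFrame X p) {q : M}
    (hq : q ∈ F.dom) {L : Matrix (Fin (n - 1)) (Fin (n - 1)) ℝ} (hL : F.IsLambda q L) :
    (F.aTensor q L).det ≠ 0 := by
  obtain ⟨F₀, L₀, hL₀, hd⟩ := ha q
  exact det_aTensor_ne_zero_of_frame hn hX hrank (F' := F.moveTo hq) hL₀ hL hd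

variable [IsManifold (𝓡 n) ∞ M]

omit hn in
lemma nonempty_coeffs_of_hasMaximalRank (F : AdaptedFrame X p) : Nonempty F.Coeffs :=
  nonempty_coeffs hX fun _ hq => F.isRegularAt hX hrank hq

/-- The λ_{ijk} of `Λ` live at `p` only, but λ_{ij} is unique, so the frame moved to `q` has the
same harmonic pole near `q`. Thus one smooth C describes ζ on the whole domain. -/
lemma zeta_eq_range {F : AdaptedFrame X p} (Λ : F.Coeffs) {q : M} (hq : q ∈ F.dom) :
    zeta X q = LinearMap.range (mvfderiv (𝓡 n) Λ.harmonicPole q).toLinearMap := by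
  obtain ⟨Λ'⟩ := nonempty_coeffs_of_hasMaximalRank hX hrank (F.moveTo hq)
  rw [zeta_eq_wedge hn hX hrank Λ', Coeffs.wedge_eq_range hn hX
    ((F.moveTo hq).isRegularAt hX hrank hq),
    mvfderiv_congr (f := Λ'.harmonicPole) (g := Λ.harmonicPole)]
  filter_upwards [F.isOpen_dom.mem_nhds hq] with r hr
  have : Λ'.lam r = Λ.lam r := isLambda_unique hr hX (F.isRegularAt hX hrank hr)
    (Λ'.isLambda r hr) (Λ.isLambda r hr)
  change F.An r + F.meanLambda r (Λ'.lam r) • F.A0 r = _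
  rw [this]
  rfl

theorem zeta_eq_map {M' : Type u} [TopologicalSpace M'] [ChartedSpace (EuclideanSpace ℝ (Fin n)) M']
    [IsManifold (𝓡 n) ∞ M'] {X' : M' → ℙ ℝ (V n)} (hX' : IsLightlikeHypersurface X')
    (hrank' : HasMaximalRank X') {T : V n ≃ₗ[ℝ] V n} {φ : M → M'} (hT : IsMotion T)
    (hφ : IsLocalDiffeomorphAt (𝓡 n) (𝓡 n) ∞ φ p) (hg : CarriesGenerators X X' T φ p) :
    zeta X' (φ p) = (zeta X p).map T.toLinearMap := by
  obtain ⟨F, -⟩ := hrank p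
  obtain ⟨F', -⟩ := hrank' (φ p)
  obtain ⟨Λ⟩ := nonempty_coeffs_of_hasMaximalRank hX hrank F
  obtain ⟨Λ'⟩ := nonempty_coeffs_of_hasMaximalRank hX' hrank' F'
  obtain ⟨O, ε, s, t, h⟩ := exists_isTransport hX hX' F F' hT hφ hg
  rw [zeta_eq_wedge hn hX hrank Λ, zeta_eq_wedge hn hX' hrank' Λ',
    h.wedge_eq_map hT hn hX hX' (fun q hq => F.isRegularAt hX hrank (h.subset hq))
      (F'.isRegularAt hX' hrank' F'.mem_dom) Λ Λ']

theorem isNormalization_zeta (ha : HasNondegenerateA X) : IsNormalization X (zeta X) := by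
  have hF : ∀ (p : M) (F : AdaptedFrame X p), F.IsRegularAt p :=
    fun p F => F.isRegularAt hX hrank F.mem_dom
  have hd : ∀ (p : M) (F : AdaptedFrame X p) (Λ : F.Coeffs), (F.aTensor p (Λ.lam p)).det ≠ 0 :=
    fun p F Λ => det_aTensor_ne_zero hn hX hrank ha F F.mem_dom (Λ.isLambda p F.mem_dom)
  refine ⟨fun p => ?_, fun p F => ?_, fun p F => ?_, fun p => ?_⟩
  · obtain ⟨F, -⟩ := hrank p
    obtain ⟨Λ⟩ := nonempty_coeffs_of_hasMaximalRank hX hrank F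
    rw [zeta_eq_wedge hn hX hrank Λ, Coeffs.wedge, finrank_span_eq_card
      (Coeffs.linearIndependent_point hn hX (hF p F) (hd p F Λ)), Fintype.card_fin]
  · obtain ⟨Λ⟩ := nonempty_coeffs_of_hasMaximalRank hX hrank F
    rw [zeta_eq_wedge hn hX hrank Λ]
    exact Coeffs.wedge_le_tangentV hX (hF p F)
  · obtain ⟨Λ⟩ := nonempty_coeffs_of_hasMaximalRank hX hrank F
    rw [zeta_eq_wedge hn hX hrank Λ]
    exact Coeffs.A0_notMem_wedge hn hX (hF p F) (hd p F Λ)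
  · obtain ⟨F, -⟩ := hrank p
    obtain ⟨Λ⟩ := nonempty_coeffs_of_hasMaximalRank hX hrank F
    obtain ⟨E₀, E, -, hEs, hE₀, hE⟩ := exists_dual_fields hX F
    refine ⟨F.dom, fun i q => mvfderiv (𝓡 n) Λ.harmonicPole q (E i q), F.isOpen_dom, F.mem_dom,
      fun i => contMDiffOn_mvfderiv_apply F.isOpen_dom Λ.smooth_harmonicPole (hEs i),
      fun q hq => ?_⟩
    have hle : Submodule.span ℝ (Set.range fun i => mvfderiv (𝓡 n) Λ.harmonicPole q (E i q))
        ≤ zeta X q := by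
      rw [zeta_eq_range hn hX hrank Λ hq, Submodule.span_le]
      rintro _ ⟨i, rfl⟩
      exact LinearMap.mem_range_self _ (E i q)
    refine le_antisymm ?_ hle
    obtain ⟨Λ'⟩ := nonempty_coeffs_of_hasMaximalRank hX hrank (F.moveTo hq)
    -- C is stationary along the generator: dC(E₀) is a multiple of A_0 lying in ζ, which does not
    -- contain A_0. Hence the n - 1 fields dC(E_i) already span ζ smoothly.
    have hzero : mvfderiv (𝓡 n) Λ.harmonicPole q (E₀ q) = 0 := by
      have h1 : F.nMap q (E₀ q) = 0 := by
        ext i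
        rw [nMap_apply, hE₀ q hq, F.form_A0_A q hq]; rfl
      have h2 := ((F.isRegularAt hX hrank hq) _).2 h1
      have h3 : mvfderiv (𝓡 n) Λ.harmonicPole q (E₀ q)
          = (-form n (mvfderiv (𝓡 n) Λ.harmonicPole q (E₀ q)) (F.Ainf q)) • F.A0 q := by
        refine eq_smul_A0 hq (Coeffs.form_mvfderiv_harmonicPole_A0 hq _) (fun i => ?_)
          (Coeffs.form_mvfderiv_harmonicPole_An hq _)
        rw [Coeffs.form_mvfderiv_harmonicPole_A hq, h2, Matrix.mulVec_zero]
        simp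
      have h4 : mvfderiv (𝓡 n) Λ.harmonicPole q (E₀ q) ∈ zeta X q := by
        rw [zeta_eq_range hn hX hrank Λ hq]
        exact LinearMap.mem_range_self _ (E₀ q)
      rw [zeta_eq_wedge hn hX hrank Λ'] at h4
      have h5 := Coeffs.A0_notMem_wedge hn hX (hF q (F.moveTo hq)) (hd q (F.moveTo hq) Λ')
      by_contra h0
      generalize -form n (mvfderiv (𝓡 n) Λ.harmonicPole q (E₀ q)) (F.Ainf q) = c at h3
      have hc : c ≠ 0 := fun hc => h0 (by rw [h3, hc, zero_smul])
      rw [h3] at h4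
      exact h5 ((Submodule.smul_mem_iff _ hc).1 h4)
    rw [zeta_eq_range hn hX hrank Λ hq]
    rintro _ ⟨v, rfl⟩
    have hv : v = F.omegan0 q v • E₀ q + ∑ i, F.omeganI q i v • E i q := by
      apply dAn_injective hq hX
      rw [dAn_eq hq v, map_add, map_smul, map_sum, hE₀ q hq]
      simp only [map_smul, hE q hq]
    change mvfderiv (𝓡 n) Λ.harmonicPole q v ∈ _
    rw [hv, map_add, map_smul, map_sum, hzero, smul_zero, zero_add]
    exact sum_mem fun i _ => by
      rw [map_smul]; exact Submodule.smul_mem _ _ (Submodule.subset_span ⟨i, rfl⟩)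

end Zeta

/-! ### Frames with A_i in ζ. -/

section Reduced

variable {n : ℕ} {M : Type u} [TopologicalSpace M] [ChartedSpace (EuclideanSpace ℝ (Fin n)) M]
  {X : M → ℙ ℝ (V n)} {p : M}

namespace AdaptedFrame

variable {F : AdaptedFrame X p}

lemma eq_A_add_smul_A0 {q : M} (hq : q ∈ F.dom) {z : V n} {i} (h0 : form n z (F.A0 q) = 0)
    (hn : form n z (F.An q) = 0) (hA : ∀ j, form n z (F.A j q) = F.g q i j) :
    z = F.A i q + (-form n z (F.Ainf q)) • F.A0 q := by
  have h := eq_smul_A0 hq (z := z - F.A i q) (by simp [h0, form_A_A0 hq])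
    (fun j => by simp [hA, g_apply]) (by simp [hn, F.form_A_An q hq])
  rw [map_sub, LinearMap.sub_apply, F.form_A_Ainf q hq, sub_zero] at h
  rw [← h]; abel

/-- Replacing the points `A_i` by other points of the lines `A_i A_0` in an adapted frame. -/
lemma exists_frame_of_points (F : AdaptedFrame X p) (B : Fin (n - 1) → M → V n)
    (hBs : ∀ i, ContMDiffOn (𝓡 n) 𝓘(ℝ, V n) ∞ (B i) F.dom)
    (h0 : ∀ q ∈ F.dom, ∀ i, form n (B i q) (F.A0 q) = 0)
    (hn : ∀ q ∈ F.dom, ∀ i, form n (B i q) (F.An q) = 0)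
    (hA : ∀ q ∈ F.dom, ∀ i j, form n (B i q) (F.A j q) = F.g q i j) :
    ∃ F' : AdaptedFrame X p, F'.dom = F.dom ∧ F'.A0 = F.A0 ∧ F'.An = F.An ∧ F'.A = B := by
  let b : Fin (n - 1) → M → ℝ := fun i q => -form n (B i q) (F.Ainf q)
  have hbs : ∀ i, ContMDiffOn (𝓡 n) 𝓘(ℝ, ℝ) ∞ (b i) F.dom := fun i =>
    (contMDiffOn_form (hBs i) F.smooth_Ainf).neg
  have hB : ∀ q ∈ F.dom, ∀ i, B i q = F.A i q + b i q • F.A0 q := fun q hq i =>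
    eq_A_add_smul_A0 hq (h0 q hq i) (hn q hq i) (hA q hq i)
  -- For B_i = A_i + b_iA_0 the new last point is A_{n+1} + c^iA_i + dA_0. Orthogonality to the B_i
  -- requires c^i g_{ij} = b_j, and isotropy requires 2d = c^i b_i.
  let c : Fin (n - 1) → M → ℝ := fun i q => ∑ j, (F.g q)⁻¹ i j * b j q
  have hcs : ∀ i, ContMDiffOn (𝓡 n) 𝓘(ℝ, ℝ) ∞ (c i) F.dom := fun i =>
    contMDiffOn_finsetSum fun j _ => (smooth_ginv i j).mul (hbs j)
  have hc : ∀ q ∈ F.dom, ∀ i, ∑ j, c j q * F.g q i j = b i q := by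
    intro q hq i
    have h := congrFun (g_mulVec_ginv hq (fun j => b j q)) i
    rw [← h]
    exact Finset.sum_congr rfl fun j _ => mul_comm _ _
  let d : M → ℝ := fun q => 1 / 2 * ∑ i, c i q * b i q
  have hds : ContMDiffOn (𝓡 n) 𝓘(ℝ, ℝ) ∞ d F.dom :=
    contMDiffOn_const.mul (contMDiffOn_finsetSum fun i _ => (hcs i).mul (hbs i))
  have hsm : ∀ {a : M → ℝ} {f : M → V n}, ContMDiffOn (𝓡 n) 𝓘(ℝ, ℝ) ∞ a F.dom →
      ContMDiffOn (𝓡 n) 𝓘(ℝ, V n) ∞ f F.dom →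
      ContMDiffOn (𝓡 n) 𝓘(ℝ, V n) ∞ (fun q => a q • f q) F.dom :=
    fun ha hf => contMDiffOn_bilin (ContinuousLinearMap.lsmul ℝ ℝ) ha hf
  let N : M → V n := fun q => F.Ainf q + (∑ i, c i q • F.A i q) + d q • F.A0 q
  have hNs : ContMDiffOn (𝓡 n) 𝓘(ℝ, V n) ∞ N F.dom :=
    (F.smooth_Ainf.add (contMDiffOn_finsetSum fun i _ => hsm (hcs i) (F.smooth_A i))).add
      (hsm hds F.smooth_A0)
  have hN0 : ∀ q ∈ F.dom, form n (F.A0 q) (N q) = -1 := fun q hq => by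
    simp [N, F.form_A0_Ainf q hq, F.form_A0_A q hq, F.form_A0_A0 q hq]
  have hNn : ∀ q ∈ F.dom, form n (F.An q) (N q) = 0 := fun q hq => by
    simp [N, F.form_An_Ainf q hq, form_An_A hq, form_An_A0 hq]
  have hNA : ∀ q ∈ F.dom, ∀ i, form n (F.A i q) (N q) = b i q := fun q hq i => by
    rw [← hc q hq i]
    simp [N, F.form_A_Ainf q hq, form_A_A0 hq, g_apply]
  have hNi : ∀ q ∈ F.dom, form n (F.Ainf q) (N q) = -d q := fun q hq => by
    simp [N, F.form_Ainf_Ainf q hq, form_Ainf_A hq, form_Ainf_A0 hq]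
  have hNf : ∀ q z, form n (N q) z = form n (F.Ainf q) z + ∑ i, c i q * form n (F.A i q) z
      + d q * form n (F.A0 q) z := fun q z => by simp [N]
  clear_value N
  refine ⟨{ F with
    A := B
    Ainf := N
    smooth_A := hBs
    smooth_Ainf := hNs
    form_A0_A := fun q hq i => by rw [form_symm]; exact h0 q hq i
    form_A0_Ainf := hN0
    form_A_An := hn
    form_A_Ainf := fun q hq i => by
      rw [hB q hq i, map_add, map_smul, LinearMap.add_apply, LinearMap.smul_apply, hNA q hq,
        hN0 q hq]
      simp
    form_An_Ainf := hNn
    form_Ainf_Ainf := fun q hq => ?_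
    linearIndependent_A := fun q hq => ?_ }, rfl, rfl, rfl, rfl⟩
  · rw [hNf q (N q), hNi q hq, hN0 q hq, Finset.sum_congr rfl fun i _ => by rw [hNA q hq i]]
    simp only [d]
    ring
  · rw [Fintype.linearIndependent_iff]
    intro a ha
    have h1 : Matrix.vecMul a (F.g q) = 0 := by
      ext j
      have := congrArg (fun z => form n z (F.A j q)) ha
      simpa [Matrix.vecMul, dotProduct, hA q hq] using this
    have h2 := congrArg (fun w => Matrix.vecMul w (F.g q)⁻¹) h1
    simp only [Matrix.vecMul_vecMul, mul_ginv hq, Matrix.vecMul_one, Matrix.zero_vecMul] at h2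
    exact congrFun h2

end AdaptedFrame

open AdaptedFrame

variable [IsManifold (𝓡 n) ∞ M] (hn : 2 ≤ n) (hX : IsLightlikeHypersurface X)
  (hrank : HasMaximalRank X)
include hn hX hrank

/-- Frames adapted to the normalization exist near points where `a_{ij}` is nondegenerate. -/
theorem exists_isReduced {F : AdaptedFrame X p} {L : Matrix (Fin (n - 1)) (Fin (n - 1)) ℝ}
    (hL : F.IsLambda p L) (hd : (F.aTensor p L).det ≠ 0) :
    ∃ F' : AdaptedFrame X p, F'.IsReduced (zeta X) := by
  obtain ⟨Λ₁⟩ := nonempty_coeffs_of_hasMaximalRank hX hrank F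
  have hL₁ : L = Λ₁.lam p := isLambda_unique F.mem_dom hX (F.isRegularAt hX hrank F.mem_dom) hL
    (Λ₁.isLambda p F.mem_dom)
  rw [hL₁] at hd
  -- Nondegeneracy is given at `p` only; by continuity it holds on a smaller domain, to which the
  -- frame is restricted.
  have hsm : ContMDiffOn (𝓡 n) 𝓘(ℝ, ℝ) ∞ (fun q => (F.aTensor q (Λ₁.lam q)).det) F.dom :=
    contMDiffOn_matrix_det fun i j =>
      (Λ₁.smooth_lam i j).sub (Λ₁.smooth_meanLambda.mul (smooth_g i j))
  have hev := ((hsm.contMDiffAt (F.isOpen_dom.mem_nhds F.mem_dom)).continuousAt).eventually_ne hd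
  obtain ⟨O, hO, hOo, hpO⟩ := eventually_nhds_iff.1 hev
  set G := F.restrict hOo hpO
  obtain ⟨Λ⟩ := nonempty_coeffs_of_hasMaximalRank hX hrank G
  have hdet : ∀ q ∈ G.dom, (G.aTensor q (Λ.lam q)).det ≠ 0 := by
    intro q hq
    have : Λ₁.lam q = Λ.lam q := isLambda_unique hq hX (G.isRegularAt hX hrank hq)
      (Λ₁.isLambda q hq.1) (Λ.isLambda q hq)
    rw [← this]
    exact hO q hq.2
  clear_value G
  obtain ⟨E₀, E, -, hEs, -, hE⟩ := exists_dual_fields hX G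
  have hCs : ∀ k, ContMDiffOn (𝓡 n) 𝓘(ℝ, V n) ∞
      (fun q => mvfderiv (𝓡 n) Λ.harmonicPole q (E k q)) G.dom := fun k =>
    contMDiffOn_mvfderiv_apply G.isOpen_dom Λ.smooth_harmonicPole (hEs k)
  -- The combinations of the dC(E_k) with coefficient matrix gN⁻¹ have scalar products g_{ij} with
  -- the A_j: they are the points of ζ on the lines A_iA_0.
  let N : M → Matrix (Fin (n - 1)) (Fin (n - 1)) ℝ := fun q => Matrix.of fun k j =>
    form n (mvfderiv (𝓡 n) Λ.harmonicPole q (E k q)) (G.A j q)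
  have hNs : ∀ k j, ContMDiffOn (𝓡 n) 𝓘(ℝ, ℝ) ∞ (fun q => N q k j) G.dom := fun k j =>
    contMDiffOn_form (hCs k) (G.smooth_A j)
  -- A kernel vector c yields v = c^kE_k with dC(v) proportional to A_0, so Y(v) = 0 and N(v) = 0;
  -- but N(v) is the covector cg.
  have hN : ∀ q ∈ G.dom, (N q).det ≠ 0 := by
    intro q hq h0
    obtain ⟨c, hc0, hc⟩ := Matrix.exists_vecMul_eq_zero_iff.2 h0
    set v := ∑ k, c k • E k q with hv
    have h1 := eq_smul_A0 hq (Coeffs.form_mvfderiv_harmonicPole_A0 (Λ := Λ) hq v)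
      (fun j => by
        have := congrFun hc j
        simpa [hv, Matrix.vecMul, dotProduct, N] using this)
      (Coeffs.form_mvfderiv_harmonicPole_An hq v)
    have h2 := ((G.isRegularAt hX hrank hq) v).1 (Coeffs.yMap_eq_zero_of_smul_A0 hq (hdet q hq) h1)
    have h3 : Matrix.vecMul c (G.g q) = 0 := by
      rw [← h2, hv, map_sum]
      ext j
      simp [nMap_dual (hE q hq _), Matrix.vecMul, dotProduct]
    have h4 := congrArg (fun w => Matrix.vecMul w (G.g q)⁻¹) h3
    simp only [Matrix.vecMul_vecMul, mul_ginv hq, Matrix.vecMul_one, Matrix.zero_vecMul] at h4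
    exact hc0 h4
  obtain ⟨F', hdom, -, -, hA⟩ := G.exists_frame_of_points
    (fun i q => ∑ k, (G.g q * (N q)⁻¹) i k • mvfderiv (𝓡 n) Λ.harmonicPole q (E k q))
    (fun i => contMDiffOn_finsetSum fun k _ => contMDiffOn_bilin (ContinuousLinearMap.lsmul ℝ ℝ)
      (contMDiffOn_matrix_mul smooth_g (contMDiffOn_matrix_inv hNs hN) i k) (hCs k))
    (fun q hq i => by simp [Coeffs.form_mvfderiv_harmonicPole_A0 hq])
    (fun q hq i => by simp [Coeffs.form_mvfderiv_harmonicPole_An hq])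
    (fun q hq i j => by
      have h1 : G.g q * (N q)⁻¹ * N q = G.g q := by
        rw [Matrix.mul_assoc, Matrix.nonsing_inv_mul _ (isUnit_iff_ne_zero.2 (hN q hq)),
          Matrix.mul_one]
      rw [← congrFun (congrFun h1 i) j, Matrix.mul_apply]
      simp only [map_sum, map_smul, LinearMap.sum_apply, LinearMap.smul_apply, smul_eq_mul]
      rfl)
  refine ⟨F', fun q hq i => ?_⟩
  rw [hdom] at hq
  rw [hA, zeta_eq_range hn hX hrank Λ hq]
  exact sum_mem fun k _ => Submodule.smul_mem _ _ (LinearMap.mem_range_self _ (E k q))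

end Reduced

/-! ### The screen distribution. -/

section Screen

variable {n : ℕ} {M : Type u} [TopologicalSpace M] [ChartedSpace (EuclideanSpace ℝ (Fin n)) M]
  {X : M → ℙ ℝ (V n)} {p : M}

open AdaptedFrame

lemma AdaptedFrame.tangentVectorsIn_eq {F : AdaptedFrame X p} {q : M} (hq : q ∈ F.dom)
    (S : Submodule ℝ (V n)) :
    tangentVectorsIn X q S = S.comap (mvfderiv (𝓡 n) F.An q).toLinearMap := by
  apply le_antisymm
  · exact iInf_le_of_le F.dom (iInf_le_of_le F.An (iInf_le_of_le ⟨hq, F.isLift_An⟩ le_rfl))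
  · refine le_iInf fun O => le_iInf fun x => le_iInf fun h v hv => ?_
    change mvfderiv (𝓡 n) x q v ∈ S
    rw [F.isLift_An.mvfderiv_eq_smul h.2 hq h.1]
    exact S.smul_mem _ hv

lemma AdaptedFrame.mem_isotropicDirection_iff {F : AdaptedFrame X p} {q : M} (hq : q ∈ F.dom)
    (hX : IsLightlikeHypersurface X) (v : TangentSpace (𝓡 n) q) :
    v ∈ isotropicDirection X q ↔ F.nMap q v = 0 := by
  rw [isotropicDirection, tangentVectorsIn_eq hq, generator_eq hq hX]
  change mvfderiv (𝓡 n) F.An q v ∈ Submodule.span ℝ {F.An q} ⊔ Submodule.span ℝ {F.A0 q} ↔ _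
  constructor
  · intro h
    obtain ⟨y, hy, z, hz, hyz⟩ := Submodule.mem_sup.1 h
    obtain ⟨a, rfl⟩ := Submodule.mem_span_singleton.1 hy
    obtain ⟨b, rfl⟩ := Submodule.mem_span_singleton.1 hz
    ext i
    rw [nMap_apply, ← hyz]
    simp [form_An_A hq, F.form_A0_A q hq]
  · intro h
    rw [dAn_eq_smul hq v h]
    exact Submodule.mem_sup_right (Submodule.smul_mem _ _ (Submodule.mem_span_singleton_self _))

variable [IsManifold (𝓡 n) ∞ M] (hn : 2 ≤ n) (hX : IsLightlikeHypersurface X)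
  (hrank : HasMaximalRank X)
include hn hX hrank

/-- ζ is spanned by n - 1 points even where a degenerates, so the independent A_i of a reduced frame
must fill it. -/
lemma finrank_zeta_le (q : M) : Module.finrank ℝ (zeta X q) ≤ n - 1 := by
  obtain ⟨F, -⟩ := hrank q
  obtain ⟨Λ⟩ := nonempty_coeffs_of_hasMaximalRank hX hrank F
  rw [zeta_eq_wedge hn hX hrank Λ, Coeffs.wedge]
  exact (finrank_range_le_card _).trans (Fintype.card_fin _).le

variable {F : AdaptedFrame X p} (hF : F.IsReduced (zeta X)) {q : M} (hq : q ∈ F.dom)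
include hF hq

lemma zeta_eq_span : zeta X q = Submodule.span ℝ (Set.range fun i => F.A i q) := by
  refine (Submodule.eq_of_le_of_finrank_le ?_ ?_).symm
  · rw [Submodule.span_le]
    rintro _ ⟨i, rfl⟩
    exact hF q hq i
  · rw [finrank_span_eq_card (F.linearIndependent_A q hq), Fintype.card_fin]
    exact finrank_zeta_le hn hX hrank q

/-- In a reduced frame x ∧ ζ is spanned by A_n and the A_i, all orthogonal to A_{n+1}, while dA_n(v)
= ω_n^0A_0 + ω_n^iA_i. -/
lemma mem_screen_iff (v : TangentSpace (𝓡 n) q) :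
    v ∈ screen X (zeta X) q ↔ F.omegan0 q v = 0 := by
  rw [screen, tangentVectorsIn_eq hq, zeta_eq_span hn hX hrank hF hq, span_An hq]
  change mvfderiv (𝓡 n) F.An q v ∈ Submodule.span ℝ {F.An q}
    ⊔ Submodule.span ℝ (Set.range fun i => F.A i q) ↔ _
  constructor
  · intro h
    have hle : Submodule.span ℝ {F.An q} ⊔ Submodule.span ℝ (Set.range fun i => F.A i q)
        ≤ LinearMap.ker ((form n).flip (F.Ainf q)) := by
      refine sup_le ?_ ?_ <;> rw [Submodule.span_le]
      · rintro _ rfl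
        exact F.form_An_Ainf q hq
      · rintro _ ⟨i, rfl⟩
        exact F.form_A_Ainf q hq i
    have h1 : form n (mvfderiv (𝓡 n) F.An q v) (F.Ainf q) = 0 := hle h
    rw [omegan0, coeff0, h1, neg_zero]
  · intro h
    rw [dAn_eq hq v, h, zero_smul, zero_add]
    exact Submodule.mem_sup_right (sum_mem fun i _ =>
      Submodule.smul_mem _ _ (Submodule.subset_span ⟨i, rfl⟩))

omit hn hrank hF [IsManifold (𝓡 n) ∞ M] in
lemma eq_sum_dual {E₀ : TangentSpace (𝓡 n) q} {E : Fin (n - 1) → TangentSpace (𝓡 n) q}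
    (hE₀ : mvfderiv (𝓡 n) F.An q E₀ = F.A0 q)
    (hE : ∀ i, mvfderiv (𝓡 n) F.An q (E i) = F.A i q) (v : TangentSpace (𝓡 n) q) :
    v = F.omegan0 q v • E₀ + ∑ i, F.omeganI q i v • E i := by
  apply dAn_injective hq hX
  rw [dAn_eq hq v, map_add, map_smul, map_sum, hE₀]
  simp only [map_smul, hE]

omit hF hq
theorem isScreenDistribution (ha : HasNondegenerateA X) :
    IsScreenDistribution X (screen X (zeta X)) := by
  have hred : ∀ p, ∃ F : AdaptedFrame X p, F.IsReduced (zeta X) := fun p => by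
    obtain ⟨F, L, hL, hd⟩ := ha p
    exact exists_isReduced hn hX hrank hL hd
  have hspan : ∀ (p : M) (F : AdaptedFrame X p), F.IsReduced (zeta X) → ∀ q ∈ F.dom,
      ∀ {E₀ : TangentSpace (𝓡 n) q} {E : Fin (n - 1) → TangentSpace (𝓡 n) q},
      mvfderiv (𝓡 n) F.An q E₀ = F.A0 q → (∀ i, mvfderiv (𝓡 n) F.An q (E i) = F.A i q) →
      screen X (zeta X) q = Submodule.span ℝ (Set.range E) := by
    intro p F hF q hq E₀ E hE₀ hE
    apply le_antisymm
    · intro v hv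
      rw [mem_screen_iff hn hX hrank hF hq] at hv
      rw [eq_sum_dual hX hq hE₀ hE v, hv, zero_smul, zero_add]
      exact sum_mem fun i _ => Submodule.smul_mem _ _ (Submodule.subset_span ⟨i, rfl⟩)
    · rw [Submodule.span_le]
      rintro _ ⟨i, rfl⟩
      rw [SetLike.mem_coe, mem_screen_iff hn hX hrank hF hq, omegan0, coeff0, hE,
        F.form_A_Ainf q hq, neg_zero]
  refine ⟨fun p => ?_, fun p => ?_, fun p => ?_⟩ <;> obtain ⟨F, hF⟩ := hred p <;>
    obtain ⟨E₀, E, hE₀s, hEs, hE₀, hE⟩ := exists_dual_fields hX F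
  · rw [hspan p F hF p F.mem_dom (hE₀ p F.mem_dom) (hE p F.mem_dom), finrank_span_eq_card,
      Fintype.card_fin]
    refine LinearIndependent.of_comp (mvfderiv (𝓡 n) F.An p).toLinearMap ?_
    have h1 : LinearIndependent ℝ fun i => mvfderiv (𝓡 n) F.An p (E i p) := by
      simp only [hE p F.mem_dom]
      exact F.linearIndependent_A p F.mem_dom
    exact h1
  · refine ⟨?_, ?_⟩
    · rw [Submodule.disjoint_def]
      intro v hv hv'
      rw [mem_screen_iff hn hX hrank hF F.mem_dom] at hv
      rw [mem_isotropicDirection_iff F.mem_dom hX] at hv'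
      apply dAn_injective F.mem_dom hX
      rw [dAn_eq_smul F.mem_dom v hv', hv, zero_smul]
      exact (map_zero _).symm
    · rw [codisjoint_iff, eq_top_iff]
      rintro v -
      rw [eq_sum_dual hX F.mem_dom (hE₀ p F.mem_dom) (hE p F.mem_dom) v, add_comm]
      refine Submodule.add_mem_sup (sum_mem fun i _ => Submodule.smul_mem _ _ ?_)
        (Submodule.smul_mem _ _ ?_)
      · rw [hspan p F hF p F.mem_dom (hE₀ p F.mem_dom) (hE p F.mem_dom)]
        exact Submodule.subset_span ⟨i, rfl⟩
      · rw [mem_isotropicDirection_iff F.mem_dom hX]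
        ext i
        rw [nMap_apply, hE₀ p F.mem_dom, F.form_A0_A p F.mem_dom]; rfl
  · exact ⟨F.dom, E, F.isOpen_dom, F.mem_dom, hEs, fun q hq =>
      hspan p F hF q hq (hE₀ q hq) (hE q hq)⟩

end Screen

/-! ### Equivariance of the screens. -/

section ScreenComparison

variable {n : ℕ} {M M' : Type u} [TopologicalSpace M] [ChartedSpace (EuclideanSpace ℝ (Fin n)) M]
  [TopologicalSpace M'] [ChartedSpace (EuclideanSpace ℝ (Fin n)) M']
  {X : M → ℙ ℝ (V n)} {X' : M' → ℙ ℝ (V n)} {p : M} {φ : M → M'} {T : V n ≃ₗ[ℝ] V n}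

open AdaptedFrame

/-- When the motion carries points to points, the displacement t vanishes identically near `q`, so
dt is zero too. -/
lemma IsTransport.mvfderiv_An_of_carriesPoints {F : AdaptedFrame X p}
    {F' : AdaptedFrame X' (φ p)} {O : Set M} {ε s t : M → ℝ} (h : IsTransport F F' T O ε s t)
    {q : M} (hq : q ∈ O) (hc : CarriesPoints X X' T φ q) (v : TangentSpace (𝓡 n) q) :
    mvfderiv (𝓡 n) F'.An (φ q) (mfderiv (𝓡 n) (𝓡 n) φ q v)
      = T (ε q • mvfderiv (𝓡 n) F.An q v) := by
  have h1 : mvfderiv (𝓡 n) t q v = 0 := by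
    rw [mvfderiv_congr (g := fun _ => (0 : ℝ)), mvfderiv_const]
    · rfl
    · filter_upwards [hc, h.isOpen.mem_nhds hq] with r hr hrO
      exact h.displacement_eq_zero hrO hr
  rw [h.mvfderiv_An hq, h1, h.displacement_eq_zero hq hc.self_of_nhds]
  congr 1
  module

theorem screen_eq_map [IsManifold (𝓡 n) ∞ M] [IsManifold (𝓡 n) ∞ M'] (hn : 2 ≤ n)
    (hX : IsLightlikeHypersurface X) (hrank : HasMaximalRank X)
    (hX' : IsLightlikeHypersurface X') (hrank' : HasMaximalRank X') (hT : IsMotion T)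
    (hφ : IsLocalDiffeomorphAt (𝓡 n) (𝓡 n) ∞ φ p) (hc : CarriesPoints X X' T φ p) :
    screen X' (zeta X') (φ p)
      = (screen X (zeta X) p).map (mfderiv (𝓡 n) (𝓡 n) φ p).toLinearMap := by
  obtain ⟨F, -⟩ := hrank p
  obtain ⟨F', -⟩ := hrank' (φ p)
  obtain ⟨O, ε, s, t, h⟩ := exists_isTransport hX hX' F F' hT hφ hc.carriesGenerators
  have hε0 : ε p ≠ 0 := fun h0 => by simpa [h0] using h.sq p h.mem
  have hS : (X' (φ p)).submodule ⊔ zeta X' (φ p)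
      = ((X p).submodule ⊔ zeta X p).map T.toLinearMap := by
    rw [Submodule.map_sup, zeta_eq_map hn hX hrank hX' hrank' hT hφ hc.carriesGenerators,
      hc.self_of_nhds]
  have key : ∀ v, mfderiv (𝓡 n) (𝓡 n) φ p v ∈ screen X' (zeta X') (φ p)
      ↔ v ∈ screen X (zeta X) p := by
    intro v
    rw [screen, screen, tangentVectorsIn_eq F.mem_dom, tangentVectorsIn_eq F'.mem_dom, hS]
    change mvfderiv (𝓡 n) F'.An (φ p) (mfderiv (𝓡 n) (𝓡 n) φ p v)
        ∈ ((X p).submodule ⊔ zeta X p).map T.toLinearMap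
      ↔ mvfderiv (𝓡 n) F.An p v ∈ (X p).submodule ⊔ zeta X p
    rw [h.mvfderiv_An_of_carriesPoints h.mem hc]
    constructor
    · rintro ⟨z, hz, hzT⟩
      have := T.injective hzT
      rwa [this, SetLike.mem_coe, Submodule.smul_mem_iff _ hε0] at hz
    · exact fun hv => ⟨_, Submodule.smul_mem _ _ hv, rfl⟩
  ext w
  constructor
  · intro hw
    obtain ⟨v, rfl⟩ := IsLocalDiffeomorphAt.surjective_mfderiv hφ w
    exact ⟨v, (key v).1 hw, rfl⟩
  · rintro ⟨v, hv, rfl⟩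
    exact (key v).2 hv

end ScreenComparison

/-! ### Smooth fields of endomorphisms of the tangent bundle. -/

section HomBundle

variable {n : ℕ} {M : Type*} [TopologicalSpace M] [ChartedSpace (EuclideanSpace ℝ (Fin n)) M]
  [IsManifold (𝓡 n) ∞ M] {p : M}

omit [TopologicalSpace M] [ChartedSpace (EuclideanSpace ℝ (Fin n)) M] [IsManifold (𝓡 n) ∞ M] in
lemma sum_coord_smulRight (b : Module.Basis (Fin n) ℝ (EuclideanSpace ℝ (Fin n)))
    (z : Fin n → EuclideanSpace ℝ (Fin n)) (a : Fin n) :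
    ∑ i, ContinuousLinearMap.smulRightL ℝ (EuclideanSpace ℝ (Fin n))
        (EuclideanSpace ℝ (Fin n)) (LinearMap.toContinuousLinearMap (b.coord i)) (z i) (b a)
      = z a := by
  simp [Finsupp.single_apply]

/-- A field of endomorphisms of the tangent spaces is smooth if it maps smooth vector fields to
smooth vector fields. -/
lemma contMDiffAt_hom_of_apply {A : (q : M) → TangentSpace (𝓡 n) q →L[ℝ] TangentSpace (𝓡 n) q}
    {O : Set M} (hO : IsOpen O) (hp : p ∈ O)
    (h : ∀ (O' : Set M) (e : (q : M) → TangentSpace (𝓡 n) q), IsOpen O' → O' ⊆ O →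
      ContMDiffOn (𝓡 n) (𝓡 n).tangent ∞ (fun q => (⟨q, e q⟩ : TangentBundle (𝓡 n) M)) O' →
      ContMDiffOn (𝓡 n) (𝓡 n).tangent ∞
        (fun q => (⟨q, A q (e q)⟩ : TangentBundle (𝓡 n) M)) O') :
    ContMDiffAt (𝓡 n) ((𝓡 n).prod 𝓘(ℝ, EuclideanSpace ℝ (Fin n) →L[ℝ] EuclideanSpace ℝ (Fin n))) ∞
      (fun q => (⟨q, A q⟩ : Bundle.TotalSpace
        (EuclideanSpace ℝ (Fin n) →L[ℝ] EuclideanSpace ℝ (Fin n))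
        (fun q : M => TangentSpace (𝓡 n) q →L[ℝ] TangentSpace (𝓡 n) q))) p := by
  rw [contMDiffAt_hom_bundle]
  refine ⟨contMDiffAt_id, ?_⟩
  let t := trivializationAt (EuclideanSpace ℝ (Fin n)) (TangentSpace (𝓡 n) : M → Type _) p
  let b := (EuclideanSpace.basisFun (Fin n) ℝ).toBasis
  have hf := t.isLocalFrameOn_localFrame_baseSet (𝓡 n) ∞ b
  have ht : p ∈ t.baseSet := FiberBundle.mem_baseSet_trivializationAt' p
  have hU : IsOpen (t.baseSet ∩ O) := t.open_baseSet.inter hO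
  have hs : ∀ a, ContMDiffAt (𝓡 n) 𝓘(ℝ, EuclideanSpace ℝ (Fin n)) ∞
      (fun q => (t ⟨q, A q (t.localFrame b a q)⟩).2) p := by
    intro a
    have h1 := h _ (t.localFrame b a) hU Set.inter_subset_right
      ((hf.contMDiffOn a).mono Set.inter_subset_left)
    exact (Bundle.contMDiffAt_section p).1 (h1.contMDiffAt (hU.mem_nhds ⟨ht, hp⟩))
  -- In the trivialization an endomorphism is the sum of (a-th coordinate) ⊗ (image of the a-th
  -- frame field).
  have hsum : ContMDiffAt (𝓡 n) 𝓘(ℝ, EuclideanSpace ℝ (Fin n) →L[ℝ] EuclideanSpace ℝ (Fin n)) ∞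
      (fun q => ∑ a, ContinuousLinearMap.smulRightL ℝ (EuclideanSpace ℝ (Fin n))
        (EuclideanSpace ℝ (Fin n)) (LinearMap.toContinuousLinearMap (b.coord a))
        (t ⟨q, A q (t.localFrame b a q)⟩).2) p :=
    contMDiffAt_finsetSum fun a _ =>
      (ContinuousLinearMap.contMDiff _).contMDiffAt.comp p (hs a)
  refine hsum.congr_of_eventuallyEq ?_
  filter_upwards [t.open_baseSet.mem_nhds ht] with q hq
  refine ContinuousLinearMap.coe_injective (b.ext fun a => ?_)
  have hl : t.localFrame b a q = Bundle.Trivialization.symmL ℝ t q (b a) := by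
    rw [Bundle.Trivialization.localFrame_apply_of_mem_baseSet (e := t) (b := b) (hx := hq)]
    simp only [Bundle.Trivialization.basisAt, Module.Basis.map_apply]
    exact (t.symmL_apply (R := ℝ) hq (b a)).symm
  rw [ContinuousLinearMap.coe_coe, ContinuousLinearMap.coe_coe, sum_apply]
  refine Eq.trans ?_ (sum_coord_smulRight b (fun i => (t ⟨q, A q (t.localFrame b i q)⟩).2) a).symm
  rw [hl]
  exact t.continuousLinearMapAt_apply_of_mem (R := ℝ) hq _

end HomBundle

/-! ### The connection forms as a projected derivative. -/

section Connection

variable {n : ℕ} {M : Type u} [TopologicalSpace M] [ChartedSpace (EuclideanSpace ℝ (Fin n)) M]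
  {X : M → ℙ ℝ (V n)} {p : M}

namespace AdaptedFrame

variable (F : AdaptedFrame X p) {q : M}

/-- The projection onto the tangent vectors of the hypersurface along the line `A_n A_{n+1}`. -/
noncomputable def proj (q : M) : V n →L[ℝ] V n :=
  ContinuousLinearMap.id ℝ (V n) - (formL n (F.An q)).smulRight (F.An q)
    + (formL n (F.A0 q)).smulRight (F.Ainf q)

lemma proj_apply (q : M) (z : V n) : F.proj q z
    = z - form n (F.An q) z • F.An q + form n (F.A0 q) z • F.Ainf q := rfl

variable {F}

lemma proj_eq (hq : q ∈ F.dom) (z : V n) :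
    F.proj q z = F.coeff0 q z • F.A0 q + ∑ i, F.coeff q i z • F.A i q := by
  have h := expand hq z
  rw [proj_apply, form_symm (F.An q), form_symm (F.A0 q)]
  nth_rewrite 1 [h]
  simp only [coeffn, coeffInf, neg_smul]
  abel

lemma contMDiffOn_proj {O : Set M} (hO : O ⊆ F.dom) {f : M → V n}
    (hf : ContMDiffOn (𝓡 n) 𝓘(ℝ, V n) ∞ f O) :
    ContMDiffOn (𝓡 n) 𝓘(ℝ, V n) ∞ (fun q => F.proj q (f q)) O :=
  (hf.sub (contMDiffOn_bilin (ContinuousLinearMap.lsmul ℝ ℝ)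
    (contMDiffOn_form (F.smooth_An.mono hO) hf) (F.smooth_An.mono hO))).add
    (contMDiffOn_bilin (ContinuousLinearMap.lsmul ℝ ℝ)
    (contMDiffOn_form (F.smooth_A0.mono hO) hf) (F.smooth_Ainf.mono hO))

lemma proj_dAn (hq : q ∈ F.dom) (v : TangentSpace (𝓡 n) q) :
    F.proj q (mvfderiv (𝓡 n) F.An q v) = mvfderiv (𝓡 n) F.An q v := by
  rw [proj_apply, form_symm, form_dAn_An hq, form_symm, F.tangent q hq]
  module

lemma coeff0_comb (hq : q ∈ F.dom) (a : ℝ) (b : Fin (n - 1) → ℝ) :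
    F.coeff0 q (a • F.A0 q + ∑ i, b i • F.A i q) = a := by
  simp [coeff0, F.form_A0_Ainf q hq, F.form_A_Ainf q hq]

lemma coeff_comb (hq : q ∈ F.dom) (a : ℝ) (b : Fin (n - 1) → ℝ) (j) :
    F.coeff q j (a • F.A0 q + ∑ i, b i • F.A i q) = b j := by
  have h := congrFun (ginv_mulVec_g hq b) j
  rw [← h]
  simp only [coeff, Matrix.mulVec, dotProduct]
  refine Finset.sum_congr rfl fun k _ => ?_
  congr 1
  simp only [map_add, map_smul, LinearMap.add_apply, LinearMap.smul_apply, F.form_A0_A q hq,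
    map_sum, LinearMap.sum_apply, smul_eq_mul, mul_zero, zero_add]
  exact Finset.sum_congr rfl fun i _ => by rw [g_apply, form_symm, mul_comm]

variable [IsManifold (𝓡 n) ∞ M]

/-- The formulas for the induced connection say that, after application of `dA_n`, it is the
projected derivative. -/
lemma dAn_eq_proj_iff (F : AdaptedFrame X p) {Y : (q : M) → TangentSpace (𝓡 n) q}
    (hY : MDifferentiableAt (𝓡 n) (𝓡 n).tangent (fun q => (⟨q, Y q⟩ : TangentBundle (𝓡 n) M)) p)
    (v w : TangentSpace (𝓡 n) p) :
    mvfderiv (𝓡 n) F.An p w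
        = F.proj p (mvfderiv (𝓡 n) (fun q => mvfderiv (𝓡 n) F.An q (Y q)) p v) ↔
      (F.omegan0 p w
            = mvfderiv (𝓡 n) (fun q => F.omegan0 q (Y q)) p v
              + F.omega00 p v * F.omegan0 p (Y p)
              + ∑ i, F.omegaI0 p i v * F.omeganI p i (Y p) ∧
        ∀ i, F.omeganI p i w
            = mvfderiv (𝓡 n) (fun q => F.omeganI q i (Y q)) p v
              + F.omega0I p i v * F.omegan0 p (Y p)
              + ∑ j, F.omegaIJ p j i v * F.omeganI p j (Y p)) := by
  have hp := F.mem_dom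
  have hG := mdifferentiableAt_mvfderiv_apply F.isOpen_dom hp F.smooth_An hY
  have h0 : MDifferentiableAt (𝓡 n) 𝓘(ℝ, ℝ) (fun q => F.omegan0 q (Y q)) p :=
    (mdifferentiableAt_bilin (formL n) hG (mdiff_Ainf hp)).neg
  have hI : ∀ i, MDifferentiableAt (𝓡 n) 𝓘(ℝ, ℝ) (fun q => F.omeganI q i (Y q)) p := fun i =>
    mdifferentiableAt_sum Finset.univ (f := fun j q => (F.g q)⁻¹ i j
      * form n (mvfderiv (𝓡 n) F.An q (Y q)) (F.A j q)) fun j _ =>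
      mdifferentiableAt_bilin (ContinuousLinearMap.mul ℝ ℝ)
        (mdiffAt_of_smoothOn F.isOpen_dom (smooth_ginv i j) hp)
        (mdifferentiableAt_bilin (formL n) hG (mdiff_A hp j))
  -- Differentiate dA_n(Y) = ω_n^0(Y)A_0 + ω_n^i(Y)A_i; the coefficients at A_0 and A_i are the two
  -- right-hand sides of the connection.
  have hd : mvfderiv (𝓡 n) (fun q => mvfderiv (𝓡 n) F.An q (Y q)) p v
      = (mvfderiv (𝓡 n) (fun q => F.omegan0 q (Y q)) p v • F.A0 p
          + F.omegan0 p (Y p) • mvfderiv (𝓡 n) F.A0 p v)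
        + ∑ i, (mvfderiv (𝓡 n) (fun q => F.omeganI q i (Y q)) p v • F.A i p
          + F.omeganI p i (Y p) • mvfderiv (𝓡 n) (F.A i) p v) := by
    rw [mvfderiv_congr (g := fun q => F.omegan0 q (Y q) • F.A0 q
        + ∑ i, F.omeganI q i (Y q) • F.A i q)
        (by filter_upwards [F.isOpen_dom.mem_nhds hp] with q hq using dAn_eq hq (Y q)),
      mvfderiv_add_apply (mdifferentiableAt_smul h0 (mdiff_A0 hp))
        (mdifferentiableAt_sum Finset.univ (f := fun i q => F.omeganI q i (Y q) • F.A i q)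
          fun i _ => mdifferentiableAt_smul (hI i) (mdiff_A hp i)),
      mvfderiv_smul_apply h0 (mdiff_A0 hp), mvfderiv_sum Finset.univ
        (f := fun i q => F.omeganI q i (Y q) • F.A i q)
          fun i _ => mdifferentiableAt_smul (hI i) (mdiff_A hp i)]
    simp only [mvfderiv_smul_apply (hI _) (mdiff_A hp _)]
  have c0 : F.coeff0 p (mvfderiv (𝓡 n) (fun q => mvfderiv (𝓡 n) F.An q (Y q)) p v)
      = mvfderiv (𝓡 n) (fun q => F.omegan0 q (Y q)) p v
              + F.omega00 p v * F.omegan0 p (Y p)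
              + ∑ i, F.omegaI0 p i v * F.omeganI p i (Y p) := by
    rw [hd]
    simp only [coeff0, map_add, map_sum, map_smul, LinearMap.add_apply, LinearMap.sum_apply,
      LinearMap.smul_apply, smul_eq_mul, F.form_A0_Ainf p hp, F.form_A_Ainf p hp, omega00, omegaI0,
      mul_zero, zero_add, neg_add, ← Finset.sum_neg_distrib]
    congr 1
    · ring
    · exact Finset.sum_congr rfl fun i _ => by ring
  have cI : ∀ i, F.coeff p i (mvfderiv (𝓡 n) (fun q => mvfderiv (𝓡 n) F.An q (Y q)) p v)
      = mvfderiv (𝓡 n) (fun q => F.omeganI q i (Y q)) p v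
              + F.omega0I p i v * F.omegan0 p (Y p)
              + ∑ j, F.omegaIJ p j i v * F.omeganI p j (Y p) := by
    intro i
    have hs := coeff_comb hp (mvfderiv (𝓡 n) (fun q => F.omegan0 q (Y q)) p v)
      (fun j => mvfderiv (𝓡 n) (fun q => F.omeganI q j (Y q)) p v) i
    rw [← coeffForm_apply] at hs
    rw [hd, ← coeffForm_apply, Finset.sum_add_distrib, add_add_add_comm, map_add, hs, map_add,
      map_smul, map_sum, coeffForm_apply, add_assoc]
    congr 1
    rw [smul_eq_mul, mul_comm]
    congr 1
    exact Finset.sum_congr rfl fun j _ => by rw [map_smul, coeffForm_apply, smul_eq_mul, mul_comm]; rfl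
  simp only [proj_eq hp, c0, cI]
  constructor
  · intro h
    refine ⟨?_, fun i => ?_⟩
    · rw [omegan0, h, coeff0_comb hp]
    · rw [omeganI, h, coeff_comb hp]
  · rintro ⟨h1, h2⟩
    rw [dAn_eq hp w, h1]
    simp only [h2]

omit [IsManifold (𝓡 n) ∞ M] in
lemma exists_dAn_eq_proj (hX : IsLightlikeHypersurface X) (hq : q ∈ F.dom) :
    ∃ r : V n →L[ℝ] TangentSpace (𝓡 n) q, ∀ z, mvfderiv (𝓡 n) F.An q (r z) = F.proj q z := by
  obtain ⟨l, hl⟩ := (mvfderiv (𝓡 n) F.An q).toLinearMap.exists_leftInverse_of_injective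
    (LinearMap.ker_eq_bot.2 (dAn_injective hq hX))
  refine ⟨(LinearMap.toContinuousLinearMap l).comp (F.proj q), fun z => ?_⟩
  rw [proj_eq hq]
  obtain ⟨v, hv⟩ := exists_dAn_eq hq hX (F.coeff0 q z) (fun i => F.coeff q i z)
  change mvfderiv (𝓡 n) F.An q (l (F.proj q z)) = _
  rw [proj_eq hq, ← hv]
  exact congrArg (mvfderiv (𝓡 n) F.An q) (LinearMap.congr_fun hl v)

end AdaptedFrame

end Connection

/-! ### Equivariance of the projected derivative. -/

section ConnectionComparison

variable {n : ℕ} {M M' : Type u} [TopologicalSpace M] [ChartedSpace (EuclideanSpace ℝ (Fin n)) M]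
  [TopologicalSpace M'] [ChartedSpace (EuclideanSpace ℝ (Fin n)) M']
  [IsManifold (𝓡 n) ∞ M] [IsManifold (𝓡 n) ∞ M']
  {X : M → ℙ ℝ (V n)} {X' : M' → ℙ ℝ (V n)} {p : M} {φ : M → M'} {T : V n ≃ₗ[ℝ] V n}

open AdaptedFrame

namespace IsTransport

variable {F : AdaptedFrame X p} {F' : AdaptedFrame X' (φ p)} {O : Set M} {ε s t : M → ℝ}
  (h : IsTransport F F' T O ε s t) (hT : IsMotion T)
include h hT

omit [IsManifold (𝓡 n) ∞ M] [IsManifold (𝓡 n) ∞ M'] in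
/-- For frames adapted to invariant normalizations, the point `A_{n+1}` is invariant. -/
lemma smul_Ainf_eq {q : M} (hq : q ∈ O) (ht : t q = 0)
    (hA : ∀ i, T (F.A i q) ∈ Submodule.span ℝ (Set.range fun i => F'.A i (φ q))) :
    s q • F'.Ainf (φ q) = T (F.Ainf q) := by
  have hqF := h.subset hq
  have hqF' := h.mapsTo q hq
  have hε0 : ε q ≠ 0 := fun h0 => by simpa [h0] using h.sq q hq
  have hs0 := h.ne_zero q hq
  set w := T.symm (F'.Ainf (φ q)) with hw
  have hTw : T w = F'.Ainf (φ q) := T.apply_symm_apply _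
  have h0 : form n w (F.A0 q) = -(s q)⁻¹ := by
    have h1 := form_Ainf_A0 hqF'
    rw [h.A0_eq q hq, ← hTw, hT, map_smul, smul_eq_mul] at h1
    field_simp
    linarith
  have hn : form n w (F.An q) = 0 := by
    have h1 := form_Ainf_An hqF'
    rw [h.An_eq q hq, ← hTw, hT, ht, zero_smul, add_zero, map_smul, smul_eq_mul] at h1
    exact (mul_eq_zero.1 h1).resolve_left hε0
  have hi : ∀ i, form n w (F.A i q) = 0 := by
    intro i
    rw [← hT, hTw]
    have hle : Submodule.span ℝ (Set.range fun i => F'.A i (φ q))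
        ≤ LinearMap.ker (form n (F'.Ainf (φ q))) := by
      rw [Submodule.span_le]
      rintro _ ⟨i, rfl⟩
      exact form_Ainf_A hqF' i
    exact hle (hA i)
  -- Orthogonality to A_n and the A_i leaves a combination of A_0 and A_{n+1}; isotropy then removes
  -- the A_0 part.
  have hww : form n w w = 0 := by rw [← hT, hTw, F'.form_Ainf_Ainf _ hqF']
  have hex := expand hqF w
  have hc : ∀ i, F.coeff q i w = 0 := fun i => by simp [coeff, hi]
  rw [coeffn, hn, coeffInf, h0] at hex
  simp only [hc, zero_smul, Finset.sum_const_zero, add_zero, neg_neg] at hex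
  have hc0 : F.coeff0 q w = 0 := by
    rw [hex] at hww
    simp only [map_add, map_smul, LinearMap.add_apply, LinearMap.smul_apply, smul_eq_mul,
      F.form_A0_A0 q hqF, F.form_A0_Ainf q hqF, form_Ainf_A0 hqF, F.form_Ainf_Ainf q hqF] at hww
    have : F.coeff0 q w * (s q)⁻¹ = 0 := by linarith
    exact (mul_eq_zero.1 this).resolve_right (inv_ne_zero hs0)
  rw [hc0, zero_smul, zero_add] at hex
  rw [← hTw, ← map_smul, hex, smul_smul, mul_inv_cancel₀ hs0, one_smul]

omit [IsManifold (𝓡 n) ∞ M] [IsManifold (𝓡 n) ∞ M'] in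
-- In the formula for `proj` the sign ε occurs squared, and the factor s of A_0 cancels against the
-- inverse factor of A_{n+1}.
lemma proj_map {q : M} (hq : q ∈ O) (ht : t q = 0)
    (hA : ∀ i, T (F.A i q) ∈ Submodule.span ℝ (Set.range fun i => F'.A i (φ q))) (z : V n) :
    F'.proj (φ q) (T z) = T (F.proj q z) := by
  have hi := h.smul_Ainf_eq hT hq ht hA
  rw [proj_apply, proj_apply, h.An_eq q hq, h.A0_eq q hq, hT, hT, ht, zero_smul, add_zero]
  simp only [map_smul, LinearMap.smul_apply, smul_eq_mul, map_add, map_sub, ← hi, smul_smul]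
  congr 2
  · rw [mul_right_comm, h.sq q hq, one_mul]
  · rw [mul_comm]

omit hT in
lemma mvfderiv_dAn (hc : CarriesPoints X X' T φ p) {Y : (q : M) → TangentSpace (𝓡 n) q}
    {Y' : (q : M') → TangentSpace (𝓡 n) q}
    (hY : MDifferentiableAt (𝓡 n) (𝓡 n).tangent (fun q => (⟨q, Y q⟩ : TangentBundle (𝓡 n) M)) p)
    (hY' : MDifferentiableAt (𝓡 n) (𝓡 n).tangent
      (fun q => (⟨q, Y' q⟩ : TangentBundle (𝓡 n) M')) (φ p))
    (hYY : ∀ᶠ q in 𝓝 p, Y' (φ q) = mfderiv (𝓡 n) (𝓡 n) φ q (Y q)) (v : TangentSpace (𝓡 n) p) :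
    mvfderiv (𝓡 n) (fun q => mvfderiv (𝓡 n) F'.An q (Y' q)) (φ p)
        (mfderiv (𝓡 n) (𝓡 n) φ p v)
      = T (ε p • mvfderiv (𝓡 n) (fun q => mvfderiv (𝓡 n) F.An q (Y q)) p v) := by
  have hG := mdifferentiableAt_mvfderiv_apply F.isOpen_dom F.mem_dom F.smooth_An hY
  have hG' := mdifferentiableAt_mvfderiv_apply F'.isOpen_dom F'.mem_dom F'.smooth_An hY'
  rw [mvfderiv_of_comp_eq (b := fun _ => 0) hG' (h.localDiffeo p h.mem)
    (mdiffAt_of_smoothOn h.isOpen h.smooth_ε h.mem) mdifferentiableAt_const hG hG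
    (by filter_upwards [hYY, h.isOpen.mem_nhds h.mem, eventually_eventually_nhds.2 hc]
          with r hr hrO hrc
        rw [zero_smul, add_zero, hr]
        exact h.mvfderiv_An_of_carriesPoints hrO hrc (Y r)), mvfderiv_const,
    mvfderiv_eq_zero_of_sq h.isOpen h.smooth_ε h.sq h.mem]
  congr 1
  have : (0 : TangentSpace (𝓡 n) p →L[ℝ] ℝ) v = 0 := rfl
  rw [this]
  module

/-- Vectors characterized by the projected derivatives correspond to each other. -/
lemma mfderiv_eq_of_proj (hX' : IsLightlikeHypersurface X') (hc : CarriesPoints X X' T φ p)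
    (hA : ∀ i, T (F.A i p) ∈ Submodule.span ℝ (Set.range fun i => F'.A i (φ p)))
    {Y : (q : M) → TangentSpace (𝓡 n) q} {Y' : (q : M') → TangentSpace (𝓡 n) q}
    (hY : MDifferentiableAt (𝓡 n) (𝓡 n).tangent (fun q => (⟨q, Y q⟩ : TangentBundle (𝓡 n) M)) p)
    (hY' : MDifferentiableAt (𝓡 n) (𝓡 n).tangent
      (fun q => (⟨q, Y' q⟩ : TangentBundle (𝓡 n) M')) (φ p))
    (hYY : ∀ᶠ q in 𝓝 p, Y' (φ q) = mfderiv (𝓡 n) (𝓡 n) φ q (Y q)) {v w : TangentSpace (𝓡 n) p}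
    {w' : TangentSpace (𝓡 n) (φ p)}
    (hw : mvfderiv (𝓡 n) F.An p w
      = F.proj p (mvfderiv (𝓡 n) (fun q => mvfderiv (𝓡 n) F.An q (Y q)) p v))
    (hw' : mvfderiv (𝓡 n) F'.An (φ p) w' = F'.proj (φ p)
      (mvfderiv (𝓡 n) (fun q => mvfderiv (𝓡 n) F'.An q (Y' q)) (φ p)
        (mfderiv (𝓡 n) (𝓡 n) φ p v))) :
    mfderiv (𝓡 n) (𝓡 n) φ p w = w' := by
  apply dAn_injective F'.mem_dom hX'
  rw [hw', h.mvfderiv_dAn hc hY hY' hYY,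
    h.proj_map hT h.mem (h.displacement_eq_zero h.mem hc.self_of_nhds) hA, map_smul, ← hw,
    h.mvfderiv_An_of_carriesPoints h.mem hc]

end IsTransport

end ConnectionComparison

/-! ### Independence of the reduced frame. -/

section InducedConnection

variable {n : ℕ} {M : Type u} [TopologicalSpace M] [ChartedSpace (EuclideanSpace ℝ (Fin n)) M]
  [IsManifold (𝓡 n) ∞ M] {X : M → ℙ ℝ (V n)} {p : M}

open AdaptedFrame

variable (hn : 2 ≤ n) (hX : IsLightlikeHypersurface X) (hrank : HasMaximalRank X)
include hn hX hrank

/-- The projected derivative does not depend on the frame adapted to the normalization. -/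
lemma dAn_eq_proj_of_isReduced {F F' : AdaptedFrame X p} (hF : F.IsReduced (zeta X))
    (hF' : F'.IsReduced (zeta X)) {Y : (q : M) → TangentSpace (𝓡 n) q}
    (hY : MDifferentiableAt (𝓡 n) (𝓡 n).tangent (fun q => (⟨q, Y q⟩ : TangentBundle (𝓡 n) M)) p)
    {v w : TangentSpace (𝓡 n) p}
    (hw : mvfderiv (𝓡 n) F.An p w
      = F.proj p (mvfderiv (𝓡 n) (fun q => mvfderiv (𝓡 n) F.An q (Y q)) p v)) :
    mvfderiv (𝓡 n) F'.An p w
      = F'.proj p (mvfderiv (𝓡 n) (fun q => mvfderiv (𝓡 n) F'.An q (Y q)) p v) := by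
  obtain ⟨O, ε, s, t, h⟩ := exists_isTransport_id hX F F'
  obtain ⟨r, hr⟩ := exists_dAn_eq_proj hX F'.mem_dom
  have hid : ∀ q : M, mfderiv (𝓡 n) (𝓡 n) (id : M → M) q = ContinuousLinearMap.id ℝ _ :=
    fun q => mfderiv_id
  have key := h.mfderiv_eq_of_proj isMotion_refl hX (carriesPoints_id X p)
    (fun i => by
      have := zeta_eq_span hn hX hrank hF' F'.mem_dom
      exact this ▸ hF p F.mem_dom i) hY hY
    (Filter.Eventually.of_forall fun q => by rw [hid]; rfl) hw
    (hr (mvfderiv (𝓡 n) (fun q => mvfderiv (𝓡 n) F'.An q (Y q)) p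
      (mfderiv (𝓡 n) (𝓡 n) (id : M → M) p v)))
  rw [hid] at key
  have key' : w = r (mvfderiv (𝓡 n) (fun q => mvfderiv (𝓡 n) F'.An q (Y q)) p v) := key
  rw [key', hr]

end InducedConnection

/-! ### Existence, torsion, smoothness and invariance of the connection. -/

section InducedConnectionProperties

variable {n : ℕ} {M : Type u} [TopologicalSpace M] [ChartedSpace (EuclideanSpace ℝ (Fin n)) M]
  [IsManifold (𝓡 n) ∞ M] {X : M → ℙ ℝ (V n)} {p : M}

open AdaptedFrame

/-- The projected derivatives along a choice of adapted frames form a covariant derivative. -/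
lemma exists_covariantDerivative (hX : IsLightlikeHypersurface X)
    (F : ∀ p, AdaptedFrame X p) :
    ∃ D : CovariantDerivative (𝓡 n) (EuclideanSpace ℝ (Fin n)) (TangentSpace (𝓡 n) : M → Type _),
      ∀ (p : M) (Y : (q : M) → TangentSpace (𝓡 n) q) (v : TangentSpace (𝓡 n) p),
        mvfderiv (𝓡 n) (F p).An p (D.toFun Y p v) = (F p).proj p
          (mvfderiv (𝓡 n) (fun q => mvfderiv (𝓡 n) (F p).An q (Y q)) p v) := by
  -- One frame is chosen per point with no coherence between them; the axioms of a covariant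
  -- derivative are pointwise, and smoothness comes later from independence of the frame.
  choose r hr using fun p => exists_dAn_eq_proj hX (F p).mem_dom
  let D : (Y : (q : M) → TangentSpace (𝓡 n) q) → (p : M) →
      TangentSpace (𝓡 n) p →L[ℝ] TangentSpace (𝓡 n) p := fun Y p =>
    (r p).comp (mvfderiv (𝓡 n) (fun q => mvfderiv (𝓡 n) (F p).An q (Y q)) p)
  have hD : ∀ p Y v, mvfderiv (𝓡 n) (F p).An p (D Y p v) = (F p).proj p
      (mvfderiv (𝓡 n) (fun q => mvfderiv (𝓡 n) (F p).An q (Y q)) p v) := fun p Y v => hr p _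
  refine ⟨⟨D, ⟨?_, ?_⟩⟩, hD⟩
  · intro Y Z p hY hZ _
    have h1 := mdifferentiableAt_mvfderiv_apply (F p).isOpen_dom (F p).mem_dom (F p).smooth_An hY
    have h2 := mdifferentiableAt_mvfderiv_apply (F p).isOpen_dom (F p).mem_dom (F p).smooth_An hZ
    ext1 v
    apply dAn_injective (F p).mem_dom hX
    have h3 : mvfderiv (𝓡 n) (fun q => mvfderiv (𝓡 n) (F p).An q ((Y + Z) q)) p v
        = mvfderiv (𝓡 n) (fun q => mvfderiv (𝓡 n) (F p).An q (Y q)) p v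
          + mvfderiv (𝓡 n) (fun q => mvfderiv (𝓡 n) (F p).An q (Z q)) p v := by
      rw [← mvfderiv_add_apply h1 h2]
      congr 2
      funext q
      exact map_add _ _ _
    refine (hD p (Y + Z) v).trans ?_
    rw [h3, map_add, ← hD, ← hD]
    exact (map_add (mvfderiv (𝓡 n) (F p).An p) (D Y p v) (D Z p v)).symm
  · intro Y g p hY hg _
    have h1 := mdifferentiableAt_mvfderiv_apply (F p).isOpen_dom (F p).mem_dom (F p).smooth_An hY
    ext1 v
    apply dAn_injective (F p).mem_dom hX
    have h3 : mvfderiv (𝓡 n) (fun q => mvfderiv (𝓡 n) (F p).An q ((g • Y) q)) p v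
        = mvfderiv (𝓡 n) g p v • mvfderiv (𝓡 n) (F p).An p (Y p)
          + g p • mvfderiv (𝓡 n) (fun q => mvfderiv (𝓡 n) (F p).An q (Y q)) p v := by
      rw [← mvfderiv_smul_apply hg h1]
      congr 2
      funext q
      exact map_smul (mvfderiv (𝓡 n) (F p).An q) (g q) (Y q)
    refine (hD p (g • Y) v).trans ?_
    rw [h3, map_add, map_smul, map_smul, ← hD, proj_dAn (F p).mem_dom, add_comm]
    refine Eq.symm ((map_add (mvfderiv (𝓡 n) (F p).An p) (g p • D Y p v)
      (mvfderiv (𝓡 n) g p v • Y p)).trans ?_)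
    exact congrArg₂ (· + ·) (map_smul _ _ _) (map_smul _ _ _)

/-- The induced connection, characterized by projected derivatives. -/
lemma isInducedConnection_iff {Z : M → Submodule ℝ (V n)}
    {D : CovariantDerivative (𝓡 n) (EuclideanSpace ℝ (Fin n))
      (TangentSpace (𝓡 n) : M → Type _)} :
    IsInducedConnection X Z D ↔ ∀ (p : M) (F : AdaptedFrame X p), F.IsReduced Z →
      ∀ Y : (q : M) → TangentSpace (𝓡 n) q,
        MDifferentiableAt (𝓡 n) (𝓡 n).tangent
          (fun q => (⟨q, Y q⟩ : TangentBundle (𝓡 n) M)) p →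
        ∀ v : TangentSpace (𝓡 n) p, mvfderiv (𝓡 n) F.An p (D.toFun Y p v)
          = F.proj p (mvfderiv (𝓡 n) (fun q => mvfderiv (𝓡 n) F.An q (Y q)) p v) :=
  forall_congr' fun _ => forall_congr' fun F => forall_congr' fun _ => forall_congr' fun _ =>
    forall_congr' fun hY => forall_congr' fun v => (dAn_eq_proj_iff F hY v _).symm

lemma exists_isInducedConnection (hn : 2 ≤ n) (hX : IsLightlikeHypersurface X)
    (hrank : HasMaximalRank X) (hred : ∀ p, ∃ F : AdaptedFrame X p, F.IsReduced (zeta X)) :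
    ∃ D : CovariantDerivative (𝓡 n) (EuclideanSpace ℝ (Fin n)) (TangentSpace (𝓡 n) : M → Type _),
      IsInducedConnection X (zeta X) D := by
  choose F hF using hred
  obtain ⟨D, hD⟩ := exists_covariantDerivative hX F
  exact ⟨D, isInducedConnection_iff.2 fun p F' hF' Y hY v =>
    dAn_eq_proj_of_isReduced hn hX hrank (hF p) hF' hY (hD p Y v)⟩

variable {Z : M → Submodule ℝ (V n)} {D : CovariantDerivative (𝓡 n) (EuclideanSpace ℝ (Fin n))
    (TangentSpace (𝓡 n) : M → Type _)}

/-- Projecting the commutator Y(dA_n(W)) - W(dA_n(Y)) = dA_n([Y, W]) changes nothing, since it is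
already tangent; the left side becomes dA_n(∇_YW - ∇_WY). -/
lemma IsInducedConnection.torsion_eq_zero (hX : IsLightlikeHypersurface X)
    (hred : ∀ p, ∃ F : AdaptedFrame X p, F.IsReduced Z) (hD : IsInducedConnection X Z D) :
    D.torsion = 0 := by
  rw [isInducedConnection_iff] at hD
  rw [CovariantDerivative.torsion_eq_zero_iff]
  intro Y W p hY hW
  obtain ⟨F, hF⟩ := hred p
  apply dAn_injective F.mem_dom hX
  rw [← mvfderiv_mlieBracket F.isOpen_dom F.mem_dom F.smooth_An hY hW]
  have h := map_sub (F.proj p)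
    (mvfderiv (𝓡 n) (fun q => mvfderiv (𝓡 n) F.An q (W q)) p (Y p))
    (mvfderiv (𝓡 n) (fun q => mvfderiv (𝓡 n) F.An q (Y q)) p (W p))
  rw [mvfderiv_mlieBracket F.isOpen_dom F.mem_dom F.smooth_An hY hW, proj_dAn F.mem_dom,
    ← hD p F hF W hW (Y p), ← hD p F hF Y hY (W p)] at h
  rw [mvfderiv_mlieBracket F.isOpen_dom F.mem_dom F.smooth_An hY hW, h]
  exact map_sub (mvfderiv (𝓡 n) F.An p) (D.toFun W p (Y p)) (D.toFun Y p (W p))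

/-- A single reduced frame computes ∇ on its whole domain, and there dA_n(∇_eY) is smooth for smooth
e; immersivity gives smoothness of ∇_eY. -/
lemma IsInducedConnection.contMDiff (hX : IsLightlikeHypersurface X)
    (hred : ∀ p, ∃ F : AdaptedFrame X p, F.IsReduced Z) (hD : IsInducedConnection X Z D) :
    CovariantDerivative.ContMDiffCovariantDerivative D ∞ := by
  rw [isInducedConnection_iff] at hD
  refine ⟨⟨fun {Y} hY p _ => ContMDiffAt.contMDiffWithinAt ?_⟩⟩
  obtain ⟨F, hF⟩ := hred p
  have hYs : ContMDiff (𝓡 n) (𝓡 n).tangent ∞ (fun q => (⟨q, Y q⟩ : TangentBundle (𝓡 n) M)) :=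
    contMDiffOn_univ.1 hY
  refine contMDiffAt_hom_of_apply F.isOpen_dom F.mem_dom fun O e hO hOF he => ?_
  have hG : ContMDiffOn (𝓡 n) 𝓘(ℝ, V n) ∞ (fun q => mvfderiv (𝓡 n) F.An q (Y q)) O :=
    (contMDiffOn_mvfderiv_apply F.isOpen_dom F.smooth_An hYs.contMDiffOn).mono hOF
  exact contMDiffOn_field_of_mvfderiv_eq hO (F.smooth_An.mono hOF)
    (contMDiffOn_proj hOF (contMDiffOn_mvfderiv_apply hO hG he))
    (fun q hq => dAn_injective (hOF hq) hX)
    fun q hq => hD q (F.moveTo (hOF hq)) (fun r hr => hF r hr) Y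
      ((hYs q).mdifferentiableAt (by simp)) (e q)

/-- The induced connection is invariant under motions and reparametrizations. -/
lemma IsInducedConnection.mfderiv_eq (hn : 2 ≤ n) (hX : IsLightlikeHypersurface X)
    (hrank : HasMaximalRank X) (ha : HasNondegenerateA X) (hD : IsInducedConnection X (zeta X) D)
    {M' : Type u} [TopologicalSpace M'] [ChartedSpace (EuclideanSpace ℝ (Fin n)) M']
    [IsManifold (𝓡 n) ∞ M'] {X' : M' → ℙ ℝ (V n)} (hX' : IsLightlikeHypersurface X')
    (hrank' : HasMaximalRank X') {D' : CovariantDerivative (𝓡 n) (EuclideanSpace ℝ (Fin n))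
      (TangentSpace (𝓡 n) : M' → Type _)} (hD' : IsInducedConnection X' (zeta X') D')
    {T : V n ≃ₗ[ℝ] V n} {φ : M → M'} (hT : IsMotion T)
    (hφ : IsLocalDiffeomorphAt (𝓡 n) (𝓡 n) ∞ φ p) (hc : CarriesPoints X X' T φ p)
    {Y : (q : M') → TangentSpace (𝓡 n) q}
    (hY : MDifferentiableAt (𝓡 n) (𝓡 n).tangent
      (fun q => (⟨q, Y q⟩ : TangentBundle (𝓡 n) M')) (φ p)) (v : TangentSpace (𝓡 n) p) :
    mfderiv (𝓡 n) (𝓡 n) φ p (D.toFun (VectorField.mpullback (𝓡 n) (𝓡 n) φ Y) p v)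
      = D'.toFun Y (φ p) (mfderiv (𝓡 n) (𝓡 n) φ p v) := by
  rw [isInducedConnection_iff] at hD hD'
  obtain ⟨F₀, L, hL, hd⟩ := ha p
  obtain ⟨F, hF⟩ := exists_isReduced hn hX hrank hL hd
  obtain ⟨F₁, -⟩ := hrank' (φ p)
  obtain ⟨O, ε, s, t, h₁⟩ := exists_isTransport hX hX' F F₁ hT hφ hc.carriesGenerators
  obtain ⟨Λ⟩ := nonempty_coeffs_of_hasMaximalRank hX hrank F
  obtain ⟨Λ₁⟩ := nonempty_coeffs_of_hasMaximalRank hX' hrank' F₁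
  -- A reduced frame of X' at φ(p) is obtained by transporting nondegeneracy of a_{ij} from X.
  obtain ⟨F', hF'⟩ := exists_isReduced hn hX' hrank' (Λ₁.isLambda _ F₁.mem_dom)
    (h₁.det_aTensor_ne_zero hT hn hX h₁.mem (F.isRegularAt hX hrank F.mem_dom)
      (Λ.isLambda p F.mem_dom) (Λ₁.isLambda _ F₁.mem_dom)
      (DeSitter.det_aTensor_ne_zero hn hX hrank ha F F.mem_dom (Λ.isLambda p F.mem_dom)))
  obtain ⟨O', ε', s', t', h⟩ := exists_isTransport hX hX' F F' hT hφ hc.carriesGenerators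
  obtain ⟨U, hU, hpU, hd⟩ := IsLocalDiffeomorphAt.exists_nhds hφ
  have hinv : ∀ q ∈ U, (mfderiv (𝓡 n) (𝓡 n) φ q).IsInvertible := fun q hq =>
    ⟨(hd q hq).mfderivToContinuousLinearEquiv (by simp), rfl⟩
  have hYp : MDifferentiableAt (𝓡 n) (𝓡 n).tangent
      (fun q => (⟨q, VectorField.mpullback (𝓡 n) (𝓡 n) φ Y q⟩ : TangentBundle (𝓡 n) M)) p :=
    MDifferentiableAt.mpullback_vectorField hY hφ.contMDiffAt (hinv p hpU) (by norm_cast)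
  refine h.mfderiv_eq_of_proj hT hX' hc (fun i => ?_) hYp hY ?_
    (hD p F hF _ hYp v) (hD' (φ p) F' hF' Y hY _)
  · have h1 := zeta_eq_span hn hX' hrank' hF' F'.mem_dom
    rw [← h1, zeta_eq_map hn hX hrank hX' hrank' hT hφ hc.carriesGenerators]
    exact Submodule.mem_map_of_mem (hF p F.mem_dom i)
  · filter_upwards [hU.mem_nhds hpU] with q hq
    exact ((hinv q hq).self_apply_inverse (Y (φ q))).symm

end InducedConnectionProperties

/-! ### Calculus of first-order jets. -/

section FirstOrderJets

variable {E F G H : Type*} [NormedAddCommGroup E] [NormedSpace ℝ E] [NormedAddCommGroup F]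
  [NormedSpace ℝ F] [NormedAddCommGroup G] [NormedSpace ℝ G] [NormedAddCommGroup H]
  [NormedSpace ℝ H] {a : E}

/-- `f` and `g` are differentiable and have the same first-order jet at `a`. -/
def SameJet (f g : E → F) (a : E) : Prop :=
  f a = g a ∧ ∃ A : E →L[ℝ] F, HasFDerivAt f A a ∧ HasFDerivAt g A a

namespace SameJet

lemma eq {f g : E → F} (h : SameJet f g a) : f a = g a := h.1

lemma fderiv_eq {f g : E → F} (h : SameJet f g a) : fderiv ℝ f a = fderiv ℝ g a := by
  obtain ⟨-, A, h1, h2⟩ := h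
  rw [h1.fderiv, h2.fderiv]

lemma of_fderiv_eq {f g : E → F} (hf : DifferentiableAt ℝ f a) (hg : DifferentiableAt ℝ g a)
    (h0 : f a = g a) (h1 : fderiv ℝ f a = fderiv ℝ g a) : SameJet f g a :=
  ⟨h0, _, hf.hasFDerivAt, h1 ▸ hg.hasFDerivAt⟩

lemma const (c : F) : SameJet (fun _ : E => c) (fun _ => c) a :=
  ⟨rfl, 0, hasFDerivAt_const c a, hasFDerivAt_const c a⟩

lemma comp {Φ : F → G} {f g : E → F} (h : SameJet f g a) (hΦ : DifferentiableAt ℝ Φ (f a)) :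
    SameJet (fun u => Φ (f u)) (fun u => Φ (g u)) a := by
  obtain ⟨h0, A, h1, h2⟩ := h
  refine ⟨congrArg Φ h0, _, hΦ.hasFDerivAt.comp a h1, ?_⟩
  rw [h0] at hΦ ⊢
  exact hΦ.hasFDerivAt.comp a h2

lemma clm_comp (L : F →L[ℝ] G) {f g : E → F} (h : SameJet f g a) :
    SameJet (fun u => L (f u)) (fun u => L (g u)) a := h.comp L.differentiableAt

lemma eval {f g : E → F →L[ℝ] G} (h : SameJet f g a) (v : F) :
    SameJet (fun u => f u v) (fun u => g u v) a :=
  h.clm_comp (ContinuousLinearMap.apply ℝ G v)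

lemma bilin (B : F →L[ℝ] G →L[ℝ] H) {f f' : E → F} {g g' : E → G} (hf : SameJet f f' a)
    (hg : SameJet g g' a) : SameJet (fun u => B (f u) (g u)) (fun u => B (f' u) (g' u)) a := by
  obtain ⟨h0, A, h1, h2⟩ := hf
  obtain ⟨k0, C, k1, k2⟩ := hg
  refine ⟨congrArg₂ (fun y z => B y z) h0 k0, _, B.hasFDerivAt_of_bilinear h1 k1, ?_⟩
  rw [h0, k0]
  exact B.hasFDerivAt_of_bilinear h2 k2

lemma mul {f f' g g' : E → ℝ} (hf : SameJet f f' a) (hg : SameJet g g' a) :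
    SameJet (fun u => f u * g u) (fun u => f' u * g' u) a :=
  hf.bilin (ContinuousLinearMap.mul ℝ ℝ) hg

lemma smul {f f' : E → ℝ} {g g' : E → F} (hf : SameJet f f' a) (hg : SameJet g g' a) :
    SameJet (fun u => f u • g u) (fun u => f' u • g' u) a :=
  hf.bilin (ContinuousLinearMap.lsmul ℝ ℝ) hg

lemma neg {f f' : E → F} (hf : SameJet f f' a) : SameJet (fun u => -f u) (fun u => -f' u) a :=
  hf.clm_comp (-ContinuousLinearMap.id ℝ F)

lemma sub {f f' g g' : E → F} (hf : SameJet f f' a) (hg : SameJet g g' a) :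
    SameJet (fun u => f u - g u) (fun u => f' u - g' u) a := by
  obtain ⟨h0, A, h1, h2⟩ := hf
  obtain ⟨k0, C, k1, k2⟩ := hg
  exact ⟨congrArg₂ (· - ·) h0 k0, A - C, h1.sub k1, h2.sub k2⟩

lemma sum {ι : Type*} (s : Finset ι) {f f' : ι → E → F} (h : ∀ i, SameJet (f i) (f' i) a) :
    SameJet (fun u => ∑ i ∈ s, f i u) (fun u => ∑ i ∈ s, f' i u) a := by
  choose h0 A h1 h2 using h
  exact ⟨Finset.sum_congr rfl fun i _ => h0 i, ∑ i ∈ s, A i,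
    HasFDerivAt.fun_sum fun i _ => h1 i, HasFDerivAt.fun_sum fun i _ => h2 i⟩

lemma pi {ι : Type*} [Fintype ι] {f f' : ι → E → F} (h : ∀ i, SameJet (f i) (f' i) a) :
    SameJet (fun u i => f i u) (fun u i => f' i u) a := by
  choose h0 A h1 h2 using h
  exact ⟨funext h0, ContinuousLinearMap.pi A, hasFDerivAt_pi.2 h1, hasFDerivAt_pi.2 h2⟩

lemma matrix_inv {ι : Type*} [Fintype ι] [DecidableEq ι] {A B : E → Matrix ι ι ℝ}
    (h : ∀ i j, SameJet (fun u => A u i j) (fun u => B u i j) a) (h0 : (A a).det ≠ 0) (i j) :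
    SameJet (fun u => (A u)⁻¹ i j) (fun u => (B u)⁻¹ i j) a := by
  have hdet : ∀ {C D : E → Matrix ι ι ℝ}, (∀ i j, SameJet (fun u => C u i j) (fun u => D u i j) a) →
      SameJet (fun u => (C u).det) (fun u => (D u).det) a := fun {C D} hCD =>
    (SameJet.pi fun i => SameJet.pi fun j => hCD i j).comp
      (contDiff_det.differentiable (by simp)).differentiableAt
  have h1 : SameJet (fun u => ((A u).det)⁻¹) (fun u => ((B u).det)⁻¹) a :=
    (hdet h).comp (differentiableAt_inv h0)
  have h2 : SameJet (fun u => (A u).adjugate i j) (fun u => (B u).adjugate i j) a := by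
    simp only [Matrix.adjugate_apply]
    refine hdet fun k l => ?_
    by_cases hk : k = j
    · subst hk
      simp only [Matrix.updateRow_self]
      exact const _
    · simp only [Matrix.updateRow_ne hk]
      exact h k l
  simp only [Matrix.inv_def, Ring.inverse_eq_inv', Matrix.smul_apply, smul_eq_mul]
  exact h1.mul h2

variable {n : ℕ}

/-- Fields with the same scalar products with a separating family have the same first-order jet. -/
lemma of_form {ι : Type*} {w w' : E → V n} (hw : DifferentiableAt ℝ w a)
    (hw' : DifferentiableAt ℝ w' a) {b b' : ι → E → V n} (hb : ∀ i, SameJet (b i) (b' i) a)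
    {f f' : ι → E → ℝ} (hf : ∀ i, SameJet (f i) (f' i) a)
    (h : ∀ i, ∀ᶠ u in 𝓝 a, form n (w u) (b i u) = f i u)
    (h' : ∀ i, ∀ᶠ u in 𝓝 a, form n (w' u) (b' i u) = f' i u)
    (hsep : ∀ z, (∀ i, form n z (b i a) = 0) → z = 0) : SameJet w w' a := by
  have h0 : w a = w' a := by
    refine sub_eq_zero.1 (hsep _ fun i => ?_)
    rw [map_sub, LinearMap.sub_apply, (h i).self_of_nhds, (hb i).eq, (h' i).self_of_nhds,
      (hf i).eq, sub_self]
  refine of_fderiv_eq hw hw' h0 ?_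
  ext1 v
  refine sub_eq_zero.1 (hsep _ fun i => ?_)
  obtain ⟨e0, A, hA, hA'⟩ := hb i
  obtain ⟨-, C, hC, hC'⟩ := hf i
  have h1 : HasFDerivAt (fun u => form n (w u) (b i u)) _ a :=
    (formL n).hasFDerivAt_of_bilinear hw.hasFDerivAt hA
  have h2 : HasFDerivAt (fun u => form n (w' u) (b' i u)) _ a :=
    (formL n).hasFDerivAt_of_bilinear hw'.hasFDerivAt hA'
  have h3 := DFunLike.congr_fun (h1.unique (hC.congr_of_eventuallyEq (h i))) v
  have h4 := DFunLike.congr_fun (h2.unique (hC'.congr_of_eventuallyEq (h' i))) v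
  have h3' : form n (w a) (A v) + form n (fderiv ℝ w a v) (b i a) = C v := h3
  have h4' : form n (w' a) (A v) + form n (fderiv ℝ w' a v) (b' i a) = C v := h4
  rw [← h0, ← e0] at h4'
  rw [map_sub, LinearMap.sub_apply]
  linarith

end SameJet

/-- Replaces a 3-jet by first-order jets of f, f' and f'', which obey product and chain rules. -/
lemma sameJet_of_iteratedFDeriv_eq {f g : E → F} (hf : ContDiffAt ℝ ∞ f a)
    (hg : ContDiffAt ℝ ∞ g a) (h : ∀ k ≤ 3, iteratedFDeriv ℝ k f a = iteratedFDeriv ℝ k g a) :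
    SameJet f g a ∧ SameJet (fderiv ℝ f) (fderiv ℝ g) a ∧
      SameJet (fderiv ℝ (fderiv ℝ f)) (fderiv ℝ (fderiv ℝ g)) a := by
  have e0 : f a = g a := by
    have := DFunLike.congr_fun (h 0 (by norm_num)) (fun _ => 0)
    simpa using this
  have e1 : fderiv ℝ f a = fderiv ℝ g a := by
    ext v
    have := DFunLike.congr_fun (h 1 (by norm_num)) (fun _ => v)
    simpa using this
  have e2 : fderiv ℝ (fderiv ℝ f) a = fderiv ℝ (fderiv ℝ g) a := by
    ext v w
    have := DFunLike.congr_fun (h 2 (by norm_num)) ![v, w]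
    simpa [iteratedFDeriv_two_apply] using this
  have e3 : fderiv ℝ (fderiv ℝ (fderiv ℝ f)) a = fderiv ℝ (fderiv ℝ (fderiv ℝ g)) a := by
    ext v w z
    have := DFunLike.congr_fun (h 3 le_rfl) ![v, w, z]
    simp only [iteratedFDeriv_succ_apply_right (n := 2), iteratedFDeriv_two_apply] at this
    exact this
  have d : ∀ {f : E → F}, ContDiffAt ℝ ∞ f a → ContDiffAt ℝ ∞ (fderiv ℝ f) a :=
    fun hf => hf.fderiv_right (m := ∞) (by norm_cast)
  have d' : ∀ {f : E → E →L[ℝ] F}, ContDiffAt ℝ ∞ f a → ContDiffAt ℝ ∞ (fderiv ℝ f) a :=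
    fun hf => hf.fderiv_right (m := ∞) (by norm_cast)
  refine ⟨.of_fderiv_eq (hf.differentiableAt (by simp)) (hg.differentiableAt (by simp)) e0 e1,
    .of_fderiv_eq ((d hf).differentiableAt (by simp)) ((d hg).differentiableAt (by simp)) e1 e2,
    .of_fderiv_eq ((d' (d hf)).differentiableAt (by simp))
      ((d' (d hg)).differentiableAt (by simp)) e2 e3⟩

end FirstOrderJets

/-! ### The harmonic pole in a parametrization, and how jets determine it. -/

section LocalPole

variable {E : Type*} [NormedAddCommGroup E] [NormedSpace ℝ E] {n : ℕ} {a : E}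

/-- The Gram matrix of the derivatives of `y` along the vectors `e`. -/
noncomputable def gramMatrix (e : Fin (n - 1) → E) (y : E → V n) (u : E) :
    Matrix (Fin (n - 1)) (Fin (n - 1)) ℝ :=
  Matrix.of fun i j => form n (fderiv ℝ y u (e i)) (fderiv ℝ y u (e j))

/-- The harmonic pole, expressed by a parametrization `x` of the hypersurface, the corresponding
points `y` of tangency with the absolute, and vectors `e` transversal to the generator. -/
noncomputable def localPole (e : Fin (n - 1) → E) (x y : E → V n) (u : E) : V n :=
  x u - (1 / ((n : ℝ) - 1) * ∑ i, ∑ j, form n (fderiv ℝ x u (e i)) (fderiv ℝ y u (e j))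
    * (gramMatrix e y u)⁻¹ i j) • y u

/-- The expression contains only x, y and their first derivatives, so 1-jets of these suffice. -/
lemma sameJet_localPole {e : Fin (n - 1) → E} {x y x' y' : E → V n} (hx : SameJet x x' a)
    (hdx : SameJet (fderiv ℝ x) (fderiv ℝ x') a) (hy : SameJet y y' a)
    (hdy : ∀ v, SameJet (fun u => fderiv ℝ y u v) (fun u => fderiv ℝ y' u v) a)
    (h0 : (gramMatrix e y a).det ≠ 0) :
    SameJet (localPole e x y) (localPole e x' y') a := by
  have hG : ∀ i j, SameJet (fun u => gramMatrix e y u i j) (fun u => gramMatrix e y' u i j) a :=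
    fun i j => (hdy (e i)).bilin (formL n) (hdy (e j))
  refine hx.sub (SameJet.smul (.mul (.const _) (.sum _ fun i => .sum _ fun j => .mul ?_ ?_)) hy)
  · exact (hdx.eval (e i)).bilin (formL n) (hdy (e j))
  · exact .matrix_inv hG h0 i j

/-- The second-order jet of the pole of the tangent hyperplane is determined by the third-order jet
of the hypersurface. -/
lemma sameJet_pole {x y x' y' : E → V n} {c : V n} (hx : ContDiffAt ℝ ∞ x a)
    (hx' : ContDiffAt ℝ ∞ x' a) (hy : ContDiffAt ℝ ∞ y a) (hy' : ContDiffAt ℝ ∞ y' a)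
    (h : SameJet x x' a) (hd : SameJet (fderiv ℝ x) (fderiv ℝ x') a)
    (hdd : SameJet (fderiv ℝ (fderiv ℝ x)) (fderiv ℝ (fderiv ℝ x')) a)
    (h1 : ∀ᶠ u in 𝓝 a, form n (y u) (x u) = 0 ∧ (∀ v, form n (y u) (fderiv ℝ x u v) = 0) ∧
      form n (y u) c = -1)
    (h1' : ∀ᶠ u in 𝓝 a, form n (y' u) (x' u) = 0 ∧ (∀ v, form n (y' u) (fderiv ℝ x' u v) = 0) ∧
      form n (y' u) c = -1)
    (hsep : ∀ z, form n z (x a) = 0 → (∀ v, form n z (fderiv ℝ x a v) = 0) → form n z c = 0 →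
      z = 0) :
    SameJet y y' a ∧ ∀ v, SameJet (fun u => fderiv ℝ y u v) (fun u => fderiv ℝ y' u v) a := by
  -- The separating family: x, the normalizing vector c, and all derivatives of x. The scalar
  -- products of y with it are 0, -1, 0.
  let b : (E → V n) → Option (Option E) → E → V n := fun x k => match k with
    | none => x
    | some none => fun _ => c
    | some (some v) => fun u => fderiv ℝ x u v
  have hb : ∀ k, SameJet (b x k) (b x' k) a := by
    rintro (_ | _ | v)
    · exact h
    · exact .const c
    · exact hd.eval v
  have hs : ∀ z, (∀ k, form n z (b x k a) = 0) → z = 0 := fun z hz =>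
    hsep z (hz none) (fun v => hz (some (some v))) (hz (some none))
  let f : Option (Option E) → E → ℝ := fun k => match k with
    | none => fun _ => 0
    | some none => fun _ => -1
    | some (some v) => fun _ => 0
  have hf : ∀ k, SameJet (f k) (f k) a := by
    rintro (_ | _ | v) <;> exact .const _
  have e1 : ∀ {x y : E → V n}, (∀ᶠ u in 𝓝 a, form n (y u) (x u) = 0 ∧
      (∀ v, form n (y u) (fderiv ℝ x u v) = 0) ∧ form n (y u) c = -1) →
      ∀ k, ∀ᶠ u in 𝓝 a, form n (y u) (b x k u) = f k u := by
    intro x y h1 k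
    filter_upwards [h1] with u hu
    rcases k with _ | _ | v
    exacts [hu.1, hu.2.2, hu.2.1 v]
  have hyy : SameJet y y' a := .of_form (hy.differentiableAt (by simp))
    (hy'.differentiableAt (by simp)) hb hf (e1 h1) (e1 h1') hs
  refine ⟨hyy, fun w => ?_⟩
  -- Differentiating those three equations along w gives the scalar products of dy(w) with the same
  -- family; the last one is -(y, ∂_w∂_v x), whose 1-jet uses third derivatives of x.
  let g : (E → V n) → (E → V n) → Option (Option E) → E → ℝ := fun x y k => match k with
    | none => fun _ => 0
    | some none => fun _ => 0
    | some (some v) => fun u => -form n (y u) (fderiv ℝ (fderiv ℝ x) u w v)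
  have hg : ∀ k, SameJet (g x y k) (g x' y' k) a := by
    rintro (_ | _ | v)
    · exact .const _
    · exact .const _
    · exact (hyy.bilin (formL n) ((hdd.eval w).eval v)).neg
  have e2 : ∀ {x y : E → V n}, ContDiffAt ℝ ∞ x a → ContDiffAt ℝ ∞ y a →
      (∀ᶠ u in 𝓝 a, form n (y u) (x u) = 0 ∧
      (∀ v, form n (y u) (fderiv ℝ x u v) = 0) ∧ form n (y u) c = -1) →
      ∀ k, ∀ᶠ u in 𝓝 a, form n (fderiv ℝ y u w) (b x k u) = g x y k u := by
    intro x y hx hy h1 k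
    have hx2 := (hx.of_le (m := 2) (by norm_cast)).eventually (by simp)
    have hy2 := (hy.of_le (m := 1) (by norm_cast)).eventually (by simp)
    filter_upwards [h1.eventually_nhds, hx2, hy2] with u hu hxu hyu
    have dy := (hyu.differentiableAt (by simp)).hasFDerivAt
    have dx := (hxu.differentiableAt (by simp)).hasFDerivAt
    have ddx := ((hxu.fderiv_right (m := 1) (by norm_cast)).differentiableAt (by simp)).hasFDerivAt
    have key : ∀ {z : E → V n} {A : E →L[ℝ] V n} (r : ℝ), HasFDerivAt z A u →
        (∀ᶠ u in 𝓝 u, form n (y u) (z u) = r) →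
        form n (y u) (A w) + form n (fderiv ℝ y u w) (z u) = 0 := by
      intro z A r hz hr
      have k1 : HasFDerivAt (fun u => form n (y u) (z u)) _ u :=
        (formL n).hasFDerivAt_of_bilinear dy hz
      exact DFunLike.congr_fun (k1.unique ((hasFDerivAt_const r u).congr_of_eventuallyEq hr)) w
    rcases k with _ | _ | v
    · have h2 := key 0 dx (hu.mono fun _ h => h.1)
      have h3 := hu.self_of_nhds.2.1 w
      change form n (fderiv ℝ y u w) (x u) = 0
      linarith
    · have h2 := key (-1) (hasFDerivAt_const c u) (hu.mono fun _ h => h.2.2)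
      simpa using h2
    · have h2 := key 0 ((ContinuousLinearMap.apply ℝ (V n) v).hasFDerivAt.comp u ddx)
        (hu.mono fun _ h => h.2.1 v)
      change form n (fderiv ℝ y u w) (fderiv ℝ x u v)
        = -form n (y u) (fderiv ℝ (fderiv ℝ x) u w v)
      have h3 : form n (y u) (fderiv ℝ (fderiv ℝ x) u w v)
        + form n (fderiv ℝ y u w) (fderiv ℝ x u v) = 0 := h2
      linarith
  have hdiff : ∀ {y : E → V n}, ContDiffAt ℝ ∞ y a → DifferentiableAt ℝ (fun u => fderiv ℝ y u w) a :=
    fun hy => ((hy.fderiv_right (m := 1) (by norm_cast)).differentiableAt (by simp)).clm_apply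
      (differentiableAt_const w)
  exact .of_form (hdiff hy) (hdiff hy') hb hg (e2 hx hy h1) (e2 hx' hy' h1') hs

end LocalPole

/-! ### The mean value λ from a rescaled pole and arbitrary transversal vectors. -/

section FrameJets

variable {n : ℕ} {M : Type u} [TopologicalSpace M] [ChartedSpace (EuclideanSpace ℝ (Fin n)) M]
  {X : M → ℙ ℝ (V n)} {p : M}

namespace AdaptedFrame

/-- The frame with the point `A_n` represented by a given lift. -/
def withLift (F : AdaptedFrame X p) {O : Set M} {x : M → V n} (hx : IsLift X O x) (hp : p ∈ O) :
    AdaptedFrame X p where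
  dom := F.dom ∩ O
  isOpen_dom := F.isOpen_dom.inter hx.isOpen
  mem_dom := ⟨F.mem_dom, hp⟩
  A0 := F.A0
  A := F.A
  An := x
  Ainf := F.Ainf
  smooth_A0 := F.smooth_A0.mono Set.inter_subset_left
  smooth_A i := (F.smooth_A i).mono Set.inter_subset_left
  isLift_An := ⟨F.isOpen_dom.inter hx.isOpen, hx.smooth.mono Set.inter_subset_right,
    fun q hq => hx.normalized q hq.2, fun q hq => hx.represents q hq.2⟩
  smooth_Ainf := F.smooth_Ainf.mono Set.inter_subset_left
  form_A0_A0 q hq := F.form_A0_A0 q hq.1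
  form_A0_A q hq := F.form_A0_A q hq.1
  form_A0_An q hq := by
    rw [(F.isLift_An.eq_smul hx hq.1 hq.2).1, map_smul, F.form_A0_An q hq.1, smul_zero]
  form_A0_Ainf q hq := F.form_A0_Ainf q hq.1
  form_A_An q hq i := by
    rw [(F.isLift_An.eq_smul hx hq.1 hq.2).1, map_smul, F.form_A_An q hq.1, smul_zero]
  form_A_Ainf q hq := F.form_A_Ainf q hq.1
  form_An_Ainf q hq := by
    rw [(F.isLift_An.eq_smul hx hq.1 hq.2).1, map_smul, LinearMap.smul_apply,
      F.form_An_Ainf q hq.1, smul_zero]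
  form_Ainf_Ainf q hq := F.form_Ainf_Ainf q hq.1
  linearIndependent_A q hq := F.linearIndependent_A q hq.1
  tangent q hq v := by
    rw [F.isLift_An.mvfderiv_eq_smul hx hq.1 hq.2, map_smul, LinearMap.smul_apply,
      F.tangent q hq.1, smul_zero]

variable {F : AdaptedFrame X p} {q : M}

lemma form_comb (hq : q ∈ F.dom) (z : V n) {z' : V n} (h0 : form n z (F.A0 q) = 0)
    (h0' : form n z' (F.A0 q) = 0) (hn : form n z' (F.An q) = 0) :
    form n z z' = ∑ i, ∑ j, form n z (F.A i q) * (F.g q)⁻¹ i j * form n z' (F.A j q) := by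
  have h := expand hq z'
  rw [coeffn, coeffInf, h0', hn] at h
  rw [congrArg (form n z) h]
  simp only [neg_zero, zero_smul, add_zero, map_add, map_smul, map_sum, h0, mul_zero, zero_add,
    smul_eq_mul]
  refine Finset.sum_congr rfl fun i _ => ?_
  rw [coeff, Finset.sum_mul]
  exact Finset.sum_congr rfl fun j _ => by ring

/-- The mean value `λ`, expressed by the derivatives of a rescaled pole along vectors transversal to
the generator. -/
lemma sum_form_mul_inv (hq : q ∈ F.dom) {L : Matrix (Fin (n - 1)) (Fin (n - 1)) ℝ}
    (hL : F.IsLambda q L) {s : ℝ} (hs : s ≠ 0) {c : Fin (n - 1) → ℝ}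
    {w : Fin (n - 1) → TangentSpace (𝓡 n) q} {y : Fin (n - 1) → V n}
    (hy : ∀ i, y i = c i • F.A0 q + s • mvfderiv (𝓡 n) F.A0 q (w i))
    (hd : (Matrix.of fun i j => form n (y i) (y j)).det ≠ 0) :
    -(1 / ((n : ℝ) - 1) * ∑ i, ∑ j, form n (mvfderiv (𝓡 n) F.An q (w i)) (y j)
      * (Matrix.of fun i j => form n (y i) (y j))⁻¹ i j) * s = F.meanLambda q L := by
  set G := Matrix.of fun i j => form n (y i) (y j) with hG
  let Y : Matrix (Fin (n - 1)) (Fin (n - 1)) ℝ := Matrix.of fun i j => F.yMap q (w i) j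
  let N : Matrix (Fin (n - 1)) (Fin (n - 1)) ℝ := Matrix.of fun i j => F.nMap q (w i) j
  let H : Matrix (Fin (n - 1)) (Fin (n - 1)) ℝ :=
    Matrix.of fun i j => form n (mvfderiv (𝓡 n) F.An q (w i)) (y j)
  have y0 : ∀ i, form n (y i) (F.A0 q) = 0 := fun i => by
    rw [hy, map_add, map_smul, map_smul, LinearMap.add_apply, LinearMap.smul_apply,
      LinearMap.smul_apply, F.form_A0_A0 q hq, form_dA0_A0 hq, smul_zero, smul_zero, add_zero]
  have yn : ∀ i, form n (y i) (F.An q) = 0 := fun i => by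
    rw [hy, map_add, map_smul, map_smul, LinearMap.add_apply, LinearMap.smul_apply,
      LinearMap.smul_apply, F.form_A0_An q hq, form_dA0_An hq, smul_zero, smul_zero, add_zero]
  have yA : ∀ i k, form n (y i) (F.A k q) = s * Y i k := fun i k => by
    rw [hy, map_add, map_smul, map_smul, LinearMap.add_apply, LinearMap.smul_apply,
      LinearMap.smul_apply, F.form_A0_A q hq, smul_zero, zero_add]
    rfl
  -- The multiples of A_0 in the y_i are invisible to all products involved, so everything is
  -- expressed by the matrices Y, N of (dA_0, A_j) and (dA_n, A_j).
  have hGY : G = s ^ 2 • (Y * (F.g q)⁻¹ * Y.transpose) := by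
    ext i j
    rw [hG, Matrix.of_apply, form_comb hq _ (y0 i) (y0 j) (yn j), Finset.sum_comm]
    simp only [yA, Matrix.smul_apply, Matrix.mul_apply, Matrix.transpose_apply, smul_eq_mul,
      Finset.mul_sum, Finset.sum_mul]
    exact Finset.sum_congr rfl fun k _ => Finset.sum_congr rfl fun l _ => by ring
  have hHY : H = s • (N * (F.g q)⁻¹ * Y.transpose) := by
    ext i j
    change form n (mvfderiv (𝓡 n) F.An q (w i)) (y j) = _
    rw [form_comb hq _ (F.tangent q hq _) (y0 j) (yn j), Finset.sum_comm]
    simp only [yA, Matrix.smul_apply, Matrix.mul_apply, Matrix.transpose_apply, smul_eq_mul,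
      Finset.mul_sum, Finset.sum_mul]
    exact Finset.sum_congr rfl fun k _ => Finset.sum_congr rfl fun l _ => by
      rw [← nMap_apply]; change _ = s * (F.nMap q (w i) l * _ * _); ring
  have hNY : N = -(Y * (F.g q)⁻¹ * L.transpose) := by
    ext i j
    have h1 := congrFun ((isLambda_iff hq).1 hL (w i)) j
    change F.nMap q (w i) j = _
    rw [h1, Pi.neg_apply, Matrix.neg_apply, Matrix.mul_assoc, ← g_transpose (F := F),
      ← Matrix.transpose_nonsing_inv, ← Matrix.transpose_mul, Matrix.transpose_nonsing_inv,
      g_transpose, Matrix.mulVec, dotProduct, Matrix.mul_apply]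
    congr 1
    exact Finset.sum_congr rfl fun k _ => by rw [Matrix.transpose_apply, mul_comm]; rfl
  have hYd : IsUnit Y.det := by
    rw [isUnit_iff_ne_zero]
    intro h0
    rw [hGY, Matrix.det_smul, Matrix.det_mul, Matrix.det_mul, h0] at hd
    simp at hd
  have hGs : G.transpose = G := by
    ext i j
    exact form_symm _ _
  have hinv : G⁻¹ = (s ^ 2)⁻¹ • (Y⁻¹.transpose * F.g q * Y⁻¹) := by
    refine Matrix.inv_eq_right_inv ?_
    rw [hGY, Matrix.smul_mul, Matrix.mul_smul, smul_smul, mul_inv_cancel₀ (pow_ne_zero 2 hs),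
      one_smul]
    calc Y * (F.g q)⁻¹ * Y.transpose * (Y⁻¹.transpose * F.g q * Y⁻¹)
        = Y * ((F.g q)⁻¹ * (Y⁻¹ * Y).transpose * F.g q) * Y⁻¹ := by
          simp only [Matrix.transpose_mul, Matrix.mul_assoc]
      _ = 1 := by
          rw [Matrix.nonsing_inv_mul _ hYd, Matrix.transpose_one, mul_one, ginv_mul hq, mul_one,
            Matrix.mul_nonsing_inv _ hYd]
  have htr : ∑ i, ∑ j, form n (mvfderiv (𝓡 n) F.An q (w i)) (y j) * G⁻¹ i j
      = (H * G⁻¹).trace := by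
    have hs : ∀ i j, G⁻¹ i j = G⁻¹ j i := fun i j => by
      conv_lhs => rw [← hGs, ← Matrix.transpose_nonsing_inv, Matrix.transpose_apply]
    simp only [Matrix.trace, Matrix.diag, Matrix.mul_apply]
    exact Finset.sum_congr rfl fun i _ => Finset.sum_congr rfl fun j _ => by rw [hs i j]; rfl
  have hval : (H * G⁻¹).trace = -s⁻¹ * (L * (F.g q)⁻¹).trace := by
    -- The choice of transversal vectors enters only through conjugation by Y, which the trace
    -- forgets.
    have h1 : H * G⁻¹ = -s⁻¹ • (Y * ((F.g q)⁻¹ * L.transpose) * Y⁻¹) := by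
      rw [hHY, hinv, hNY]
      simp only [Matrix.smul_mul, Matrix.mul_smul, smul_smul, Matrix.neg_mul, neg_smul, smul_neg]
      congr 2
      · field_simp
      · calc Y * (F.g q)⁻¹ * L.transpose * (F.g q)⁻¹ * Y.transpose * (Y⁻¹.transpose * F.g q * Y⁻¹)
            = Y * (F.g q)⁻¹ * L.transpose * ((F.g q)⁻¹ * (Y⁻¹ * Y).transpose * F.g q) * Y⁻¹ := by
              simp only [Matrix.transpose_mul, Matrix.mul_assoc]
          _ = _ := by
              rw [Matrix.nonsing_inv_mul _ hYd, Matrix.transpose_one, mul_one, ginv_mul hq,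
                mul_one]
              simp only [Matrix.mul_assoc]
    rw [h1, Matrix.trace_smul, smul_eq_mul, Matrix.trace_mul_cycle, Matrix.nonsing_inv_mul _ hYd,
      one_mul, ← Matrix.trace_transpose, Matrix.transpose_mul, Matrix.transpose_transpose,
      Matrix.transpose_nonsing_inv, g_transpose]
  rw [htr, hval, AdaptedFrame.meanLambda_eq]
  field_simp

end AdaptedFrame

end FrameJets

/-! ### Dependence of ζ on the third-order jet. -/

section ThirdOrder

variable {n : ℕ} {M : Type u} [TopologicalSpace M] [ChartedSpace (EuclideanSpace ℝ (Fin n)) M]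
  {X : M → ℙ ℝ (V n)} {p : M}

/-- The derivative of a parametrization of the manifold. -/
noncomputable def paramDeriv (ψ : EuclideanSpace ℝ (Fin n) → M) (u : EuclideanSpace ℝ (Fin n)) :
    EuclideanSpace ℝ (Fin n) →L[ℝ] TangentSpace (𝓡 n) (ψ u) :=
  mfderiv (𝓡 n) (𝓡 n) ψ u

lemma hasFDerivAt_comp_of_mdifferentiableAt {W : Type*} [NormedAddCommGroup W] [NormedSpace ℝ W]
    {ψ : EuclideanSpace ℝ (Fin n) → M} {u : EuclideanSpace ℝ (Fin n)} {f : M → W}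
    (hf : MDifferentiableAt (𝓡 n) 𝓘(ℝ, W) f (ψ u)) (hψ : MDifferentiableAt (𝓡 n) (𝓡 n) ψ u) :
    HasFDerivAt (f ∘ ψ) ((mvfderiv (𝓡 n) f (ψ u)).comp (paramDeriv ψ u)) u := by
  refine hasMFDerivAt_iff_hasFDerivAt.1 ?_
  exact HasMFDerivAt.comp u (hasMFDerivAt_mvfderiv hf) hψ.hasMFDerivAt

namespace AdaptedFrame

variable (F : AdaptedFrame X p) (c : V n) (ψ : EuclideanSpace ℝ (Fin n) → M)
  (u : EuclideanSpace ℝ (Fin n))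

/-- The pole `A_0`, normalized by `(A_0, c) = -1`. -/
noncomputable def normalizedPole (q : M) : V n := (-(form n (F.A0 q) c)⁻¹) • F.A0 q

/-- `ψ` is, at `u`, a regular parametrization of the domain of `F`, where `A_0` can be normalized
by its scalar product with `c`. -/
structure IsParametrizedAt : Prop where
  smooth : ContMDiffAt (𝓡 n) (𝓡 n) ∞ ψ u
  surjective : Function.Surjective (paramDeriv ψ u)
  mem : ψ u ∈ F.dom
  ne_zero : form n (F.A0 (ψ u)) c ≠ 0

variable {F c ψ u}

namespace IsParametrizedAt

variable (h : F.IsParametrizedAt c ψ u)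
include h

lemma mdifferentiableAt : MDifferentiableAt (𝓡 n) (𝓡 n) ψ u := h.smooth.mdifferentiableAt (by simp)

lemma contDiffAt_comp {f : M → V n} (hf : ContMDiffOn (𝓡 n) 𝓘(ℝ, V n) ∞ f F.dom) :
    ContDiffAt ℝ ∞ (f ∘ ψ) u :=
  ((hf.contMDiffAt (F.isOpen_dom.mem_nhds h.mem)).comp u h.smooth).contDiffAt

lemma contDiffAt_pole : ContDiffAt ℝ ∞ (F.normalizedPole c ∘ ψ) u := by
  have h0 := h.contDiffAt_comp F.smooth_A0
  have h1 : ContDiffAt ℝ ∞ (fun u => form n ((F.A0 ∘ ψ) u) c) u :=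
    ((formL n).flip c).contDiff.contDiffAt.comp u h0
  exact (h1.inv h.ne_zero).neg.smul h0

lemma fderiv_An (e : EuclideanSpace ℝ (Fin n)) : fderiv ℝ (F.An ∘ ψ) u e
    = mvfderiv (𝓡 n) F.An (ψ u) (paramDeriv ψ u e) := by
  rw [(hasFDerivAt_comp_of_mdifferentiableAt (mdiff_An h.mem) h.mdifferentiableAt).fderiv]
  rfl

/-- The coefficient at A_0, coming from the derivative of the normalizing factor, never matters and
is left unspecified. -/
lemma fderiv_pole : ∃ b : EuclideanSpace ℝ (Fin n) → ℝ, ∀ e,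
    fderiv ℝ (F.normalizedPole c ∘ ψ) u e = b e • F.A0 (ψ u) + (-(form n (F.A0 (ψ u)) c)⁻¹)
      • mvfderiv (𝓡 n) F.A0 (ψ u) (paramDeriv ψ u e) := by
  have h0 := hasFDerivAt_comp_of_mdifferentiableAt (mdiff_A0 h.mem) h.mdifferentiableAt
  have h1 : DifferentiableAt ℝ (fun u => form n ((F.A0 ∘ ψ) u) c) u :=
    ((formL n).flip c).differentiableAt.comp u h0.differentiableAt
  have h2 : DifferentiableAt ℝ (fun u => -(form n ((F.A0 ∘ ψ) u) c)⁻¹) u :=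
    (h1.inv h.ne_zero).neg
  have h3 : HasFDerivAt (F.normalizedPole c ∘ ψ) _ u := h2.hasFDerivAt.smul h0
  refine ⟨fderiv ℝ (fun u => -(form n ((F.A0 ∘ ψ) u) c)⁻¹) u, fun e => ?_⟩
  rw [h3.fderiv]
  exact add_comm (-(form n (F.A0 (ψ u)) c)⁻¹ • mvfderiv (𝓡 n) F.A0 (ψ u) (paramDeriv ψ u e)) _

lemma pole_conditions : form n ((F.normalizedPole c ∘ ψ) u) ((F.An ∘ ψ) u) = 0 ∧
    (∀ v, form n ((F.normalizedPole c ∘ ψ) u) (fderiv ℝ (F.An ∘ ψ) u v) = 0) ∧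
      form n ((F.normalizedPole c ∘ ψ) u) c = -1 := by
  simp only [Function.comp_apply, normalizedPole, map_smul, LinearMap.smul_apply, smul_eq_mul]
  refine ⟨by rw [F.form_A0_An _ h.mem, mul_zero], fun v => ?_, ?_⟩
  · rw [h.fderiv_An, form_symm (F.A0 (ψ u)) (mvfderiv _ _ _ _), F.tangent _ h.mem, mul_zero]
  · rw [neg_mul, inv_mul_cancel₀ h.ne_zero]

lemma eq_zero_of_orthogonal (hX : IsLightlikeHypersurface X) {z : V n}
    (h0 : form n z ((F.An ∘ ψ) u) = 0) (h1 : ∀ v, form n z (fderiv ℝ (F.An ∘ ψ) u v) = 0)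
    (h2 : form n z c = 0) : z = 0 := by
  have hz := eq_smul_A0_of_tangent h.mem hX h0 fun w => by
    obtain ⟨v, rfl⟩ := h.surjective w
    rw [← h.fderiv_An]
    exact h1 v
  rw [hz, map_smul, LinearMap.smul_apply, smul_eq_mul] at h2
  rw [hz, (mul_eq_zero.1 h2).resolve_right h.ne_zero, zero_smul]

lemma localPole_eq {Λ : F.Coeffs} {e : Fin (n - 1) → EuclideanSpace ℝ (Fin n)}
    (hd : (gramMatrix e (F.normalizedPole c ∘ ψ) u).det ≠ 0) :
    localPole e (F.An ∘ ψ) (F.normalizedPole c ∘ ψ) u = Λ.harmonicPole (ψ u) := by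
  obtain ⟨b, hb⟩ := h.fderiv_pole
  have key := sum_form_mul_inv h.mem (Λ.isLambda _ h.mem) (s := -(form n (F.A0 (ψ u)) c)⁻¹)
    (neg_ne_zero.2 (inv_ne_zero h.ne_zero)) (c := fun i => b (e i))
    (w := fun i => paramDeriv ψ u (e i))
    (y := fun i => fderiv ℝ (F.normalizedPole c ∘ ψ) u (e i)) (fun i => hb (e i)) hd
  rw [localPole, Coeffs.harmonicPole, ← key, sub_eq_add_neg, ← neg_smul]
  simp only [h.fderiv_An, mul_smul]
  rfl

/-- Choose directions along which dA_0 equals A_i modulo A_0; the Gram matrix is then a multiple of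
g. -/
lemma exists_gramMatrix (hX : IsLightlikeHypersurface X) (hr : F.IsRegularAt (ψ u)) :
    ∃ e, (gramMatrix e (F.normalizedPole c ∘ ψ) u).det ≠ 0 := by
  obtain ⟨b, hb⟩ := h.fderiv_pole
  choose w hw using fun i => yMap_surjective h.mem hX hr (F.g (ψ u) i)
  choose e he using fun i => h.surjective (w i)
  set s := -(form n (F.A0 (ψ u)) c)⁻¹ with hs
  have hs0 : s ≠ 0 := neg_ne_zero.2 (inv_ne_zero h.ne_zero)
  have h1 : ∀ i, mvfderiv (𝓡 n) F.A0 (ψ u) (w i)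
      = F.omega00 (ψ u) (w i) • F.A0 (ψ u) + F.A i (ψ u) := by
    intro i
    rw [dA0_eq h.mem]
    congr 1
    have h2 : ∀ j, F.omega0I (ψ u) j (w i) = (1 : Matrix (Fin (n - 1)) (Fin (n - 1)) ℝ) j i := by
      intro j
      rw [omega0I_eq, hw, ← ginv_mul h.mem, Matrix.mulVec, dotProduct, Matrix.mul_apply]
      exact Finset.sum_congr rfl fun k _ => by
        rw [← Matrix.transpose_apply (F.g (ψ u)) k i, g_transpose]
    simp only [h2, Matrix.one_apply, ite_smul, one_smul, zero_smul, Finset.sum_ite_eq',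
      Finset.mem_univ, if_true]
  have h2 : gramMatrix e (F.normalizedPole c ∘ ψ) u = s ^ 2 • F.g (ψ u) := by
    ext i j
    rw [gramMatrix, Matrix.of_apply, hb, hb, he, he, h1, h1, Matrix.smul_apply, g_apply]
    simp only [map_add, map_smul, LinearMap.add_apply, LinearMap.smul_apply, smul_eq_mul,
      F.form_A0_A0 _ h.mem, F.form_A0_A _ h.mem, form_A_A0 h.mem]
    ring
  refine ⟨e, ?_⟩
  rw [h2, Matrix.det_smul]
  exact mul_ne_zero (pow_ne_zero _ (pow_ne_zero 2 hs0)) (isUnit_det_g h.mem).ne_zero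

end IsParametrizedAt

/-- The Gram determinant stays nonzero nearby, so the local expression is C∘ψ on a neighbourhood,
and dψ is onto. -/
lemma range_fderiv_localPole (hψ : ∀ᶠ u in 𝓝 u, F.IsParametrizedAt c ψ u) (hp : ψ u = p)
    {Λ : F.Coeffs} {e : Fin (n - 1) → EuclideanSpace ℝ (Fin n)}
    (hd : (gramMatrix e (F.normalizedPole c ∘ ψ) u).det ≠ 0) :
    LinearMap.range (fderiv ℝ (localPole e (F.An ∘ ψ) (F.normalizedPole c ∘ ψ)) u).toLinearMap
      = LinearMap.range (mvfderiv (𝓡 n) Λ.harmonicPole p).toLinearMap := by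
  subst hp
  have h := hψ.self_of_nhds
  have hdc : ContinuousAt (fderiv ℝ (F.normalizedPole c ∘ ψ)) u :=
    (h.contDiffAt_pole.fderiv_right (m := 0) (by norm_cast)).continuousAt
  have hdet : ContinuousAt (fun u => (gramMatrix e (F.normalizedPole c ∘ ψ) u).det) u := by
    refine (continuous_id.matrix_det).continuousAt.comp
      (f := gramMatrix e (F.normalizedPole c ∘ ψ)) ?_
    refine continuousAt_pi.2 fun i => continuousAt_pi.2 fun j => ?_
    exact ((formL n).continuous.continuousAt.comp
      (hdc.clm_apply continuousAt_const)).clm_apply (hdc.clm_apply continuousAt_const)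
  have heq : localPole e (F.An ∘ ψ) (F.normalizedPole c ∘ ψ) =ᶠ[𝓝 u] Λ.harmonicPole ∘ ψ := by
    filter_upwards [hψ, hdet.eventually_ne hd] with u h1 h2 using h1.localPole_eq h2
  rw [heq.fderiv_eq, (hasFDerivAt_comp_of_mdifferentiableAt
    (mdiffAt_of_smoothOn F.isOpen_dom Λ.smooth_harmonicPole h.mem) h.mdifferentiableAt).fderiv]
  exact LinearMap.range_comp_of_range_eq_top _ (LinearMap.range_eq_top.2 h.surjective)

end AdaptedFrame

open AdaptedFrame

variable [IsManifold (𝓡 n) ∞ M]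

/-- The normalization is determined by the differential neighbourhood of third order. -/
theorem zeta_eq_of_sameThirdOrderJet (hn : 2 ≤ n) (hX : IsLightlikeHypersurface X)
    (hrank : HasMaximalRank X) {M' : Type u} [TopologicalSpace M']
    [ChartedSpace (EuclideanSpace ℝ (Fin n)) M'] [IsManifold (𝓡 n) ∞ M'] {X' : M' → ℙ ℝ (V n)}
    (hX' : IsLightlikeHypersurface X') (hrank' : HasMaximalRank X') {φ : M → M'}
    (hφ : IsLocalDiffeomorphAt (𝓡 n) (𝓡 n) ∞ φ p) (hj : SameThirdOrderJet X X' φ p) :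
    zeta X' (φ p) = zeta X p := by
  obtain ⟨O, x, O', x', hpO, hx, hpO', hx', hj⟩ := hj
  obtain ⟨F₀, -⟩ := hrank p
  obtain ⟨F₀', -⟩ := hrank' (φ p)
  -- The frames are arranged so that A_n is the very lift whose jets are compared.
  let F := F₀.withLift hx hpO
  let F' := F₀'.withLift hx' hpO'
  obtain ⟨Λ⟩ := nonempty_coeffs_of_hasMaximalRank hX hrank F
  obtain ⟨Λ'⟩ := nonempty_coeffs_of_hasMaximalRank hX' hrank' F'
  set ψ := (extChartAt (𝓡 n) p).symm with hψdef
  set a := extChartAt (𝓡 n) p p with ha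
  have hψa : ψ a = p := extChartAt_to_inv p
  obtain ⟨U, hU, hpU, hd⟩ := IsLocalDiffeomorphAt.exists_nhds hφ
  have hsψ : ∀ᶠ u in 𝓝 a, ContMDiffAt (𝓡 n) (𝓡 n) ∞ ψ u ∧
      Function.Surjective (paramDeriv ψ u) := by
    filter_upwards [(isOpen_extChartAt_target p).mem_nhds (mem_extChartAt_target p)] with u hu
    refine ⟨(contMDiffOn_extChartAt_symm p).contMDiffAt
      ((isOpen_extChartAt_target p).mem_nhds hu), ?_⟩
    rw [paramDeriv, (hasMFDerivAt_extChartAt_symm hu).mfderiv]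
    exact (isInvertible_chartInvDeriv hu).bijective.surjective
  have hsφ : ∀ᶠ u in 𝓝 a, ContMDiffAt (𝓡 n) (𝓡 n) ∞ (φ ∘ ψ) u ∧
      Function.Surjective (paramDeriv (φ ∘ ψ) u) := by
    have hc : ContinuousAt ψ a := (hsψ.self_of_nhds.1).continuousAt
    filter_upwards [hsψ, hc.eventually_mem (by rw [hψa]; exact hU.mem_nhds hpU)] with u hu hu'
    have hφu := hd _ hu'
    refine ⟨hφu.contMDiffAt.comp u hu.1, ?_⟩
    rw [paramDeriv, mfderiv_comp u (hφu.contMDiffAt.mdifferentiableAt (by simp))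
      (hu.1.mdifferentiableAt (by simp))]
    exact (IsLocalDiffeomorphAt.surjective_mfderiv hφu).comp hu.2
  have hparam : ∀ {M : Type u} [TopologicalSpace M] [ChartedSpace (EuclideanSpace ℝ (Fin n)) M]
      {X : M → ℙ ℝ (V n)} {p : M} (F : AdaptedFrame X p) (c : V n)
      {ψ : EuclideanSpace ℝ (Fin n) → M},
      (∀ᶠ u in 𝓝 a, ContMDiffAt (𝓡 n) (𝓡 n) ∞ ψ u ∧
        Function.Surjective (paramDeriv ψ u)) → ψ a = p → form n (F.A0 p) c ≠ 0 →
      ∀ᶠ u in 𝓝 a, F.IsParametrizedAt c ψ u := by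
    intro M _ _ X p F c ψ hs hp hne
    subst hp
    have hc : ContinuousAt ψ a := hs.self_of_nhds.1.continuousAt
    have hA : ContinuousAt (fun u => form n (F.A0 (ψ u)) c) a :=
      ((formL n).flip c).continuous.continuousAt.comp
        (ContinuousAt.comp (g := F.A0) (mdiff_A0 F.mem_dom).continuousAt hc)
    filter_upwards [hs, hc.eventually_mem (F.isOpen_dom.mem_nhds F.mem_dom),
      hA.eventually_ne hne] with u h1 h2 h3
    exact ⟨h1.1, h1.2, h2, h3⟩
  -- One fixed vector normalizes the poles of both hypersurfaces, so that they solve the same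
  -- equations.
  let c := F.Ainf p
  have hP := hparam F c hsψ hψa (by rw [F.form_A0_Ainf p F.mem_dom]; norm_num)
  have h := hP.self_of_nhds
  have hmem' : (φ ∘ ψ) a ∈ F'.dom := by
    change φ (ψ a) ∈ F'.dom
    rw [hψa]
    exact F'.mem_dom
  have hcx : ContDiffAt ℝ ∞ (F.An ∘ ψ) a := h.contDiffAt_comp F.smooth_An
  have hcx' : ContDiffAt ℝ ∞ (F'.An ∘ φ ∘ ψ) a :=
    ((F'.smooth_An.contMDiffAt (F'.isOpen_dom.mem_nhds hmem')).comp a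
      hsφ.self_of_nhds.1).contDiffAt
  obtain ⟨hx0, hx1, hx2⟩ := sameJet_of_iteratedFDeriv_eq hcx hcx' hj
  -- Equal 1-jets mean equal tangent hyperplanes, so A_0' is also orthogonal to the point and
  -- derivatives of X; were it orthogonal to c as well, it would vanish.
  have hne : form n (F'.A0 (φ p)) c ≠ 0 := by
    intro h0
    refine A0_ne_zero F'.mem_dom (h.eq_zero_of_orthogonal hX ?_ (fun v => ?_) h0)
    · rw [hx0.eq]
      change form n _ (F'.An (φ (ψ a))) = 0
      rw [hψa, F'.form_A0_An _ F'.mem_dom]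
    · rw [hx0.fderiv_eq, (hasFDerivAt_comp_of_mdifferentiableAt (mdiff_An hmem')
        (hsφ.self_of_nhds.1.mdifferentiableAt (by simp))).fderiv, form_symm]
      have := F'.tangent _ hmem' (paramDeriv (φ ∘ ψ) a v)
      change form n (mvfderiv (𝓡 n) F'.An _ _) (F'.A0 (φ (ψ a))) = 0 at this
      rwa [hψa] at this
  have hφψa : (φ ∘ ψ) a = φ p := congrArg φ hψa
  have hP' := hparam F' c hsφ hφψa hne
  have h' := hP'.self_of_nhds
  obtain ⟨hy, hdy⟩ := sameJet_pole hcx hcx' h.contDiffAt_pole h'.contDiffAt_pole hx0 hx1 hx2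
    (hP.mono fun _ h => h.pole_conditions) (hP'.mono fun _ h => h.pole_conditions)
    (fun z h0 h1 h2 => h.eq_zero_of_orthogonal hX h0 h1 h2)
  obtain ⟨e, he⟩ := h.exists_gramMatrix hX (F.isRegularAt hX hrank h.mem)
  have hG : gramMatrix e (F.normalizedPole c ∘ ψ) a
      = gramMatrix e (F'.normalizedPole c ∘ φ ∘ ψ) a := by
    ext i j
    exact congrArg₂ (fun y z => form n y z) (hdy (e i)).eq (hdy (e j)).eq
  rw [zeta_eq_wedge hn hX hrank Λ, zeta_eq_wedge hn hX' hrank' Λ',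
    Coeffs.wedge_eq_range hn hX (F.isRegularAt hX hrank F.mem_dom),
    Coeffs.wedge_eq_range hn hX' (F'.isRegularAt hX' hrank' F'.mem_dom),
    ← range_fderiv_localPole hP hψa he, ← range_fderiv_localPole hP' hφψa (hG ▸ he),
    (sameJet_localPole hx0 hx1 hy hdy he).fderiv_eq]

end ThirdOrder

end DeSitter

/-! ### The theorem. -/

theorem theorem6 (n : ℕ) (hn : 2 ≤ n) {M : Type u} [TopologicalSpace M] [T2Space M]
    [ChartedSpace (EuclideanSpace ℝ (Fin n)) M] [IsManifold (𝓡 n) ∞ M]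
    (X : M → ℙ ℝ (DeSitter.V n))
    (hX : DeSitter.IsLightlikeHypersurface X) (hrank : DeSitter.HasMaximalRank X)
    (ha : DeSitter.HasNondegenerateA X) :
    -- the construction: every adapted frame yields independent points `C_i`, which span `ζ`
    (∀ p, Nonempty (DeSitter.AdaptedFrame X p) ∧
      ∀ F : DeSitter.AdaptedFrame X p, Nonempty F.Coeffs ∧
        ∀ Λ : F.Coeffs, LinearIndependent ℝ Λ.point ∧ DeSitter.zeta X p = Λ.wedge ∧
          DeSitter.zeta X p = F.tangentV ⊓ Λ.tangentW) ∧
    -- `ζ` is a normalization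
    DeSitter.IsNormalization X (DeSitter.zeta X) ∧
    -- it is invariant under motions and reparametrizations and constant along the generators
    (∀ (M' : Type u) [TopologicalSpace M'] [T2Space M']
      [ChartedSpace (EuclideanSpace ℝ (Fin n)) M'] [IsManifold (𝓡 n) ∞ M']
      (X' : M' → ℙ ℝ (DeSitter.V n)), DeSitter.IsLightlikeHypersurface X' →
      DeSitter.HasMaximalRank X' →
      ∀ (T : DeSitter.V n ≃ₗ[ℝ] DeSitter.V n) (φ : M → M') (p : M), DeSitter.IsMotion T →
        IsLocalDiffeomorphAt (𝓡 n) (𝓡 n) ∞ φ p → DeSitter.CarriesGenerators X X' T φ p →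
        DeSitter.zeta X' (φ p) = (DeSitter.zeta X p).map T.toLinearMap) ∧
    -- it is determined by the differential neighbourhood of third order
    (∀ (M' : Type u) [TopologicalSpace M'] [T2Space M']
      [ChartedSpace (EuclideanSpace ℝ (Fin n)) M'] [IsManifold (𝓡 n) ∞ M']
      (X' : M' → ℙ ℝ (DeSitter.V n)), DeSitter.IsLightlikeHypersurface X' →
      DeSitter.HasMaximalRank X' →
      ∀ (φ : M → M') (p : M), IsLocalDiffeomorphAt (𝓡 n) (𝓡 n) ∞ φ p →
        DeSitter.SameThirdOrderJet X X' φ p →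
        DeSitter.zeta X' (φ p) = DeSitter.zeta X p) ∧
    -- it induces a screen distribution
    DeSitter.IsScreenDistribution X (DeSitter.screen X (DeSitter.zeta X)) ∧
    -- which is invariant
    (∀ (M' : Type u) [TopologicalSpace M'] [T2Space M']
      [ChartedSpace (EuclideanSpace ℝ (Fin n)) M'] [IsManifold (𝓡 n) ∞ M']
      (X' : M' → ℙ ℝ (DeSitter.V n)), DeSitter.IsLightlikeHypersurface X' →
      DeSitter.HasMaximalRank X' →
      ∀ (T : DeSitter.V n ≃ₗ[ℝ] DeSitter.V n) (φ : M → M') (p : M), DeSitter.IsMotion T →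
        IsLocalDiffeomorphAt (𝓡 n) (𝓡 n) ∞ φ p → DeSitter.CarriesPoints X X' T φ p →
        DeSitter.screen X' (DeSitter.zeta X') (φ p)
          = (DeSitter.screen X (DeSitter.zeta X) p).map
              (mfderiv (𝓡 n) (𝓡 n) φ p).toLinearMap) ∧
    -- it induces a torsion-free affine connection, which is invariant
    (∀ p, ∃ F : DeSitter.AdaptedFrame X p, F.IsReduced (DeSitter.zeta X)) ∧
    ∃ D : CovariantDerivative (𝓡 n) (EuclideanSpace ℝ (Fin n))
        (TangentSpace (𝓡 n) : M → Type _),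
      DeSitter.IsInducedConnection X (DeSitter.zeta X) D ∧
      CovariantDerivative.ContMDiffCovariantDerivative D ∞ ∧
      D.torsion = 0 ∧
      ∀ (M' : Type u) [TopologicalSpace M'] [T2Space M']
        [ChartedSpace (EuclideanSpace ℝ (Fin n)) M'] [IsManifold (𝓡 n) ∞ M']
        (X' : M' → ℙ ℝ (DeSitter.V n)), DeSitter.IsLightlikeHypersurface X' →
        DeSitter.HasMaximalRank X' →
        ∀ D' : CovariantDerivative (𝓡 n) (EuclideanSpace ℝ (Fin n))
            (TangentSpace (𝓡 n) : M' → Type _),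
          DeSitter.IsInducedConnection X' (DeSitter.zeta X') D' →
          ∀ (T : DeSitter.V n ≃ₗ[ℝ] DeSitter.V n) (φ : M → M') (p : M), DeSitter.IsMotion T →
            IsLocalDiffeomorphAt (𝓡 n) (𝓡 n) ∞ φ p → DeSitter.CarriesPoints X X' T φ p →
            ∀ Y : (q : M') → TangentSpace (𝓡 n) q,
              MDifferentiableAt (𝓡 n) (𝓡 n).tangent
                (fun q => (⟨q, Y q⟩ : TangentBundle (𝓡 n) M')) (φ p) →
              ∀ v : TangentSpace (𝓡 n) p,
                mfderiv (𝓡 n) (𝓡 n) φ p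
                    (D.toFun (VectorField.mpullback (𝓡 n) (𝓡 n) φ Y) p v)
                  = D'.toFun Y (φ p) (mfderiv (𝓡 n) (𝓡 n) φ p v) := by
  have hred : ∀ p, ∃ F : DeSitter.AdaptedFrame X p, F.IsReduced (DeSitter.zeta X) := fun p => by
    obtain ⟨F, L, hL, hd⟩ := ha p
    exact DeSitter.exists_isReduced hn hX hrank hL hd
  obtain ⟨D, hD⟩ := DeSitter.exists_isInducedConnection hn hX hrank hred
  refine ⟨fun p => ⟨⟨(ha p).choose⟩, fun F =>
    ⟨DeSitter.nonempty_coeffs_of_hasMaximalRank hX hrank F, fun Λ => ?_⟩⟩,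
    DeSitter.isNormalization_zeta hn hX hrank ha, ?_, ?_,
    DeSitter.isScreenDistribution hn hX hrank ha, ?_, hred, D, hD, hD.contMDiff hX hred,
    hD.torsion_eq_zero hX hred, ?_⟩
  · have hr := F.isRegularAt hX hrank F.mem_dom
    have hz := DeSitter.zeta_eq_wedge hn hX hrank Λ
    exact ⟨DeSitter.AdaptedFrame.Coeffs.linearIndependent_point hn hX hr
      (DeSitter.det_aTensor_ne_zero hn hX hrank ha F F.mem_dom (Λ.isLambda p F.mem_dom)), hz,
      hz.trans (DeSitter.AdaptedFrame.Coeffs.wedge_eq_inf hn hX hr)⟩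
  · intro M' _ _ _ _ X' hX' hrank' T φ p hT hφ hg
    exact DeSitter.zeta_eq_map hn hX hrank hX' hrank' hT hφ hg
  · intro M' _ _ _ _ X' hX' hrank' φ p hφ hj
    exact DeSitter.zeta_eq_of_sameThirdOrderJet hn hX hrank hX' hrank' hφ hj
  · intro M' _ _ _ _ X' hX' hrank' T φ p hT hφ hc
    exact DeSitter.screen_eq_map hn hX hrank hX' hrank' hT hφ hc
  -- The case X' = X, T = 1, φ = id of this clause is the uniqueness of the connection.
  · intro M' _ _ _ _ X' hX' hrank' D' hD' T φ p hT hφ hc Y hY v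
    exact hD.mfderiv_eq hn hX hrank ha hX' hrank' hD' hT hφ hc hY v
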